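/- Let $K$ be a field of characteristic $0$. Let $X$ be a topological space with a base point $x_0\in X$, and suppose that $\mathrm{cat}_{LS}(X)\le 1$. Here $\mathrm{cat}_{LS}(X)$ is the least integer $n\ge 0$ such that $X$ is covered by $n+1$ open subsets whose inclusions into $X$ are null-homotopic (it is $\infty$ if there is no such $n$). Then the augmented singular cochain dg-algebra $\widetilde C^*(X;K)$ is formal. Here dg-algebras are $\mathbb Z$-graded, associative and not necessarily unital, and the terms are understood as follows. (a) The underlying complex of $\widetilde C^*(X;K)$ is $$\cdots\to 0\to K\xrightarrow{\ \epsilon\ }C^0(X;K)\to C^1(X;K)\to\cdots ,$$ where $K$ stands in degree $-1$, $\epsilon(c)$ is the constant $0$-cochain with value $c$, and $C^*(X;K)$ is the complex of singular cochains. Its cohomology is the reduced cohomology $\widetilde H^*(X;K)$. It is the direct sum of the ideal $I\subset C^*(X;K)$ of the cochains that vanish on the $0$-simplex $x_0$ and of the acyclic complex $K\xrightarrow{\epsilon}K\cdot 1$. The product of $\widetilde C^*(X;K)$ is the cup product on $I$, and it is zero when one of the factors lies in $K\xrightarrow{\epsilon}K\cdot 1$. (b) A dg-algebra $A$ is an $A_\infty$-algebra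 with $m_1=d$, $m_2$ the product and $m_n=0$ for $n\ge 3$. An $A_\infty$-morphism $f\colon H\to A$ is a family of linear maps $f_n\colon H^{\otimes n}\to A$ ($n\ge 1$) of degree $1-n$ such that for all $n\ge 1$ $$\sum_{r+s+t=n,\ s\ge 1}(-1)^{r+st}f_{r+1+t}\,(\mathrm{id}^{\otimes r}\otimes m_s\otimes \mathrm{id}^{\otimes t})=\sum_{k=1}^{n}\ \sum_{i_1+\cdots+i_k=n}(-1)^{u}\,m_k\,(f_{i_1}\otimes\cdots\otimes f_{i_k}),\qquad u=\sum_{t=1}^{k-1}t\,(i_{k-t}-1),$$ with the Koszul sign rule on elements. It is a quasi-isomorphism if $f_1$ induces an isomorphism in cohomology. $A$ is formal if there are a dg-algebra $H$ with zero differential and an $A_\infty$-quasi-isomorphism $H\to A$. -/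

import Mathlib

open CategoryTheory Finset

universe u v w w'

/-- Replace the block `v r, …, v (r + s - 1)` of a sequence by the single entry `x`. -/
def spliceSeq {V : Type w} (v : ℕ → V) (r s : ℕ) (x : V) : ℕ → V :=
  fun i => if i < r then v i else if i = r then x else v (i - 1 + s)

/-- An `A_∞`-algebra over `K`: a `ℤ`-graded vector space `carrier = ⨁ gr i` with linear maps
`m n : carrier^{⊗ n} → carrier` (`n ≥ 1`) of degree `2 - n` such that, for all `n`,
`∑_{r+s+t=n, s ≥ 1} (-1)^{r+st} m_{r+1+t} (id^{⊗ r} ⊗ m_s ⊗ id^{⊗ t}) = 0`.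
The identity is evaluated on homogeneous elements `v 0, …, v (n-1)` of degrees
`deg 0, …, deg (n-1)`; by the Koszul rule, moving `m_s` past the first `r` of them contributes
the sign `(-1)^{(2-s)(deg 0 + ⋯ + deg (r-1))}`. There is no operation of arity `0`, which is
recorded as `m 0 = 0`. -/
structure AInfAlgebra (K : Type v) [Field K] where
  carrier : Type w
  [addCommGroup : AddCommGroup carrier]
  [module : Module K carrier]
  gr : ℤ → Submodule K carrier
  isInternal : DirectSum.IsInternal gr
  m : (n : ℕ) → MultilinearMap K (fun _ : Fin n => carrier) carrier
  m_zero : m 0 = 0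
  m_mem : ∀ (n : ℕ) (v : Fin n → carrier) (deg : Fin n → ℤ), (∀ i, v i ∈ gr (deg i)) →
    m n v ∈ gr (∑ i, deg i + 2 - n)
  stasheff : ∀ (n : ℕ) (v : ℕ → carrier) (deg : ℕ → ℤ), (∀ i, v i ∈ gr (deg i)) →
    ∑ x ∈ antidiagonal n, ∑ y ∈ antidiagonal x.2 with 1 ≤ y.1,
      (((x.1 : ℤ) + y.1 * y.2) + (2 - (y.1 : ℤ)) * ∑ l ∈ range x.1, deg l).negOnePow •
        m (x.1 + 1 + y.2) (fun i =>
          spliceSeq v x.1 y.1 (m y.1 (fun j => v (x.1 + j))) i) = 0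

attribute [instance] AInfAlgebra.addCommGroup AInfAlgebra.module

namespace AInfAlgebra

variable {K : Type v} [Field K]

/-- The differential `m_1`. -/
def d (A : AInfAlgebra.{v, w} K) : A.carrier →ₗ[K] A.carrier :=
  (MultilinearMap.ofSubsingleton K A.carrier A.carrier (0 : Fin 1)).symm (A.m 1)

/-- The cohomology `ker m_1 / im m_1`. -/
abbrev Cohomology (A : AInfAlgebra.{v, w} K) : Type w :=
  LinearMap.ker A.d ⧸ (LinearMap.range A.d).comap (LinearMap.ker A.d).subtype

/-- An `A_∞`-morphism `A → B`: linear maps `f n : A^{⊗ n} → B` (`n ≥ 1`) of degree `1 - n` with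
`∑_{r+s+t=n, s ≥ 1} (-1)^{r+st} f_{r+1+t} (id^{⊗ r} ⊗ m_s ⊗ id^{⊗ t})
  = ∑_{k, i_1+⋯+i_k=n} (-1)^{u} m_k (f_{i_1} ⊗ ⋯ ⊗ f_{i_k})`, where
`u = ∑_{t=1}^{k-1} t (i_{k-t} - 1)`. As above the identity is evaluated on homogeneous elements
with the Koszul signs; on the right, the map of degree `1 - i_j` moves past all the elements that
belong to the earlier blocks. The tuples `(i_1, …, i_k)` of positive integers with sum `n` are
the compositions of `n`; with blocks indexed from `0`, the block `j` has size `c.blocksFun j`, it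
starts at position `c.sizeUpTo j`, and it enters `u` with the weight `k - 1 - j`. -/
structure Hom (A : AInfAlgebra.{v, w} K) (B : AInfAlgebra.{v, w'} K) where
  f : (n : ℕ) → MultilinearMap K (fun _ : Fin n => A.carrier) B.carrier
  f_zero : f 0 = 0
  f_mem : ∀ (n : ℕ) (v : Fin n → A.carrier) (deg : Fin n → ℤ), (∀ i, v i ∈ A.gr (deg i)) →
    f n v ∈ B.gr (∑ i, deg i + 1 - n)
  relation : ∀ (n : ℕ) (v : ℕ → A.carrier) (deg : ℕ → ℤ), 1 ≤ n → (∀ i, v i ∈ A.gr (deg i)) →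
    ∑ x ∈ antidiagonal n, ∑ y ∈ antidiagonal x.2 with 1 ≤ y.1,
      (((x.1 : ℤ) + y.1 * y.2) + (2 - (y.1 : ℤ)) * ∑ l ∈ range x.1, deg l).negOnePow •
        f (x.1 + 1 + y.2) (fun i =>
          spliceSeq v x.1 y.1 (A.m y.1 (fun j => v (x.1 + j))) i) =
    ∑ c : Composition n,
      ((∑ j : Fin c.length, ((c.length : ℤ) - 1 - j) * ((c.blocksFun j : ℤ) - 1)) +
        ∑ j : Fin c.length, (1 - (c.blocksFun j : ℤ)) *
          ∑ l ∈ range (c.sizeUpTo j), deg l).negOnePow •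
        B.m c.length (fun j => f (c.blocksFun j) (fun i => v (c.sizeUpTo j + i)))

namespace Hom

variable {A : AInfAlgebra.{v, w} K} {B : AInfAlgebra.{v, w'} K}

/-- The linear component `f_1`. -/
def linear (F : Hom A B) : A.carrier →ₗ[K] B.carrier :=
  (MultilinearMap.ofSubsingleton K A.carrier B.carrier (0 : Fin 1)).symm (F.f 1)

theorem sum_mem_of_mem {A : AInfAlgebra.{v, w} K} (x : A.carrier) :
    x ∈ ⨆ i, A.gr i := by
  rw [A.isInternal.submodule_iSup_eq_top]
  trivial

/-- `f_1` is a cochain map. -/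
theorem linear_d (F : Hom A B) (x : A.carrier) : F.linear (A.d x) = B.d (F.linear x) := by
  have hx := sum_mem_of_mem x
  induction hx using Submodule.iSup_induction' with
  | zero => simp
  | add x y _ _ hx hy => simp [hx, hy]
  | mem i x hx =>
    have h := F.relation 1 (fun _ => x) (fun _ => i) le_rfl (fun _ => hx)
    have hu : ∀ c : Composition 1, c = Composition.single 1 one_pos := fun c =>
      (Fintype.card_le_one_iff_subsingleton.1 (by simp [composition_card])).elim _ _
    rw [Fintype.sum_eq_single (Composition.single 1 one_pos) (fun c hc => (hc (hu c)).elim)] at h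
    simp [Finset.Nat.antidiagonal_succ, Finset.sum_filter, spliceSeq] at h
    have e : (fun i : Fin 1 => if i = 0 then (A.m 1) fun _ => x else x) =
        fun _ => (A.m 1) fun _ => x := by
      funext i
      simp [Subsingleton.elim i 0]
    rw [e] at h
    refine h.trans (congrArg (B.m 1) (funext fun j : Fin 1 => ?_))
    fin_cases j
    rfl

/-- The map induced by `f_1` in cohomology. -/
def cohomologyMap (F : Hom A B) : A.Cohomology →ₗ[K] B.Cohomology :=
  Submodule.mapQ _ _
    (F.linear.restrict (p := LinearMap.ker A.d) (q := LinearMap.ker B.d) (fun x hx => by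
      rw [LinearMap.mem_ker] at hx ⊢
      rw [← F.linear_d, hx, map_zero]))
    (by
      rintro ⟨x, hx⟩ ⟨y, hy⟩
      exact ⟨F.linear y, by rw [← F.linear_d, hy]; rfl⟩)

/-- `F` is an `A_∞`-quasi-isomorphism: `f_1` induces an isomorphism in cohomology. -/
def IsQuasiIso (F : Hom A B) : Prop :=
  Function.Bijective F.cohomologyMap

end Hom

end AInfAlgebra

/-- A (not necessarily unital) dg-algebra over `K`, cohomologically graded. -/
structure DGAlgebra (K : Type v) [Field K] where
  carrier : Type w
  [addCommGroup : AddCommGroup carrier]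
  [module : Module K carrier]
  gr : ℤ → Submodule K carrier
  isInternal : DirectSum.IsInternal gr
  d : carrier →ₗ[K] carrier
  mul : carrier →ₗ[K] carrier →ₗ[K] carrier
  d_mem : ∀ (i : ℤ) (a : carrier), a ∈ gr i → d a ∈ gr (i + 1)
  mul_mem : ∀ (i j : ℤ) (a b : carrier), a ∈ gr i → b ∈ gr j → mul a b ∈ gr (i + j)
  d_d : ∀ a, d (d a) = 0
  mul_assoc : ∀ a b c, mul (mul a b) c = mul a (mul b c)
  leibniz : ∀ (i : ℤ) (a b : carrier), a ∈ gr i →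
    d (mul a b) = mul (d a) b + i.negOnePow • mul a (d b)

attribute [instance] DGAlgebra.addCommGroup DGAlgebra.module

namespace DGAlgebra

variable {K : Type v} [Field K]

/-- The product, as a multilinear map of two variables. -/
def mulMultilinear (A : DGAlgebra.{v, w} K) :
    MultilinearMap K (fun _ : Fin 2 => A.carrier) A.carrier where
  toFun v := A.mul (v 0) (v 1)
  map_update_add' v i x y := by
    fin_cases i <;> simp [Function.update]
  map_update_smul' v i c x := by
    fin_cases i <;> simp [Function.update]

/-- The operations of a dg-algebra as an `A_∞`-algebra: `m_1 = d`, `m_2` is the product, and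
`m_n = 0` for `n ≥ 3`. -/
def ops (A : DGAlgebra.{v, w} K) : (n : ℕ) → MultilinearMap K (fun _ : Fin n => A.carrier) A.carrier
  | 1 => MultilinearMap.ofSubsingleton K A.carrier A.carrier (0 : Fin 1) A.d
  | 2 => A.mulMultilinear
  | _ => 0

theorem ops_one (A : DGAlgebra.{v, w} K) (v : Fin 1 → A.carrier) : A.ops 1 v = A.d (v 0) := rfl

theorem ops_two (A : DGAlgebra.{v, w} K) (v : Fin 2 → A.carrier) :
    A.ops 2 v = A.mul (v 0) (v 1) := rfl

theorem ops_eq_zero (A : DGAlgebra.{v, w} K) (n : ℕ) (hn : n = 0 ∨ 3 ≤ n) : A.ops n = 0 := by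
  match n, hn with
  | 0, _ => rfl
  | n + 3, _ => rfl

/-- A dg-algebra, regarded as an `A_∞`-algebra. -/
def toAInf (A : DGAlgebra.{v, w} K) : AInfAlgebra.{v, w} K where
  carrier := A.carrier
  gr := A.gr
  isInternal := A.isInternal
  m := A.ops
  m_zero := rfl
  m_mem n v deg hv := by
    match n with
    | 0 => rw [ops_eq_zero _ _ (Or.inl rfl)]; simp
    | 1 =>
      rw [ops_one]
      convert A.d_mem _ _ (hv 0) using 2
      simp
      ring
    | 2 =>
      rw [ops_two]
      convert A.mul_mem _ _ _ _ (hv 0) (hv 1) using 2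
      simp
    | n + 3 => rw [ops_eq_zero _ _ (Or.inr (by omega))]; simp
  stasheff n v deg hv := by
    match n with
    | 0 => simp [Finset.sum_filter]
    | 1 =>
      simp [Finset.Nat.antidiagonal_succ, Finset.sum_filter, spliceSeq, ops_one, A.d_d]
    | 2 =>
      have h := A.leibniz _ _ (v 1) (hv 0)
      simp [Finset.Nat.antidiagonal_succ, Finset.sum_filter, spliceSeq, ops_one, ops_two]
      rw [h, add_comm 1 (deg 0), Int.negOnePow_succ, Units.neg_smul]
      abel
    | 3 =>
      have h := A.mul_assoc (v 0) (v 1) (v 2)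
      simp [Finset.Nat.antidiagonal_succ, Finset.sum_filter, spliceSeq, ops_one, ops_two]
      simp [h, ops_eq_zero A 3 (Or.inr le_rfl), show (2 : ℤ).negOnePow = 1 from rfl]
    | n + 4 =>
      refine Finset.sum_eq_zero fun x hx => Finset.sum_eq_zero fun y hy => ?_
      rw [Finset.HasAntidiagonal.mem_antidiagonal] at hx
      rw [Finset.mem_filter, Finset.HasAntidiagonal.mem_antidiagonal] at hy
      by_cases h : 3 ≤ y.1
      · rw [ops_eq_zero A y.1 (Or.inr h)]
        rw [MultilinearMap.map_coord_zero (i := ⟨x.1, by omega⟩), smul_zero]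
        simp [spliceSeq]
      · rw [ops_eq_zero A (x.1 + 1 + y.2) (Or.inr (by omega))]
        simp

/-- A dg-algebra is formal if it is `A_∞`-quasi-isomorphic to a dg-algebra with trivial
differential. -/
def IsFormal (A : DGAlgebra.{v, w} K) : Prop :=
  ∃ H : DGAlgebra.{v, w} K, H.d = 0 ∧
    ∃ F : AInfAlgebra.Hom H.toAInf A.toAInf, F.IsQuasiIso

end DGAlgebra

section Cochains

open Simplicial

variable (K : Type v) [Field K] (S : SSet.{u})

/-- The cochains of a simplicial set with values in `K`, all degrees together: families of
functions `φ n` on the `n`-simplices, only finitely many of them non-zero. This is the direct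
sum of the spaces `C^n(S; K)` of all functions on the `n`-simplices. -/
def cochains : Submodule K ((n : ℕ) → S _⦋n⦌ → K) where
  carrier := {φ | ∃ N, ∀ n, N ≤ n → φ n = 0}
  add_mem' := by
    rintro φ ψ ⟨N, hN⟩ ⟨M, hM⟩
    exact ⟨max N M, fun n hn => by
      simp [hN n (le_trans (le_max_left _ _) hn), hM n (le_trans (le_max_right _ _) hn)]⟩
  zero_mem' := ⟨0, fun _ _ => rfl⟩
  smul_mem' := by
    rintro c φ ⟨N, hN⟩
    exact ⟨N, fun n hn => by simp [hN n hn]⟩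

variable {S}

/-- The monotone map `[k] → [n]`, `i ↦ a + i`. (It is only used for `a + k ≤ n`; in general it
is truncated at `n`.) -/
def intervalMap (n a k : ℕ) : ⦋k⦌ ⟶ ⦋n⦌ :=
  SimplexCategory.mkHom
    ⟨fun i => ⟨min (a + i) n, by omega⟩, fun i j h => by
      have : (i : ℕ) ≤ j := h
      simp only [Fin.mk_le_mk]
      omega⟩

/-- The face of the simplex `σ` spanned by its vertices `a, a + 1, …, a + k`. -/
def intervalFace {n : ℕ} (σ : S _⦋n⦌) (a k : ℕ) : S _⦋k⦌ :=
  S.map (intervalMap n a k).op σ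

variable {K}

/-- The differential of cochains, the alternating sum over the faces. -/
def cochainD (φ : (n : ℕ) → S _⦋n⦌ → K) : (n : ℕ) → S _⦋n⦌ → K := fun n =>
  match n with
  | 0 => 0
  | n + 1 => fun σ => ∑ j : Fin (n + 2), (-1 : K) ^ (j : ℕ) * φ n (S.δ j σ)

/-- The cup product of cochains: front face times back face. -/
def cup (φ ψ : (n : ℕ) → S _⦋n⦌ → K) (n : ℕ) (σ : S _⦋n⦌) : K :=
  ∑ x ∈ antidiagonal n, φ x.1 (intervalFace σ 0 x.1) * ψ x.2 (intervalFace σ x.1 x.2)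

theorem cochainD_cochainD (φ : (n : ℕ) → S _⦋n⦌ → K) : cochainD (cochainD φ) = 0 := by
  funext n σ
  match n with
  | 0 => rfl
  | 1 => simp [cochainD]
  | n + 2 =>
    simp only [cochainD, Finset.mul_sum, Pi.zero_apply]
    rw [Finset.sum_comm, ← Finset.sum_product', Finset.univ_product_univ]
    let T : Finset (Fin (n + 2) × Fin (n + 3)) := {ij | (ij.2 : ℕ) ≤ (ij.1 : ℕ)}
    rw [← Finset.sum_add_sum_compl T, ← eq_neg_iff_add_eq_zero, ← Finset.sum_neg_distrib]
    have hT : ∀ ij, ij ∈ T ↔ (ij.2 : ℕ) ≤ (ij.1 : ℕ) := by simp [T]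
    refine Finset.sum_bij
      (fun ij hij => (Fin.castLT ij.2 (lt_of_le_of_lt ((hT _).1 hij) ij.1.is_lt), ij.1.succ))
      ?_ ?_ ?_ ?_
    · intro ij hij
      rw [Finset.mem_compl, hT]
      rw [hT] at hij
      simp
      omega
    · rintro ⟨i, j⟩ hij ⟨i', j'⟩ hij' h
      simp only [Prod.mk.injEq, Fin.ext_iff, Fin.val_castLT] at h ⊢
      exact ⟨by simpa using h.2, h.1⟩
    · rintro ⟨i', j'⟩ hij'
      rw [Finset.mem_compl, hT, not_le] at hij'
      have h0 : j' ≠ 0 := by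
        rintro rfl
        simp at hij'
      refine ⟨(j'.pred h0, i'.castSucc), ?_, ?_⟩
      · rw [hT]
        simp
        simp at hij'
        omega
      · simp
    · rintro ⟨i, j⟩ hij
      rw [hT] at hij
      have h1 : S.δ i (S.δ j σ) =
          S.δ (Fin.castLT j (lt_of_le_of_lt hij i.is_lt)) (S.δ i.succ σ) :=
        (congrArg (fun f => f σ)
          (SimplicialObject.δ_comp_δ'' (X := S) (i := j) (j := i) hij)).symm
      simp only [h1, Fin.val_castLT, Fin.val_succ, pow_succ]
      ring

theorem simplexHom_ext {k n : ℕ} {f g : ⦋k⦌ ⟶ ⦋n⦌}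
    (h : ∀ i : Fin (k + 1), (f.toOrderHom i : ℕ) = (g.toOrderHom i : ℕ)) : f = g := by
  ext i
  exact h i

theorem simplexHom_comp {k n l : ℕ} (f : ⦋k⦌ ⟶ ⦋n⦌) (g : ⦋n⦌ ⟶ ⦋l⦌) (i : Fin (k + 1)) :
    (f ≫ g).toOrderHom i = g.toOrderHom (f.toOrderHom i) := rfl

theorem intervalMap_val (n a k : ℕ) (i : Fin (k + 1)) :
    (((intervalMap n a k).toOrderHom i : Fin (n + 1)) : ℕ) = min (a + i) n := rfl

theorem δ_val {n : ℕ} (j : Fin (n + 2)) (i : Fin (n + 1)) :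
    (((SimplexCategory.δ j).toOrderHom i : Fin (n + 2)) : ℕ) =
      if (i : ℕ) < j then (i : ℕ) else i + 1 := by
  change ((j.succAbove i : Fin (n + 2)) : ℕ) = _
  simp only [Fin.succAbove, Fin.lt_def, Fin.val_castSucc]
  split_ifs <;> simp

theorem intervalFace_intervalFace {n : ℕ} (σ : S _⦋n⦌) (a k b l : ℕ) (h : b + l ≤ k) :
    intervalFace (intervalFace σ a k) b l = intervalFace σ (a + b) l := by
  have e : intervalMap k b l ≫ intervalMap n a k = intervalMap n (a + b) l := by
    refine simplexHom_ext fun k => ?_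
    have := k.is_lt
    simp only [simplexHom_comp, intervalMap_val]
    grind
  simp only [intervalFace, ← e, op_comp, Functor.map_comp_apply]

theorem cup_assoc (φ ψ χ : (n : ℕ) → S _⦋n⦌ → K) :
    cup (cup φ ψ) χ = cup φ (cup ψ χ) := by
  funext n σ
  simp only [cup, Finset.sum_mul, Finset.mul_sum, Finset.sum_sigma']
  refine Finset.sum_bij'
    (fun x _ => ⟨(x.2.1, x.2.2 + x.1.2), (x.2.2, x.1.2)⟩)
    (fun x _ => ⟨(x.1.1 + x.2.1, x.2.2), (x.1.1, x.2.1)⟩) ?_ ?_ ?_ ?_ ?_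
  · rintro ⟨⟨a, b⟩, c, e⟩ h
    simp at h ⊢
    omega
  · rintro ⟨⟨a, b⟩, c, e⟩ h
    simp at h ⊢
    omega
  · rintro ⟨⟨a, b⟩, c, e⟩ h
    simp at h ⊢
    omega
  · rintro ⟨⟨a, b⟩, c, e⟩ h
    simp at h ⊢
    omega
  · rintro ⟨⟨a, b⟩, c, e⟩ h
    simp only [Finset.mem_sigma, Finset.HasAntidiagonal.mem_antidiagonal] at h
    obtain ⟨h1, rfl⟩ := h
    dsimp only
    rw [intervalFace_intervalFace _ _ _ _ _ (by omega),
      intervalFace_intervalFace _ _ _ _ _ (by omega),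
      intervalFace_intervalFace _ _ _ _ _ (by omega),
      intervalFace_intervalFace _ _ _ _ _ (by omega)]
    simp only [zero_add, add_zero, mul_assoc]

theorem intervalFace_δ_of_le {p q : ℕ} (σ : S _⦋p + q + 1⦌) (i : Fin (p + q + 2))
    (hi : (i : ℕ) ≤ p) :
    intervalFace (S.δ i σ) 0 p = S.δ ⟨i, by omega⟩ (intervalFace σ 0 (p + 1)) ∧
      intervalFace (S.δ i σ) p q = intervalFace σ (p + 1) q := by
  have e1 : intervalMap (p + q) 0 p ≫ SimplexCategory.δ i =
      SimplexCategory.δ (n := p) ⟨i, by omega⟩ ≫ intervalMap (p + q + 1) 0 (p + 1) := by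
    refine simplexHom_ext fun k => ?_
    have := k.is_lt
    simp only [simplexHom_comp, intervalMap_val, δ_val]
    grind
  have e2 : intervalMap (p + q) p q ≫ SimplexCategory.δ i =
      intervalMap (p + q + 1) (p + 1) q := by
    refine simplexHom_ext fun k => ?_
    have := k.is_lt
    simp only [simplexHom_comp, intervalMap_val, δ_val]
    grind
  constructor
  · change S.map _ (S.map _ σ) = S.map _ (S.map _ σ)
    rw [← Functor.map_comp_apply, ← Functor.map_comp_apply, ← op_comp, ← op_comp, e1]
  · change S.map _ (S.map _ σ) = S.map _ σ
    rw [← Functor.map_comp_apply, ← op_comp, e2]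

theorem intervalFace_δ_of_gt {p q : ℕ} (σ : S _⦋p + q + 1⦌) (j : Fin (q + 2)) (hj : 1 ≤ (j : ℕ)) :
    intervalFace (S.δ (n := p + q) ⟨p + j, by omega⟩ σ) 0 p = intervalFace σ 0 p ∧
      intervalFace (S.δ (n := p + q) ⟨p + j, by omega⟩ σ) p q =
        S.δ j (intervalFace σ p (q + 1)) := by
  have e1 : intervalMap (p + q) 0 p ≫ SimplexCategory.δ (n := p + q) ⟨p + j, by omega⟩ =
      intervalMap (p + q + 1) 0 p := by
    refine simplexHom_ext fun k => ?_
    have := k.is_lt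
    simp only [simplexHom_comp, intervalMap_val, δ_val]
    grind
  have e2 : intervalMap (p + q) p q ≫ SimplexCategory.δ (n := p + q) ⟨p + j, by omega⟩ =
      SimplexCategory.δ j ≫ intervalMap (p + q + 1) p (q + 1) := by
    refine simplexHom_ext fun k => ?_
    have := k.is_lt
    simp only [simplexHom_comp, intervalMap_val, δ_val]
    grind
  constructor
  · change S.map _ (S.map _ σ) = S.map _ σ
    rw [← Functor.map_comp_apply, ← op_comp, e1]
  · change S.map _ (S.map _ σ) = S.map _ (S.map _ σ)
    rw [← Functor.map_comp_apply, ← Functor.map_comp_apply, ← op_comp, ← op_comp, e2]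

theorem δ_last_intervalFace {n : ℕ} (σ : S _⦋n⦌) (p : ℕ) :
    S.δ (Fin.last (p + 1)) (intervalFace σ 0 (p + 1)) = intervalFace σ 0 p := by
  have e : SimplexCategory.δ (Fin.last (p + 1)) ≫ intervalMap n 0 (p + 1) =
      intervalMap n 0 p := by
    refine simplexHom_ext fun k => ?_
    have := k.is_lt
    simp only [simplexHom_comp, intervalMap_val, δ_val]
    grind
  change S.map _ (S.map _ σ) = S.map _ σ
  rw [← Functor.map_comp_apply, ← op_comp, e]

theorem δ_zero_intervalFace {n : ℕ} (σ : S _⦋n⦌) (p q : ℕ) :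
    S.δ (0 : Fin (q + 2)) (intervalFace σ p (q + 1)) = intervalFace σ (p + 1) q := by
  have e : SimplexCategory.δ (0 : Fin (q + 2)) ≫ intervalMap n p (q + 1) =
      intervalMap n (p + 1) q := by
    refine simplexHom_ext fun k => ?_
    have := k.is_lt
    simp only [simplexHom_comp, intervalMap_val, δ_val]
    grind
  change S.map _ (S.map _ σ) = S.map _ σ
  rw [← Functor.map_comp_apply, ← op_comp, e]

theorem leibniz_aux (p q : ℕ) (φ : S _⦋p⦌ → K) (ψ : S _⦋q⦌ → K) (σ : S _⦋p + q + 1⦌) :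
    ∑ i : Fin (p + q + 2), (-1 : K) ^ (i : ℕ) *
        (φ (intervalFace (S.δ i σ) 0 p) * ψ (intervalFace (S.δ i σ) p q)) =
      (∑ i : Fin (p + 2), (-1 : K) ^ (i : ℕ) * φ (S.δ i (intervalFace σ 0 (p + 1)))) *
          ψ (intervalFace σ (p + 1) q) +
        (-1 : K) ^ p * (φ (intervalFace σ 0 p) *
          ∑ j : Fin (q + 2), (-1 : K) ^ (j : ℕ) * ψ (S.δ j (intervalFace σ p (q + 1)))) := by
  rw [Fin.sum_univ_castSucc (n := p + 1), Fin.sum_univ_succ (n := q + 1), δ_last_intervalFace,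
    δ_zero_intervalFace]
  have e : p + q + 2 = (p + 1) + (q + 1) := by omega
  rw [← (finCongr e.symm).sum_comp, Fin.sum_univ_add]
  have h1 : ∀ i : Fin (p + 1),
      (-1 : K) ^ ((finCongr e.symm (Fin.castAdd (q + 1) i) : Fin _) : ℕ) *
        (φ (intervalFace (S.δ (finCongr e.symm (Fin.castAdd (q + 1) i)) σ) 0 p) *
          ψ (intervalFace (S.δ (finCongr e.symm (Fin.castAdd (q + 1) i)) σ) p q)) =
      ((-1 : K) ^ (i.castSucc : ℕ) * φ (S.δ i.castSucc (intervalFace σ 0 (p + 1)))) *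
        ψ (intervalFace σ (p + 1) q) := by
    intro i
    obtain ⟨a, b⟩ := intervalFace_δ_of_le σ (finCongr e.symm (Fin.castAdd (q + 1) i))
      (by simp; omega)
    rw [a, b, mul_assoc]
    rfl
  have h2 : ∀ j : Fin (q + 1),
      (-1 : K) ^ ((finCongr e.symm (Fin.natAdd (p + 1) j) : Fin _) : ℕ) *
        (φ (intervalFace (S.δ (finCongr e.symm (Fin.natAdd (p + 1) j)) σ) 0 p) *
          ψ (intervalFace (S.δ (finCongr e.symm (Fin.natAdd (p + 1) j)) σ) p q)) =
      (-1 : K) ^ p * (φ (intervalFace σ 0 p) *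
        ((-1 : K) ^ (j.succ : ℕ) * ψ (S.δ j.succ (intervalFace σ p (q + 1))))) := by
    intro j
    obtain ⟨a, b⟩ := intervalFace_δ_of_gt σ j.succ (by simp)
    have hj : (finCongr e.symm (Fin.natAdd (p + 1) j) : Fin _) =
        ⟨p + (j.succ : ℕ), by have := j.succ.is_lt; omega⟩ := by
      ext
      simp
      omega
    rw [hj, a, b]
    simp only [pow_add]
    ring
  rw [Finset.sum_congr rfl (fun i _ => h1 i), Finset.sum_congr rfl (fun j _ => h2 j),
    ← Finset.sum_mul, ← Finset.mul_sum, ← Finset.mul_sum]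
  simp only [Fin.val_last, Fin.val_zero, pow_succ, pow_zero]
  ring

theorem cochainD_cup (i : ℤ) (φ ψ : (n : ℕ) → S _⦋n⦌ → K) (hφ : ∀ n : ℕ, (n : ℤ) ≠ i → φ n = 0) :
    cochainD (cup φ ψ) = cup (cochainD φ) ψ + i.negOnePow • cup φ (cochainD ψ) := by
  funext n σ
  match n with
  | 0 => simp [cochainD, cup]
  | n + 1 =>
    have hs : ∀ x : K, i.negOnePow • x = ((i.negOnePow : ℤ) : K) * x := fun x => by
      rw [Units.smul_def, zsmul_eq_mul]
    simp only [Pi.add_apply, Pi.smul_apply, hs]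
    simp only [cup, cochainD, Finset.mul_sum]
    rw [Finset.sum_comm, Finset.Nat.sum_antidiagonal_succ, Finset.Nat.sum_antidiagonal_succ']
    simp only [Pi.zero_apply, zero_mul, mul_zero, zero_add]
    rw [← Finset.sum_add_distrib]
    refine Finset.sum_congr rfl ?_
    rintro ⟨p, q⟩ hx
    rw [Finset.HasAntidiagonal.mem_antidiagonal] at hx
    subst hx
    have := leibniz_aux p q (φ p) (ψ q) σ
    by_cases hp : (p : ℤ) = i
    · subst hp
      simp only [Int.cast_negOnePow_natCast]
      simpa [Finset.mul_sum] using this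
    · simp [hφ p hp]

theorem intervalFace_zero_zero (σ : S _⦋0⦌) : intervalFace σ 0 0 = σ := by
  have e : intervalMap 0 0 0 = 𝟙 ⦋0⦌ := simplexHom_ext fun k => by
    have := k.is_lt
    change min (0 + (k : ℕ)) 0 = (k : ℕ)
    omega
  rw [intervalFace, e]
  simp

theorem cup_zero_apply (φ ψ : (n : ℕ) → S _⦋n⦌ → K) (σ : S _⦋0⦌) :
    cup φ ψ 0 σ = φ 0 σ * ψ 0 σ := by
  simp [cup, intervalFace_zero_zero]

variable (K S)

/-- The unit of the cup product, the `0`-cochain with constant value `1`. -/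
def unitCochain : cochains K S :=
  ⟨fun n => match n with
    | 0 => fun _ => 1
    | _ + 1 => 0,
   1, fun n hn => by
    match n, hn with
    | _ + 1, _ => rfl⟩

/-- The differential on `C^*(S; K)`. -/
def cochainDLin : cochains K S →ₗ[K] cochains K S where
  toFun φ := ⟨cochainD φ.1, by
    obtain ⟨N, hN⟩ := φ.2
    refine ⟨N + 1, fun n hn => ?_⟩
    match n, hn with
    | n + 1, hn =>
      funext σ
      simp [cochainD, hN n (by omega)]⟩
  map_add' φ ψ := by
    ext n σ
    match n with
    | 0 => simp [cochainD]
    | n + 1 => simp [cochainD, mul_add, Finset.sum_add_distrib]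
  map_smul' c φ := by
    ext n σ
    match n with
    | 0 => simp [cochainD]
    | n + 1 => simp [cochainD, Finset.mul_sum, mul_left_comm]

/-- The cup product on `C^*(S; K)`. -/
def cupLin : cochains K S →ₗ[K] cochains K S →ₗ[K] cochains K S :=
  LinearMap.mk₂ K
    (fun φ ψ => ⟨cup φ.1 ψ.1, by
      obtain ⟨N, hN⟩ := φ.2
      obtain ⟨M, hM⟩ := ψ.2
      refine ⟨N + M, fun n hn => ?_⟩
      funext σ
      refine Finset.sum_eq_zero fun x hx => ?_
      rw [Finset.HasAntidiagonal.mem_antidiagonal] at hx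
      by_cases h : N ≤ x.1
      · simp [hN _ h]
      · simp [hM x.2 (by omega)]⟩)
    (fun φ φ' ψ => by ext n σ; simp [cup, add_mul, Finset.sum_add_distrib])
    (fun c φ ψ => by ext n σ; simp [cup, Finset.mul_sum, mul_assoc])
    (fun φ ψ ψ' => by ext n σ; simp [cup, mul_add, Finset.sum_add_distrib])
    (fun c φ ψ => by ext n σ; simp [cup, Finset.mul_sum, mul_left_comm])

variable {S}

/-- The projection `φ ↦ φ - φ(s₀) · 1` of `C^*(S; K)` onto the ideal of the cochains that vanish
on the vertex `s₀`, i.e. the kernel of the augmentation `C^*(S; K) → K`, `φ ↦ φ(s₀)`. -/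
def augProj (s₀ : S _⦋0⦌) : cochains K S →ₗ[K] cochains K S where
  toFun φ := φ - φ.1 0 s₀ • unitCochain K S
  map_add' φ ψ := by
    simp only [Submodule.coe_add, Pi.add_apply, add_smul]
    abel
  map_smul' c φ := by
    simp only [Submodule.coe_smul, Pi.smul_apply, smul_eq_mul, mul_smul, smul_sub,
      RingHom.id_apply]

variable {K}

theorem augProj_apply (s₀ : S _⦋0⦌) (φ : cochains K S) :
    augProj K s₀ φ = φ - φ.1 0 s₀ • unitCochain K S := rfl

theorem augProj_eq_zero (s₀ : S _⦋0⦌) (i : ℤ) (φ : cochains K S)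
    (h : ∀ n : ℕ, (n : ℤ) ≠ i → φ.1 n = 0) (n : ℕ) (hn : (n : ℤ) ≠ i) :
    (augProj K s₀ φ).1 n = 0 := by
  match n with
  | 0 =>
    have := h 0 hn
    simp [augProj, this]
  | n + 1 =>
    have := h (n + 1) hn
    simp [augProj, this, unitCochain]

theorem cochainDLin_unit : cochainDLin K S (unitCochain K S) = 0 := by
  ext n σ
  match n with
  | 0 => rfl
  | 1 => simp [cochainDLin, cochainD, unitCochain, Fin.sum_univ_succ]
  | n + 2 => simp [cochainDLin, cochainD, unitCochain]

theorem cochainDLin_cochainDLin (φ : cochains K S) :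
    cochainDLin K S (cochainDLin K S φ) = 0 :=
  Subtype.ext (cochainD_cochainD φ.1)

theorem cochainDLin_augProj (s₀ : S _⦋0⦌) (φ : cochains K S) :
    cochainDLin K S (augProj K s₀ φ) = cochainDLin K S φ := by
  simp [augProj, cochainDLin_unit]

theorem augProj_d (s₀ : S _⦋0⦌) (φ : cochains K S) (c : K) :
    augProj K s₀ (cochainDLin K S φ + c • unitCochain K S) = cochainDLin K S φ := by
  have h : (cochainDLin K S φ + c • unitCochain K S).1 0 s₀ = c := by
    simp [cochainDLin, cochainD, unitCochain]
  rw [augProj_apply, h, add_sub_cancel_right]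

theorem augProj_apply_base (s₀ : S _⦋0⦌) (φ : cochains K S) : (augProj K s₀ φ).1 0 s₀ = 0 := by
  simp [augProj, unitCochain]

theorem augProj_cup (s₀ : S _⦋0⦌) (φ ψ : cochains K S) :
    augProj K s₀ (cupLin K S (augProj K s₀ φ) (augProj K s₀ ψ)) =
      cupLin K S (augProj K s₀ φ) (augProj K s₀ ψ) := by
  have h : (cupLin K S (augProj K s₀ φ) (augProj K s₀ ψ)).1 0 s₀ = 0 := by
    change cup _ _ 0 s₀ = 0
    rw [cup_zero_apply, augProj_apply_base, zero_mul]
  rw [augProj_apply, h, zero_smul, sub_zero]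

variable (K S)

/-- The elements of degree `i` of `K ⊕ C^*(S; K)`, where `K` is placed in degree `-1`. -/
def augGr (i : ℤ) : Submodule K (K × cochains K S) where
  carrier := {x | (i ≠ -1 → x.1 = 0) ∧ ∀ n : ℕ, (n : ℤ) ≠ i → x.2.1 n = 0}
  add_mem' := by
    rintro x y ⟨h1, h2⟩ ⟨h3, h4⟩
    exact ⟨fun h => by simp [h1 h, h3 h], fun n h => by simp [h2 n h, h4 n h]⟩
  zero_mem' := ⟨fun _ => rfl, fun _ _ => rfl⟩
  smul_mem' := by
    rintro c x ⟨h1, h2⟩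
    exact ⟨fun h => by simp [h1 h], fun n h => by simp [h2 n h]⟩

/-- The projection of `K ⊕ C^*(S; K)` to its part of degree `i`. -/
def augGrProj (i : ℤ) : (K × cochains K S) →ₗ[K] (K × cochains K S) where
  toFun x := (if i = -1 then x.1 else 0,
    ⟨fun n => if (n : ℤ) = i then x.2.1 n else 0, by
      obtain ⟨N, hN⟩ := x.2.2
      exact ⟨N, fun n hn => by simp [hN n hn]⟩⟩)
  map_add' x y := by
    ext n σ
    · dsimp
      split_ifs <;> simp
    · dsimp
      split_ifs <;> simp
  map_smul' c x := by
    ext n σ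
    · dsimp
      split_ifs <;> simp
    · dsimp
      split_ifs <;> simp

theorem augGrProj_mem (i : ℤ) (x : K × cochains K S) : augGrProj K S i x ∈ augGr K S i :=
  ⟨fun h => by simp [augGrProj, h], fun n h => by simp [augGrProj, h]⟩

theorem augGr_isInternal : DirectSum.IsInternal (augGr K S) := by
  apply DirectSum.isInternal_submodule_of_iSupIndep_of_iSup_eq_top
  · intro i
    rw [Submodule.disjoint_def]
    intro x hx hx'
    have h1 : augGrProj K S i x = x := by
      ext n σ
      · by_cases h : i = -1
        · simp [augGrProj, h]
        · simp [augGrProj, h, hx.1 h]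
      · by_cases h : (n : ℤ) = i
        · simp [augGrProj, h]
        · simp [augGrProj, h, hx.2 n h]
    have h2 : (⨆ j, ⨆ (_ : j ≠ i), augGr K S j) ≤ LinearMap.ker (augGrProj K S i) := by
      refine iSup_le fun j => iSup_le fun hj => ?_
      intro y hy
      rw [LinearMap.mem_ker]
      ext n σ
      · by_cases h : i = -1
        · have := hy.1 (by omega)
          simp [augGrProj, this]
        · simp [augGrProj, h]
      · by_cases h : (n : ℤ) = i
        · have := hy.2 n (by omega)
          simp [augGrProj, this]
        · simp [augGrProj, h]
    rw [← h1]
    exact h2 hx'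
  · rw [eq_top_iff]
    intro x _
    obtain ⟨N, hN⟩ := x.2.2
    have h : x = augGrProj K S (-1) x + ∑ m ∈ range N, augGrProj K S (m : ℤ) x := by
      ext n σ
      · have : ∀ m : ℕ, (m : ℤ) ≠ -1 := fun m => by omega
        simp [augGrProj, Prod.fst_sum, this]
      · have h0 : (n : ℤ) ≠ -1 := by omega
        simp only [Prod.snd_add, Prod.snd_sum, Submodule.coe_add, Submodule.coe_sum, Pi.add_apply,
          Finset.sum_apply]
        simp only [augGrProj, LinearMap.coe_mk, AddHom.coe_mk, h0, if_false, Nat.cast_inj,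
          Pi.zero_apply, zero_add]
        by_cases hn : N ≤ n
        · rw [hN n hn]
          simp
        · rw [Finset.sum_eq_single n]
          · simp
          · intro b _ hb
            simp [Ne.symm hb]
          · intro hb
            simp at hb
            omega
    rw [h]
    refine add_mem (Submodule.mem_iSup_of_mem _ (augGrProj_mem K S _ x)) (sum_mem fun m _ => ?_)
    exact Submodule.mem_iSup_of_mem _ (augGrProj_mem K S _ x)

/-- The augmented cochain dg-algebra of a simplicial set with a base vertex `s₀`. The underlying
complex is `0 → K → C^0(S; K) → C^1(S; K) → ⋯`, with `K` in degree `-1`, where `c : K` is sent to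
the constant `0`-cochain `c`; its cohomology is the reduced cohomology. The cup product with the
unit cochain `1` does not extend to this complex, because `1` is exact in it. The complex is the
direct sum of the ideal of `C^*(S; K)` of the cochains that vanish on `s₀` and of the acyclic
complex `K → K · 1`; the product is the cup product on the former, and it is zero if one
of the factors lies in the latter. So the cohomology algebra is the reduced cohomology with its
cup product. -/
def augCochains {S : SSet.{u}} (s₀ : S _⦋0⦌) : DGAlgebra.{v, max u v} K where
  carrier := K × cochains K S
  gr := augGr K S
  isInternal := augGr_isInternal K S
  d := LinearMap.prod 0
    ((cochainDLin K S).comp (LinearMap.snd K K (cochains K S)) +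
      (LinearMap.fst K K (cochains K S)).smulRight (unitCochain K S))
  mul := ((cupLin K S).compl₁₂ (augProj K s₀ ∘ₗ LinearMap.snd K K (cochains K S))
    (augProj K s₀ ∘ₗ LinearMap.snd K K (cochains K S))).compr₂
      (LinearMap.inr K K (cochains K S))
  d_mem := by
    rintro i ⟨c, φ⟩ ⟨h1, h2⟩
    refine ⟨fun _ => rfl, fun n hn => ?_⟩
    funext σ
    match n with
    | 0 =>
      have : c = 0 := h1 (by rintro rfl; simp at hn)
      simp [cochainDLin, cochainD, this]
    | n + 1 =>
      have : φ.1 n = 0 := h2 n (by rintro rfl; simp at hn)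
      simp [cochainDLin, cochainD, unitCochain, this]
  mul_mem := by
    rintro i j ⟨c, φ⟩ ⟨e, ψ⟩ ⟨h1, h2⟩ ⟨h3, h4⟩
    refine ⟨fun _ => rfl, fun n hn => ?_⟩
    funext σ
    change cup (augProj K s₀ φ).1 (augProj K s₀ ψ).1 n σ = 0
    refine Finset.sum_eq_zero fun x hx => ?_
    rw [Finset.HasAntidiagonal.mem_antidiagonal] at hx
    by_cases h : (x.1 : ℤ) = i
    · have := augProj_eq_zero s₀ j ψ h4 x.2 (by omega)
      simp [this]
    · have := augProj_eq_zero s₀ i φ h2 x.1 h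
      simp [this]
  d_d := by
    rintro ⟨c, φ⟩
    simp [cochainDLin_cochainDLin, cochainDLin_unit]
  mul_assoc := by
    rintro ⟨c, φ⟩ ⟨e, ψ⟩ ⟨g, χ⟩
    simp only [LinearMap.compr₂_apply, LinearMap.compl₁₂_apply, LinearMap.comp_apply,
      LinearMap.snd_apply, LinearMap.inr_apply, augProj_cup]
    exact congrArg (Prod.mk (0 : K)) (Subtype.ext (cup_assoc _ _ _))
  leibniz := by
    rintro i ⟨c, φ⟩ ⟨e, ψ⟩ ⟨h1, h2⟩
    have h := cochainD_cup i (augProj K s₀ φ).1 (augProj K s₀ ψ).1 (augProj_eq_zero s₀ i φ h2)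
    have h' : cochainDLin K S (cupLin K S (augProj K s₀ φ) (augProj K s₀ ψ)) =
        cupLin K S (cochainDLin K S φ) (augProj K s₀ ψ) +
          i.negOnePow • cupLin K S (augProj K s₀ φ) (cochainDLin K S ψ) := by
      rw [← cochainDLin_augProj s₀ φ, ← cochainDLin_augProj s₀ ψ]
      exact Subtype.ext h
    refine Prod.ext ?_ ?_
    · simp
    · simpa [augProj_d, -map_add] using h'

theorem augCochains_d_apply {S : SSet.{u}} (s₀ : S _⦋0⦌) (c : K) (φ : cochains K S) :
    (augCochains K s₀).d (c, φ) = ((0 : K), cochainDLin K S φ + c • unitCochain K S) := rfl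

theorem augCochains_mul_apply {S : SSet.{u}} (s₀ : S _⦋0⦌) (c e : K) (φ ψ : cochains K S) :
    (augCochains K s₀).mul (c, φ) (e, ψ) =
      ((0 : K), cupLin K S (augProj K s₀ φ) (augProj K s₀ ψ)) := rfl

end Cochains

/-- The Lusternik-Schnirelmann category of `X`: the least `n` such that `X` is covered by `n + 1`
open subsets whose inclusions into `X` are null-homotopic (`⊤` if there is no such `n`). -/
noncomputable def lsCat (X : Type u) [TopologicalSpace X] : ℕ∞ :=
  sInf {k : ℕ∞ | ∃ n : ℕ, k = n ∧ ∃ U : Fin (n + 1) → Set X,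
    (∀ i, IsOpen (U i)) ∧ (⋃ i, U i) = Set.univ ∧
      ∀ i, (⟨Subtype.val, continuous_subtype_val⟩ : C(U i, X)).Nullhomotopic}

/-- The augmented singular cochain dg-algebra of the space `X`, with base point `x₀`. -/
noncomputable def augSingularCochains (K : Type v) [Field K] (X : Type u) [TopologicalSpace X]
    (x₀ : X) : DGAlgebra.{v, max u v} K :=
  augCochains K (S := TopCat.toSSet.obj (TopCat.of X))
    ((TopCat.toSSetObjEquiv (TopCat.of X) (Opposite.op (SimplexCategory.mk 0))).symm
      (ContinuousMap.const _ x₀))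

/-!
Let `X = U ∪ V` with `U`, `V` open and null-homotopic in `X`. A cochain that vanishes on the
simplices in `U`, multiplied by one that vanishes on the simplices in `V`, lands in the ideal `N` of
the cochains that vanish on both kinds of simplices, and `N` is acyclic by barycentric subdivision.
If the reduced `H⁰` vanishes, coning with the two null-homotopies shows that every cohomology class
has representatives of both sorts. So choose representatives `x` of the first sort with
`x + d (c x)` of the second sort: the products `x₀ * c x₁ * ⋯ * c xₙ` satisfy the equation of an
`A_∞`-morphism from the cohomology with zero product up to an error in `N`, and this error is
corrected inductively inside `N`. Otherwise `U` and `V` are disjoint and nonempty, and the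
indicator of the one that misses the base point is an idempotent cocycle that spans the cohomology.
-/

theorem exists_linearMap_mem_of_forall_exists {K V W : Type*} [Field K]
    [AddCommGroup V] [Module K V] [AddCommGroup W] [Module K W] (R : Submodule K (V × W))
    (hR : ∀ x, ∃ y, (x, y) ∈ R) : ∃ s : V →ₗ[K] W, ∀ x, (x, s x) ∈ R := by
  obtain ⟨t, ht⟩ := ((LinearMap.fst K V W).comp R.subtype).exists_rightInverse_of_surjective
    (LinearMap.range_eq_top.2 fun x => (hR x).elim fun y hy => ⟨⟨(x, y), hy⟩, rfl⟩)
  have fst_t (x : V) : (t x).1.1 = x := LinearMap.congr_fun ht x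
  refine ⟨(LinearMap.snd K V W).comp (R.subtype.comp t), fun x => ?_⟩
  have mem := (t x).2
  rwa [← Prod.mk.eta (p := (t x).1), fst_t] at mem

/-! ### Multilinear functions of sequences -/

/-- `Φ` is a multilinear function of the first `n` entries of a sequence. Working with whole
sequences avoids casts between the types `Fin n` when blocks of arguments are concatenated. -/
def IsMultilinearSeq (K : Type*) [CommSemiring K] {V M : Type*} [AddCommMonoid V] [Module K V]
    [AddCommMonoid M] [Module K M] (n : ℕ) (Φ : (ℕ → V) → M) : Prop :=
  ∃ φ : MultilinearMap K (fun _ : Fin n => V) M, ∀ v, φ (fun i => v i) = Φ v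

namespace IsMultilinearSeq

variable {K V M M' M'' : Type*} [CommSemiring K] [AddCommMonoid V] [Module K V]
  [AddCommMonoid M] [Module K M] [AddCommMonoid M'] [Module K M'] [AddCommMonoid M''] [Module K M'']

theorem zero (n : ℕ) : IsMultilinearSeq K n (fun _ : ℕ → V => (0 : M)) :=
  ⟨0, fun _ => rfl⟩

theorem add {n : ℕ} {Φ Ψ : (ℕ → V) → M} : IsMultilinearSeq K n Φ → IsMultilinearSeq K n Ψ →
    IsMultilinearSeq K n (fun v => Φ v + Ψ v)
  | ⟨φ, hφ⟩, ⟨ψ, hψ⟩ => ⟨φ + ψ, fun v => by simp only [add_apply, hφ, hψ]⟩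

theorem comp {n : ℕ} {Φ : (ℕ → V) → M} (g : M →ₗ[K] M') :
    IsMultilinearSeq K n Φ → IsMultilinearSeq K n (fun v => g (Φ v))
  | ⟨φ, hφ⟩ => ⟨g.compMultilinearMap φ, fun v => congrArg g (hφ v)⟩

theorem sum {n : ℕ} {ι : Type*} (s : Finset ι) {Φ : ι → (ℕ → V) → M}
    (h : ∀ i ∈ s, IsMultilinearSeq K n (Φ i)) :
    IsMultilinearSeq K n (fun v => ∑ i ∈ s, Φ i v) := by
  classical
  induction s using Finset.induction_on with
  | empty => simpa using zero n
  | insert i s hi ih =>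
    simp only [sum_insert hi]
    exact (h i (mem_insert_self i s)).add (ih fun j hj => h j (mem_insert_of_mem hj))

theorem apply_zero (g : V →ₗ[K] M) : IsMultilinearSeq K 1 (fun v : ℕ → V => g (v 0)) :=
  ⟨MultilinearMap.ofSubsingleton K V M (0 : Fin 1) g, fun _ => rfl⟩

theorem mul (B : M →ₗ[K] M' →ₗ[K] M'') {n m p : ℕ} (hp : n + m = p) {Φ : (ℕ → V) → M}
    {Ψ : (ℕ → V) → M'} : IsMultilinearSeq K n Φ → IsMultilinearSeq K m Ψ →
    IsMultilinearSeq K p (fun v => B (Φ v) (Ψ (fun k => v (n + k))))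
  | ⟨φ, hφ⟩, ⟨ψ, hψ⟩ => by
    subst hp
    refine ⟨((TensorProduct.lift B).compMultilinearMap (φ.domCoprod ψ)).domDomCongr finSumFinEquiv,
      fun v => ?_⟩
    simp only [MultilinearMap.domDomCongr_apply, LinearMap.compMultilinearMap_apply,
      MultilinearMap.domCoprod_apply, TensorProduct.lift.tmul, finSumFinEquiv_apply_left,
      finSumFinEquiv_apply_right, Fin.val_castAdd, Fin.val_natAdd, hφ, hψ fun k => v (n + k)]

end IsMultilinearSeq

/-! ### The grading of a dg-algebra -/

theorem negOnePow_smul_eq_zpow_smul (K : Type*) [Field K] {M : Type*} [AddCommGroup M] [Module K M]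
    (i : ℤ) (x : M) : i.negOnePow • x = (-1 : K) ^ i • x := by
  rw [← Int.cast_negOnePow, Int.cast_smul_eq_zsmul, Units.smul_def]

theorem neg_one_zpow_eq_of_even_sub {K : Type*} [Field K] {i j : ℤ} (h : Even (i - j)) :
    (-1 : K) ^ i = (-1) ^ j := by
  rw [← Int.cast_negOnePow, ← Int.cast_negOnePow, Int.negOnePow_eq_iff _ _ |>.2 h]

theorem neg_one_zpow_sum {K ι : Type*} [Field K] (s : Finset ι) (f : ι → ℤ) :
    (-1 : K) ^ (∑ i ∈ s, f i) = ∏ i ∈ s, (-1) ^ f i := by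
  classical
  induction s using Finset.induction_on with
  | empty => simp
  | insert i s hi ih => rw [sum_insert hi, prod_insert hi, zpow_add₀ (by simp), ih]

namespace DGAlgebra

variable {K : Type v} [Field K] (A : DGAlgebra.{v, w} K)

noncomputable instance : DirectSum.Decomposition A.gr :=
  A.isInternal.chooseDecomposition

section Lift

variable {A} {B : Type*} [AddCommGroup B] [Module K B]

theorem linearMap_ext {f g : A.carrier →ₗ[K] B} (h : ∀ i, ∀ x ∈ A.gr i, f x = g x) : f = g :=
  DirectSum.decompose_lhom_ext A.gr fun i => LinearMap.ext fun x => h i x x.2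

/-- The linear map on `A` with prescribed restrictions to the homogeneous components. -/
noncomputable def lift (g : ∀ i, A.gr i →ₗ[K] B) : A.carrier →ₗ[K] B :=
  (DirectSum.toModule K ℤ B g).comp (DirectSum.decomposeLinearEquiv A.gr).toLinearMap

theorem lift_apply (g : ∀ i, A.gr i →ₗ[K] B) {i : ℤ} {x : A.carrier} (hx : x ∈ A.gr i) :
    lift g x = g i ⟨x, hx⟩ := by
  simp [lift, DirectSum.decomposeLinearEquiv_apply, DirectSum.decompose_of_mem A.gr hx,
    ← DirectSum.lof_eq_of K]

end Lift

/-- The projection onto the homogeneous component of degree `i`. -/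
noncomputable def proj (i : ℤ) : A.carrier →ₗ[K] A.carrier :=
  ((A.gr i).subtype.comp (DirectSum.component K ℤ (fun i => A.gr i) i)).comp
    (DirectSum.decomposeLinearEquiv A.gr).toLinearMap

theorem proj_mem (i : ℤ) (x : A.carrier) : A.proj i x ∈ A.gr i :=
  (DirectSum.decompose A.gr x i).2

theorem proj_of_mem {i : ℤ} {x : A.carrier} (hx : x ∈ A.gr i) : A.proj i x = x :=
  DirectSum.decompose_of_mem_same A.gr hx

theorem proj_of_mem_ne {i j : ℤ} {x : A.carrier} (hx : x ∈ A.gr i) (hij : i ≠ j) :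
    A.proj j x = 0 :=
  DirectSum.decompose_of_mem_ne A.gr hx hij

theorem mem_of_forall_proj_mem {P : Submodule K A.carrier} {x : A.carrier}
    (hx : ∀ i, A.proj i x ∈ P) : x ∈ P := by
  classical
  rw [← DirectSum.sum_support_decompose A.gr x]
  exact sum_mem fun i _ => hx i

theorem proj_map_of_forall_mem {A : DGAlgebra.{v, w} K} {B : DGAlgebra.{v, w'} K} {k : ℤ}
    {φ : A.carrier →ₗ[K] B.carrier} (hφ : ∀ i, ∀ x ∈ A.gr i, φ x ∈ B.gr (i + k)) (i : ℤ)
    (x : A.carrier) : B.proj (i + k) (φ x) = φ (A.proj i x) := by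
  suffices (B.proj (i + k)).comp φ = φ.comp (A.proj i) from LinearMap.congr_fun this x
  refine linearMap_ext fun j y hy => ?_
  obtain rfl | hij := eq_or_ne j i
  · simp [B.proj_of_mem (hφ _ _ hy), A.proj_of_mem hy]
  · have hij' : j + k ≠ i + k := by simpa using hij
    simp [B.proj_of_mem_ne (hφ _ _ hy) hij', A.proj_of_mem_ne hy hij]

theorem proj_d (i : ℤ) (x : A.carrier) : A.proj (i + 1) (A.d x) = A.d (A.proj i x) :=
  proj_map_of_forall_mem A.d_mem i x

/-- The grading involution: multiplication by `(-1) ^ i` in degree `i`. It carries the Koszul signs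
of identities between elements that are not assumed to be homogeneous. -/
noncomputable def involution : A.carrier →ₗ[K] A.carrier :=
  lift fun i => (-1 : K) ^ i • (A.gr i).subtype

variable {A}

theorem involution_apply {i : ℤ} {x : A.carrier} (hx : x ∈ A.gr i) :
    A.involution x = (-1 : K) ^ i • x := by
  simp [involution, lift_apply _ hx]

theorem involution_mem {i : ℤ} {x : A.carrier} (hx : x ∈ A.gr i) : A.involution x ∈ A.gr i := by
  rw [involution_apply hx]
  exact Submodule.smul_mem _ _ hx

theorem involution_pow_apply {i : ℤ} {x : A.carrier} (hx : x ∈ A.gr i) (n : ℕ) :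
    (A.involution ^ n) x = (-1 : K) ^ (n * i) • x := by
  induction n with
  | zero => simp
  | succ n ih =>
    rw [pow_succ', Module.End.mul_apply, ih, map_smul, involution_apply hx, smul_smul,
      ← zpow_add₀ (by simp), Nat.cast_succ, add_one_mul]

theorem involution_mem_of_isHomogeneous {P : Submodule K A.carrier} (hP : P.IsHomogeneous A.gr)
    {x : A.carrier} (hx : x ∈ P) : A.involution x ∈ P := by
  classical
  rw [← DirectSum.sum_support_decompose A.gr x, map_sum]
  refine sum_mem fun i _ => ?_
  rw [involution_apply (DirectSum.decompose A.gr x i).2]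
  exact P.smul_mem _ (hP i hx)

variable (A)

theorem involution_involution (x : A.carrier) : A.involution (A.involution x) = x := by
  suffices A.involution.comp A.involution = LinearMap.id from LinearMap.congr_fun this x
  refine linearMap_ext fun i x hx => ?_
  simp [involution_apply hx, smul_smul, ← mul_zpow]

theorem d_involution (x : A.carrier) : A.d (A.involution x) = -A.involution (A.d x) := by
  suffices A.d.comp A.involution = -(A.involution.comp A.d) from LinearMap.congr_fun this x
  refine linearMap_ext fun i x hx => ?_
  simp [involution_apply hx, involution_apply (A.d_mem i x hx), zpow_add₀]

theorem involution_mul (x y : A.carrier) :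
    A.involution (A.mul x y) = A.mul (A.involution x) (A.involution y) := by
  suffices A.mul.compr₂ A.involution = A.mul.compl₁₂ A.involution A.involution from
    LinearMap.congr_fun₂ this x y
  refine linearMap_ext fun i x hx => linearMap_ext fun j y hy => ?_
  simp [involution_apply hx, involution_apply hy, involution_apply (A.mul_mem _ _ _ _ hx hy),
    zpow_add₀, smul_smul, mul_comm]

theorem d_mul (x y : A.carrier) :
    A.d (A.mul x y) = A.mul (A.d x) y + A.mul (A.involution x) (A.d y) := by
  suffices A.d.comp (A.mul.flip y) =
      (A.mul.flip y).comp A.d + (A.mul.flip (A.d y)).comp A.involution from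
    LinearMap.congr_fun this x
  refine linearMap_ext fun i x hx => ?_
  simp [involution_apply hx, A.leibniz i x y hx, negOnePow_smul_eq_zpow_smul K i]

end DGAlgebra

/-! ### `A_∞`-morphisms between dg-algebras -/

/-- The composition `(i, j)` of `n = i + j`. -/
def pairComposition {n i j : ℕ} (hi : 0 < i) (hj : 0 < j) (h : i + j = n) : Composition n where
  blocks := [i, j]
  blocks_pos := by rintro k hk; aesop
  blocks_sum := by simpa using h

theorem exists_eq_pairComposition {n : ℕ} {c : Composition n} (hc : c.length = 2) :
    ∃ (i j : ℕ) (hi : 0 < i) (hj : 0 < j) (h : i + j = n), c = pairComposition hi hj h := by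
  obtain ⟨i, j, hij⟩ := List.length_eq_two.1 hc
  refine ⟨i, j, c.blocks_pos (by simp [hij]), c.blocks_pos (by simp [hij]), ?_,
    Composition.ext hij⟩
  simpa [hij] using c.blocks_sum

theorem sum_composition_length_eq_two {M : Type*} [AddCommMonoid M] {n : ℕ}
    (g : Composition n → M) (g' : ℕ × ℕ → M)
    (hg : ∀ i j (hi : 0 < i) (hj : 0 < j) (h : i + j = n), g (pairComposition hi hj h) = g' (i, j))
    (hg' : ∀ x, x.1 = 0 ∨ x.2 = 0 → g' x = 0) :
    ∑ c with c.length = 2, g c = ∑ x ∈ antidiagonal n, g' x := by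
  refine sum_of_injOn (fun c => (c.blocks.headD 0, c.blocks.tail.headD 0)) ?_ ?_ ?_ ?_
  · simp only [coe_filter, mem_univ, true_and]
    intro c hc c' hc' h
    obtain ⟨i, j, hi, hj, hs, rfl⟩ := exists_eq_pairComposition hc
    obtain ⟨i', j', hi', hj', hs', rfl⟩ := exists_eq_pairComposition hc'
    simp only [pairComposition, List.headD_cons, List.tail_cons, Prod.mk.injEq] at h
    simp only [h]
  · simp only [coe_filter, mem_univ, true_and]
    intro c hc
    obtain ⟨i, j, hi, hj, hs, rfl⟩ := exists_eq_pairComposition hc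
    simpa [pairComposition] using hs
  · rintro ⟨i, j⟩ hx hx'
    refine hg' _ ?_
    by_contra! h
    refine hx' ⟨pairComposition (Nat.pos_of_ne_zero h.1) (Nat.pos_of_ne_zero h.2)
      (mem_antidiagonal.1 hx), ?_, rfl⟩
    simp [pairComposition, Composition.length]
  · intro c hc
    obtain ⟨i, j, hi, hj, hs, rfl⟩ := exists_eq_pairComposition (mem_filter.1 hc).2
    exact hg i j hi hj hs

theorem sum_composition_eq_single_add {M : Type*} [AddCommMonoid M] {n : ℕ} (hn : 0 < n)
    (g : Composition n → M) (hg : ∀ c, 3 ≤ c.length → g c = 0) :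
    ∑ c, g c = g (Composition.single n hn) + ∑ c with c.length = 2, g c := by
  classical
  rw [← add_sum_erase _ _ (mem_univ (Composition.single n hn))]
  congr 1
  refine (sum_subset (fun c hc => ?_) fun c hc hc' => hg c ?_).symm
  · refine mem_erase.2 ⟨?_, mem_univ c⟩
    rintro rfl
    simp at hc
  · have ne_one : c.length ≠ 1 := fun h =>
      (mem_erase.1 hc).1 ((Composition.eq_single_iff_length hn).2 h)
    have ne_two : c.length ≠ 2 := by simpa using hc'
    have pos : 0 < c.length := c.length_pos_of_pos hn
    omega

namespace DGAlgebra

variable {K : Type v} [Field K]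

theorem sum_composition_ops (A : DGAlgebra.{v, w} K) {V : Type*} [AddCommGroup V] [Module K V]
    (f : (n : ℕ) → MultilinearMap K (fun _ : Fin n => V) A.carrier) (f_zero : f 0 = 0)
    {n : ℕ} (hn : 0 < n) (v : ℕ → V) (deg : ℕ → ℤ) :
    ∑ c : Composition n,
      ((∑ j : Fin c.length, ((c.length : ℤ) - 1 - j) * ((c.blocksFun j : ℤ) - 1)) +
        ∑ j : Fin c.length, (1 - (c.blocksFun j : ℤ)) *
          ∑ l ∈ range (c.sizeUpTo j), deg l).negOnePow •
        A.ops c.length (fun j => f (c.blocksFun j) (fun i => v (c.sizeUpTo j + i))) =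
    A.d (f n fun i => v i) + ∑ x ∈ antidiagonal n,
      ((x.1 : ℤ) - 1 + (1 - (x.2 : ℤ)) * ∑ l ∈ range x.1, deg l).negOnePow •
        A.mul (f x.1 fun i => v i) (f x.2 fun i => v (x.1 + i)) := by
  rw [sum_composition_eq_single_add hn, sum_composition_length_eq_two _ (fun x =>
    ((x.1 : ℤ) - 1 + (1 - (x.2 : ℤ)) * ∑ l ∈ range x.1, deg l).negOnePow •
      A.mul (f x.1 fun i => v i) (f x.2 fun i => v (x.1 + i)))]
  · congr 1
    have ops_single : (A.ops (Composition.single n hn).length fun j =>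
        f ((Composition.single n hn).blocksFun j)
          fun i => v ((Composition.single n hn).sizeUpTo j + i)) = A.d (f n fun i => v i) := by
      change A.d (f n fun i => v (0 + i)) = _
      simp only [zero_add]
    rw [ops_single]
    simp [Composition.sizeUpTo]
  · intro i j hi hj hs
    change (∑ k : Fin 2, ((2 : ℕ) - 1 - (k : ℤ)) * (([i, j][k] : ℤ) - 1) +
      ∑ k : Fin 2, (1 - ([i, j][k] : ℤ)) *
        ∑ l ∈ range ([i, j].take k).sum, deg l).negOnePow •
      A.mul (f i fun l => v (0 + l)) (f j fun l => v (i + l)) = _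
    simp [Fin.sum_univ_two]
  · rintro ⟨i, j⟩ (rfl | rfl) <;> simp [f_zero]
  · intro c hc
    rw [A.ops_eq_zero _ (Or.inr hc), zero_apply, smul_zero]

theorem exists_homogeneous_seq_extending {A : DGAlgebra.{v, w} K} {n : ℕ} {v : Fin n → A.carrier}
    {deg : Fin n → ℤ} (hv : ∀ i, v i ∈ A.gr (deg i)) :
    ∃ (v' : ℕ → A.carrier) (deg' : ℕ → ℤ), (∀ i, v' i ∈ A.gr (deg' i)) ∧
      (∀ i : Fin n, v' i = v i) ∧ ∀ i : Fin n, deg' i = deg i := by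
  refine ⟨fun i => if h : i < n then v ⟨i, h⟩ else 0,
    fun i => if h : i < n then deg ⟨i, h⟩ else 0, fun i => ?_, by simp, by simp⟩
  dsimp only
  split_ifs with h
  exacts [hv _, zero_mem _]

variable {H : DGAlgebra.{v, w} K} {A : DGAlgebra.{v, w'} K}

theorem forall_mem_gr_of_forall_seq_mem_gr {n : ℕ} {p : ℤ}
    {φ : MultilinearMap K (fun _ : Fin n => H.carrier) A.carrier}
    (hφ : ∀ (v : ℕ → H.carrier) (deg : ℕ → ℤ), (∀ i, v i ∈ H.gr (deg i)) →
      φ (fun i => v i) ∈ A.gr (∑ l ∈ range n, deg l + p)) (v : Fin n → H.carrier) (deg : Fin n → ℤ)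
    (hv : ∀ i, v i ∈ H.gr (deg i)) : φ v ∈ A.gr (∑ i, deg i + p) := by
  obtain ⟨v', deg', hv', hvv', hdeg⟩ := exists_homogeneous_seq_extending hv
  have := hφ v' deg' hv'
  simpa only [sum_range, hvv', hdeg] using this

/-- An `A_∞`-morphism of dg-algebras from its components. On the right-hand side of the relation
only the compositions into one or two blocks are left. -/
def homOfComponents (f : (n : ℕ) → MultilinearMap K (fun _ : Fin n => H.carrier) A.carrier)
    (f_zero : f 0 = 0)
    (f_mem : ∀ (n : ℕ) (v : ℕ → H.carrier) (deg : ℕ → ℤ), (∀ i, v i ∈ H.gr (deg i)) →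
      f n (fun i => v i) ∈ A.gr (∑ l ∈ range n, deg l + (1 - n)))
    (relation : ∀ (n : ℕ) (v : ℕ → H.carrier) (deg : ℕ → ℤ), 0 < n → (∀ i, v i ∈ H.gr (deg i)) →
      ∑ x ∈ antidiagonal n, ∑ y ∈ antidiagonal x.2 with 1 ≤ y.1,
        (((x.1 : ℤ) + y.1 * y.2) + (2 - (y.1 : ℤ)) * ∑ l ∈ range x.1, deg l).negOnePow •
          f (x.1 + 1 + y.2) (fun i => spliceSeq v x.1 y.1 (H.ops y.1 fun j => v (x.1 + j)) i) =
      A.d (f n fun i => v i) + ∑ x ∈ antidiagonal n,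
        ((x.1 : ℤ) - 1 + (1 - (x.2 : ℤ)) * ∑ l ∈ range x.1, deg l).negOnePow •
          A.mul (f x.1 fun i => v i) (f x.2 fun i => v (x.1 + i))) :
    AInfAlgebra.Hom H.toAInf A.toAInf where
  f := f
  f_zero := f_zero
  f_mem n v deg hv := by
    rw [add_sub_assoc]
    exact forall_mem_gr_of_forall_seq_mem_gr (f_mem n) v deg hv
  relation n v deg hn hv :=
    (relation n v deg hn hv).trans (A.sum_composition_ops f f_zero hn v deg).symm

theorem isQuasiIso_of_forall (hd : H.d = 0) (F : AInfAlgebra.Hom H.toAInf A.toAInf)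
    (g : H.carrier →ₗ[K] A.carrier) (hg : ∀ x, F.linear x = g x)
    (inj : ∀ x y, A.d y = g x → x = 0) (surj : ∀ y, A.d y = 0 → ∃ x z, A.d z = y - g x) :
    F.IsQuasiIso := by
  constructor
  · refine (injective_iff_map_eq_zero F.cohomologyMap).2 fun q hq => ?_
    obtain ⟨⟨x, hx⟩, rfl⟩ := Submodule.Quotient.mk_surjective _ q
    obtain ⟨y, hy⟩ := (Submodule.Quotient.mk_eq_zero _).1 hq
    have x_eq_zero : x = 0 := inj x y (Eq.trans hy (hg x))
    exact (Submodule.Quotient.mk_eq_zero _).2 (x_eq_zero ▸ zero_mem _)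
  · intro q
    obtain ⟨⟨y, hy⟩, rfl⟩ := Submodule.Quotient.mk_surjective _ q
    obtain ⟨x, z, hz⟩ := surj y hy
    refine ⟨Submodule.Quotient.mk ⟨x, LinearMap.congr_fun hd x⟩, ?_⟩
    refine Eq.symm ((Submodule.Quotient.eq _).2 ⟨z, ?_⟩)
    exact hz.trans (congrArg (fun t : A.toAInf.carrier => y - t) (hg x).symm)

end DGAlgebra

/-! ### Twisting families -/

namespace DGAlgebra

variable {K : Type v} [Field K]

/-- The `n`-th member of a family is a function of sequences, in practice one that depends only on
the first `n` entries. Families model the linear maps from the bar construction of `V` to `A`. -/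
abbrev Family (A : DGAlgebra.{v, w} K) (V : Type*) := ℕ → (ℕ → V) → A.carrier

section Family

variable (A : DGAlgebra.{v, w} K) {V : Type*}

/-- A linear endomorphism of `A` applied to all members of a family. -/
def postcomp (φ : A.carrier →ₗ[K] A.carrier) : A.Family V →ₗ[K] A.Family V :=
  (φ.compLeft (ℕ → V)).compLeft ℕ

theorem postcomp_apply (φ : A.carrier →ₗ[K] A.carrier) (F : A.Family V) (n : ℕ) (v : ℕ → V) :
    A.postcomp φ F n v = φ (F n v) := rfl

/-- The convolution product of families: split the arguments into two consecutive blocks, apply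
one family to each block, and multiply. -/
def conv : A.Family V →ₗ[K] A.Family V →ₗ[K] A.Family V :=
  LinearMap.mk₂ K
    (fun F G n v => ∑ x ∈ antidiagonal n, A.mul (F x.1 v) (G x.2 fun k => v (x.1 + k)))
    (fun F F' G => by ext; simp [sum_add_distrib])
    (fun c F G => by ext; simp [smul_sum])
    (fun F G G' => by ext; simp [sum_add_distrib])
    (fun c F G => by ext; simp [smul_sum])

theorem conv_apply (F G : A.Family V) (n : ℕ) (v : ℕ → V) : A.conv F G n v =
    ∑ x ∈ antidiagonal n, A.mul (F x.1 v) (G x.2 fun k => v (x.1 + k)) := rfl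

theorem conv_assoc (F G H : A.Family V) :
    A.conv (A.conv F G) H = A.conv F (A.conv G H) := by
  funext n v
  simp only [conv_apply, map_sum, LinearMap.sum_apply, sum_sigma']
  refine sum_nbij' (fun x => ⟨(x.2.1, x.2.2 + x.1.2), (x.2.2, x.1.2)⟩)
    (fun x => ⟨(x.1.1 + x.2.1, x.2.2), (x.1.1, x.2.1)⟩) ?_ ?_ ?_ ?_ ?_ <;>
    rintro ⟨⟨i, j⟩, ⟨k, l⟩⟩ h <;>
    simp only [mem_sigma, HasAntidiagonal.mem_antidiagonal] at h ⊢ <;> obtain ⟨rfl, rfl⟩ := h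
  · exact ⟨(add_assoc k l j).symm, trivial⟩
  · exact ⟨add_assoc i k l, trivial⟩
  · rfl
  · rfl
  · simp only [A.mul_assoc, add_assoc]

theorem postcomp_d_conv (F G : A.Family V) : A.postcomp A.d (A.conv F G) =
    A.conv (A.postcomp A.d F) G + A.conv (A.postcomp A.involution F) (A.postcomp A.d G) := by
  funext n v
  simp only [postcomp_apply, conv_apply, map_sum, A.d_mul, sum_add_distrib, Pi.add_apply]

theorem postcomp_involution_conv (F G : A.Family V) : A.postcomp A.involution (A.conv F G) =
    A.conv (A.postcomp A.involution F) (A.postcomp A.involution G) := by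
  funext n v
  simp only [postcomp_apply, conv_apply, map_sum, A.involution_mul]

theorem postcomp_involution_involution (F : A.Family V) :
    A.postcomp A.involution (A.postcomp A.involution F) = F := by
  funext n v
  simp only [postcomp_apply, A.involution_involution]

theorem postcomp_d_involution (F : A.Family V) :
    A.postcomp A.d (A.postcomp A.involution F) = -A.postcomp A.involution (A.postcomp A.d F) := by
  funext n v
  simp only [postcomp_apply, A.d_involution, Pi.neg_apply]

/-- The quadratic part `τF ⋆ F` of the curvature, where `τ` is the grading involution. -/
noncomputable def square (F : A.Family V) : A.Family V :=
  A.conv (A.postcomp A.involution F) F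

/-- The left-hand side `dF + τF ⋆ F` of the Maurer–Cartan equation. -/
noncomputable def curvature (F : A.Family V) : A.Family V :=
  A.postcomp A.d F + A.square F

theorem postcomp_d_square (F : A.Family V) : A.postcomp A.d (A.square F) =
    A.conv F (A.curvature F) - A.conv (A.postcomp A.involution (A.curvature F)) F := by
  simp only [square, curvature, postcomp_d_conv, postcomp_d_involution, postcomp_involution_conv,
    postcomp_involution_involution, map_add, map_neg, LinearMap.add_apply, LinearMap.neg_apply,
    conv_assoc]
  abel

theorem square_sub_square (F G : A.Family V) : A.square F - A.square G =
    A.conv (A.postcomp A.involution (F - G)) F + A.conv (A.postcomp A.involution G) (F - G) := by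
  simp only [square, map_sub, LinearMap.sub_apply]
  abel

variable {A}

theorem conv_mem_of_left {P : Submodule K A.carrier} (hP : ∀ x ∈ P, ∀ y, A.mul x y ∈ P)
    {F G : A.Family V} (hG : G 0 = 0) {n : ℕ} (hF : ∀ m < n, ∀ v, F m v ∈ P) (v : ℕ → V) :
    A.conv F G n v ∈ P := by
  rw [conv_apply]
  refine sum_mem fun x hx => ?_
  rw [HasAntidiagonal.mem_antidiagonal] at hx
  obtain h | h := Nat.eq_zero_or_pos x.2
  · simp [h, hG]
  · exact hP _ (hF _ (by omega) _) _

theorem conv_mem_of_right {P : Submodule K A.carrier} (hP : ∀ x, ∀ y ∈ P, A.mul x y ∈ P)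
    {F G : A.Family V} (hF : F 0 = 0) {n : ℕ} (hG : ∀ m < n, ∀ v, G m v ∈ P) (v : ℕ → V) :
    A.conv F G n v ∈ P := by
  rw [conv_apply]
  refine sum_mem fun x hx => ?_
  rw [HasAntidiagonal.mem_antidiagonal] at hx
  obtain h | h := Nat.eq_zero_or_pos x.1
  · simp [h, hF]
  · exact hP _ _ (hG _ (by omega) _)

theorem postcomp_zero_index (φ : A.carrier →ₗ[K] A.carrier) {F : A.Family V} (hF : F 0 = 0) :
    A.postcomp φ F 0 = 0 := by
  funext v
  simp [postcomp_apply, hF]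

theorem square_apply_congr {F G : A.Family V} (hF : F 0 = 0) (hG : G 0 = 0) {n : ℕ}
    (h : ∀ m < n, F m = G m) : A.square F n = A.square G n := by
  funext v
  rw [← sub_eq_zero, ← Submodule.mem_bot K, ← Pi.sub_apply, ← Pi.sub_apply, square_sub_square]
  refine add_mem (conv_mem_of_left (by simp) hF (fun m hm v => ?_) v)
    (conv_mem_of_right (by simp) (postcomp_zero_index _ hG) (fun m hm v => ?_) v) <;>
  simp [postcomp_apply, h m hm]

end Family

section Degree

variable {A : DGAlgebra.{v, w} K} {V : Type*} [AddCommGroup V] [Module K V]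

/-- `F` has degree `p - n` as a function of `n` homogeneous elements. -/
def HasDegree (gr : ℤ → Submodule K V) (p : ℤ) (F : A.Family V) : Prop :=
  ∀ (n : ℕ) (v : ℕ → V) (deg : ℕ → ℤ), (∀ i, v i ∈ gr (deg i)) →
    F n v ∈ A.gr (∑ l ∈ range n, deg l + (p - n))

variable {gr : ℤ → Submodule K V} {F G : A.Family V}

theorem HasDegree.add {p : ℤ} (hF : HasDegree gr p F) (hG : HasDegree gr p G) :
    HasDegree gr p (F + G) :=
  fun n v deg hv => add_mem (hF n v deg hv) (hG n v deg hv)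

theorem HasDegree.sub {p : ℤ} (hF : HasDegree gr p F) (hG : HasDegree gr p G) :
    HasDegree gr p (F - G) :=
  fun n v deg hv => sub_mem (hF n v deg hv) (hG n v deg hv)

theorem HasDegree.postcomp {p k q : ℤ} {φ : A.carrier →ₗ[K] A.carrier} (hpkq : p + k = q)
    (hφ : ∀ i, ∀ x ∈ A.gr i, φ x ∈ A.gr (i + k)) (hF : HasDegree gr p F) :
    HasDegree gr q (A.postcomp φ F) := fun n v deg hv => by
  have := hφ _ _ (hF n v deg hv)
  rwa [show ∑ l ∈ range n, deg l + (p - n) + k = ∑ l ∈ range n, deg l + (q - n) by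
    rw [← hpkq]; ring] at this

theorem HasDegree.conv {p q : ℤ} (hF : HasDegree gr p F) (hG : HasDegree gr q G) :
    HasDegree gr (p + q) (A.conv F G) := fun n v deg hv => by
  rw [conv_apply]
  refine sum_mem fun x hx => ?_
  have := A.mul_mem _ _ _ _ (hF x.1 v deg hv)
    (hG x.2 (fun k => v (x.1 + k)) (fun k => deg (x.1 + k)) fun k => hv _)
  rw [← HasAntidiagonal.mem_antidiagonal.1 hx, sum_range_add, Nat.cast_add]
  convert this using 2
  ring

theorem HasDegree.square (hF : HasDegree gr 1 F) : HasDegree gr 2 (A.square F) :=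
  (hF.postcomp (k := 0) rfl (by simpa using fun i x => involution_mem)).conv hF

theorem isMultilinearSeq_conv (hF : ∀ n, IsMultilinearSeq K n (F n))
    (hG : ∀ n, IsMultilinearSeq K n (G n)) (n : ℕ) : IsMultilinearSeq K n (A.conv F G n) :=
  .sum _ fun x hx => .mul A.mul (HasAntidiagonal.mem_antidiagonal.1 hx) (hF x.1) (hG x.2)

/-- A family with the linearity and the degrees of the components of an `A_∞`-morphism. -/
structure IsAdmissible (gr : ℤ → Submodule K V) (F : A.Family V) : Prop where
  zero : F 0 = 0
  isMultilinearSeq : ∀ n, IsMultilinearSeq K n (F n)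
  hasDegree : HasDegree gr 1 F

end Degree

end DGAlgebra

namespace DGAlgebra

variable {K : Type v} [Field K]

/-- `h` is a contracting homotopy of the subcomplex `N`, on cocycles. -/
structure IsContraction {A : DGAlgebra.{v, w} K} (N : Submodule K A.carrier)
    (h : A.carrier →ₗ[K] A.carrier) : Prop where
  mem_gr : ∀ i, ∀ x ∈ A.gr i, h x ∈ A.gr (i - 1)
  mem : ∀ x ∈ N, A.d x = 0 → h x ∈ N
  d_apply : ∀ x ∈ N, A.d x = 0 → A.d (h x) = x

theorem exists_isContraction {A : DGAlgebra.{v, w} K} {N : Submodule K A.carrier}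
    (hN : N.IsHomogeneous A.gr) (acyclic : ∀ x ∈ N, A.d x = 0 → ∃ y ∈ N, A.d y = x) :
    ∃ h, IsContraction N h := by
  classical
  let Z := N ⊓ LinearMap.ker A.d
  obtain ⟨s, hs⟩ := exists_linearMap_mem_of_forall_exists
    (N.comap (LinearMap.snd K Z A.carrier) ⊓ LinearMap.eqLocus
      (A.d.comp (LinearMap.snd K Z A.carrier)) (Z.subtype.comp (LinearMap.fst K Z A.carrier)))
    fun x => (acyclic x x.2.1 x.2.2).imp fun y hy => ⟨hy.1, hy.2⟩
  obtain ⟨t, ht⟩ := s.exists_extend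
  let h : A.carrier →ₗ[K] A.carrier := lift fun i => (A.proj (i - 1)).comp (t.comp (A.gr i).subtype)
  have h_apply {i : ℤ} {x : A.carrier} (hx : x ∈ A.gr i) : h x = A.proj (i - 1) (t x) :=
    lift_apply _ hx
  have d_proj (i : ℤ) {x : A.carrier} (hx : A.d x = 0) : A.d (A.proj i x) = 0 := by
    rw [← A.proj_d, hx, map_zero]
  have h_proj (i : ℤ) {x : A.carrier} (hx : x ∈ N) (hdx : A.d x = 0) :
      h (A.proj i x) ∈ N ∧ A.d (h (A.proj i x)) = A.proj i x := by
    obtain ⟨s_mem, d_s⟩ := hs ⟨A.proj i x, hN i hx, d_proj i hdx⟩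
    have t_eq : t (A.proj i x) = s ⟨A.proj i x, hN i hx, d_proj i hdx⟩ :=
      LinearMap.congr_fun ht ⟨A.proj i x, hN i hx, d_proj i hdx⟩
    replace d_s : A.d (t (A.proj i x)) = A.proj i x := (congrArg A.d t_eq).trans d_s
    rw [h_apply (A.proj_mem i x)]
    refine ⟨hN (i - 1) (t_eq ▸ s_mem), ?_⟩
    rw [← A.proj_d, d_s, sub_add_cancel, A.proj_of_mem (A.proj_mem i x)]
  refine ⟨h, fun i x hx => h_apply hx ▸ A.proj_mem _ _, fun x hx hdx => ?_, fun x hx hdx => ?_⟩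
  · rw [← DirectSum.sum_support_decompose A.gr x, map_sum]
    exact sum_mem fun i _ => (h_proj i hx hdx).1
  · conv_rhs => rw [← DirectSum.sum_support_decompose A.gr x]
    conv_lhs => rw [← DirectSum.sum_support_decompose A.gr x, map_sum, map_sum]
    exact sum_congr rfl fun i _ => (h_proj i hx hdx).2

section MaurerCartan

variable (A : DGAlgebra.{v, w} K) {V : Type*} (h : A.carrier →ₗ[K] A.carrier)

/-- One step of the iteration that deforms `G` into a solution of the Maurer–Cartan equation. -/
noncomputable def correct (G F : A.Family V) : A.Family V :=
  G - A.postcomp h (A.postcomp A.d G + A.square F)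

/-- The limit of the iteration `F ↦ correct h G F` started at `G`. The members up to index `n` no
longer change after `n` steps. -/
noncomputable def solution (G : A.Family V) : A.Family V :=
  fun n => (A.correct h G)^[n] G n

variable {A h} {F G : A.Family V}

theorem correct_apply (n : ℕ) (v : ℕ → V) :
    A.correct h G F n v = G n v - h (A.d (G n v) + A.square F n v) := rfl

theorem correct_zero_index (hG : G 0 = 0) (hF : F 0 = 0) : A.correct h G F 0 = 0 := by
  have : A.square F 0 = A.square 0 0 := square_apply_congr hF rfl (by simp)
  funext v
  rw [correct_apply, this]
  simp [hG, square]

theorem iterate_correct_zero_index (hG : G 0 = 0) (k : ℕ) : (A.correct h G)^[k] G 0 = 0 := by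
  induction k with
  | zero => exact hG
  | succ k ih => rw [Function.iterate_succ_apply', correct_zero_index hG ih]

theorem iterate_correct_succ_apply (hG : G 0 = 0) (k : ℕ) : ∀ n ≤ k,
    (A.correct h G)^[k + 1] G n = (A.correct h G)^[k] G n := by
  induction k with
  | zero =>
    rintro n hn
    obtain rfl := Nat.le_zero.1 hn
    simp only [iterate_correct_zero_index hG]
  | succ k ih =>
    intro n hn
    have square_eq : A.square ((A.correct h G)^[k + 1] G) n = A.square ((A.correct h G)^[k] G) n :=
      square_apply_congr (iterate_correct_zero_index hG _) (iterate_correct_zero_index hG _)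
        fun m hm => ih m (by omega)
    funext v
    rw [Function.iterate_succ_apply', correct_apply, square_eq, Function.iterate_succ_apply',
      correct_apply]

theorem iterate_correct_apply_of_le (hG : G 0 = 0) {n k : ℕ} (hnk : n ≤ k) :
    (A.correct h G)^[k] G n = A.solution h G n := by
  induction k, hnk using Nat.le_induction with
  | base => rfl
  | succ k hnk ih => rw [iterate_correct_succ_apply hG k n hnk, ih]

theorem solution_zero_index (hG : G 0 = 0) : A.solution h G 0 = 0 := hG

theorem solution_eq_correct (hG : G 0 = 0) : A.solution h G = A.correct h G (A.solution h G) := by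
  funext n v
  have square_eq : A.square ((A.correct h G)^[n] G) n = A.square (A.solution h G) n :=
    square_apply_congr (iterate_correct_zero_index hG _) (solution_zero_index hG)
      fun m hm => iterate_correct_apply_of_le hG hm.le
  rw [← iterate_correct_apply_of_le hG n.le_succ, Function.iterate_succ_apply']
  rw [correct_apply, square_eq, correct_apply]

theorem solution_one_index (hG : G 0 = 0) {v : ℕ → V} (d_G : A.d (G 1 v) = 0) :
    A.solution h G 1 v = G 1 v := by
  have hF : A.solution h G 0 = 0 := hG
  rw [solution_eq_correct hG, correct_apply, d_G]
  simp [square, conv_apply, postcomp_apply, Finset.Nat.antidiagonal_succ, hF]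

variable {N : Submodule K A.carrier}

theorem sub_mem_and_curvature_solution_eq_zero (hh : IsContraction N h)
    (hN : N.IsHomogeneous A.gr) (mul_mem_right : ∀ x ∈ N, ∀ y, A.mul x y ∈ N)
    (mul_mem_left : ∀ x, ∀ y ∈ N, A.mul x y ∈ N) (hG : G 0 = 0)
    (curvature_mem : ∀ n v, A.curvature G n v ∈ N) (n : ℕ) : ∀ v,
    (A.solution h G - G) n v ∈ N ∧ A.curvature (A.solution h G) n v = 0 := by
  induction n using Nat.strong_induction_on with | _ n ih =>
  intro v
  set F := A.solution h G
  have hF : F 0 = 0 := hG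
  let C := A.d (G n v) + A.square F n v
  have C_mem : C ∈ N := by
    have square_sub_mem : (A.square F - A.square G) n v ∈ N := by
      rw [square_sub_square]
      refine add_mem (conv_mem_of_left mul_mem_right hF (fun m hm w => ?_) v)
        (conv_mem_of_right mul_mem_left (postcomp_zero_index _ hG) (fun m hm w => (ih m hm w).1) v)
      exact involution_mem_of_isHomogeneous hN (ih m hm w).1
    have C_eq : C = A.curvature G n v + (A.square F - A.square G) n v := by
      simp only [C, curvature, Pi.add_apply, Pi.sub_apply, postcomp_apply]
      abel
    exact C_eq ▸ add_mem (curvature_mem n v) square_sub_mem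
  have d_C : A.d C = 0 := by
    have curvature_eq_zero (m : ℕ) (hm : m < n) (w : ℕ → V) :
        A.curvature F m w ∈ (⊥ : Submodule K A.carrier) := (ih m hm w).2
    rw [map_add, A.d_d, zero_add, ← postcomp_apply, postcomp_d_square]
    refine (Submodule.mem_bot K).1 (sub_mem (conv_mem_of_right (by simp) hF curvature_eq_zero v)
      (conv_mem_of_left (by simp) hF (fun m hm w => ?_) v))
    rw [postcomp_apply, (ih m hm w).2, map_zero]
    exact zero_mem _
  have F_eq : F n v = G n v - h C := congrFun (congrFun (solution_eq_correct hG) n) v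
  constructor
  · simpa [F_eq] using hh.mem C C_mem d_C
  · change A.d (F n v) + A.square F n v = 0
    rw [F_eq, map_sub, hh.d_apply C C_mem d_C]
    simp [C]

theorem curvature_solution (hh : IsContraction N h)
    (hN : N.IsHomogeneous A.gr) (mul_mem_right : ∀ x ∈ N, ∀ y, A.mul x y ∈ N)
    (mul_mem_left : ∀ x, ∀ y ∈ N, A.mul x y ∈ N) (hG : G 0 = 0)
    (curvature_mem : ∀ n v, A.curvature G n v ∈ N) : A.curvature (A.solution h G) = 0 := by
  funext n v
  exact (sub_mem_and_curvature_solution_eq_zero hh hN mul_mem_right mul_mem_left hG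
    curvature_mem n v).2

section Admissible

variable [AddCommGroup V] [Module K V] {gr : ℤ → Submodule K V}

theorem IsAdmissible.correct (h_mem : ∀ i, ∀ x ∈ A.gr i, h x ∈ A.gr (i - 1))
    (hG : IsAdmissible gr G) (hF : IsAdmissible gr F) : IsAdmissible gr (A.correct h G F) where
  zero := correct_zero_index hG.zero hF.zero
  isMultilinearSeq n := by
    have hd := (hG.isMultilinearSeq n).comp A.d
    have hsq : IsMultilinearSeq K n (A.square F n) :=
      isMultilinearSeq_conv (F := A.postcomp A.involution F)
        (fun n => (hF.isMultilinearSeq n).comp A.involution) hF.isMultilinearSeq n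
    have := (hG.isMultilinearSeq n).add ((hd.add hsq).comp (-h))
    convert this using 1
    funext v
    rw [correct_apply, sub_eq_add_neg, LinearMap.neg_apply]
  hasDegree := hG.hasDegree.sub <| ((hG.hasDegree.postcomp (by norm_num) A.d_mem).add
    hF.hasDegree.square).postcomp (k := -1) (by norm_num) h_mem

theorem IsAdmissible.solution (h_mem : ∀ i, ∀ x ∈ A.gr i, h x ∈ A.gr (i - 1))
    (hG : IsAdmissible gr G) : IsAdmissible gr (A.solution h G) := by
  have iterate (k : ℕ) : IsAdmissible gr ((A.correct h G)^[k] G) := by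
    induction k with
    | zero => exact hG
    | succ k ih => rw [Function.iterate_succ_apply']; exact hG.correct h_mem ih
  exact ⟨hG.zero, fun n => (iterate n).isMultilinearSeq n, fun n => (iterate n).hasDegree n⟩

end Admissible

end MaurerCartan

end DGAlgebra

namespace DGAlgebra

variable {K : Type v} [Field K]

theorem ops_eq_zero_of_d_mul_eq_zero {H : DGAlgebra.{v, w} K} (hd : H.d = 0) (hmul : H.mul = 0) :
    ∀ n, H.ops n = 0
  | 0 => rfl
  | 1 => by ext v; simp [ops_one, hd]
  | 2 => by ext v; simp [ops_two, hmul]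
  | _ + 3 => rfl

/-- The exponent of the sign by which a twisting family differs from an `A_∞`-morphism: the sign
obtained when the shifts that turn `H` into its bar construction move past the arguments. -/
def twistExp (n : ℕ) (deg : ℕ → ℤ) : ℤ := ∑ l ∈ range n, ((n - 1 - l : ℕ) : ℤ) * deg l

theorem twistExp_add (i j : ℕ) (deg : ℕ → ℤ) : twistExp (i + j) deg =
    twistExp i deg + j * ∑ l ∈ range i, deg l + twistExp j (fun k => deg (i + k)) := by
  simp only [twistExp, sum_range_add, mul_sum, ← sum_add_distrib, ← add_mul]
  congr 1
  · refine sum_congr rfl fun l hl => ?_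
    rw [mem_range] at hl
    rw [show i + j - 1 - l = i - 1 - l + j by omega, Nat.cast_add]
  · refine sum_congr rfl fun l _ => ?_
    rw [show i + j - 1 - (i + l) = j - 1 - l by omega]

variable {H : DGAlgebra.{v, w} K} {A : DGAlgebra.{v, w'} K}

theorem sum_antidiagonal_mul_of_twist {F : A.Family H.carrier} (hF : HasDegree H.gr 1 F)
    {v : ℕ → H.carrier} {deg : ℕ → ℤ} (hv : ∀ i, v i ∈ H.gr (deg i)) (n : ℕ) :
    ∑ x ∈ antidiagonal n, ((x.1 : ℤ) - 1 + (1 - (x.2 : ℤ)) * ∑ l ∈ range x.1, deg l).negOnePow •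
        A.mul ((-1 : K) ^ twistExp x.1 deg • F x.1 v)
          ((-1 : K) ^ twistExp x.2 (fun k => deg (x.1 + k)) • F x.2 fun k => v (x.1 + k)) =
      (-1 : K) ^ twistExp n deg • A.square F n v := by
  rw [square, conv_apply, smul_sum]
  refine sum_congr rfl fun ⟨i, j⟩ hij => ?_
  obtain rfl := HasAntidiagonal.mem_antidiagonal.1 hij
  have neg_one_ne_zero : (-1 : K) ≠ 0 := by simp
  simp only [postcomp_apply, involution_apply (hF i v deg hv), map_smul, LinearMap.smul_apply,
    smul_smul, negOnePow_smul_eq_zpow_smul K, ← zpow_add₀ neg_one_ne_zero]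
  congr 1
  apply neg_one_zpow_eq_of_even_sub
  rw [twistExp_add]
  exact ⟨(i : ℤ) - 1 - j * ∑ l ∈ range i, deg l, by ring⟩

theorem IsAdmissible.exists_components {F : A.Family H.carrier} (hF : IsAdmissible H.gr F) :
    ∃ f : (n : ℕ) → MultilinearMap K (fun _ : Fin n => H.carrier) A.carrier,
      f 0 = 0 ∧ (∀ x, f 1 (fun _ => x) = F 1 fun _ => x) ∧
      ∀ (n : ℕ) (v : ℕ → H.carrier) (deg : ℕ → ℤ), (∀ i, v i ∈ H.gr (deg i)) →
        f n (fun i => v i) = (-1 : K) ^ twistExp n deg • F n v := by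
  choose φ hφ using hF.isMultilinearSeq
  refine ⟨fun n => (φ n).compLinearMap fun l : Fin n => H.involution ^ (n - 1 - (l : ℕ)),
    ?_, fun x => ?_, fun n v deg hv => ?_⟩
  · ext v
    have := hφ 0 fun _ => 0
    rw [hF.zero] at this
    rw [MultilinearMap.compLinearMap_apply, zero_apply]
    exact (congrArg (φ 0) (Subsingleton.elim _ _)).trans this
  · rw [← hφ 1]
    simp [MultilinearMap.compLinearMap_apply]
  · simp only [MultilinearMap.compLinearMap_apply, H.involution_pow_apply (hv _)]
    rw [MultilinearMap.map_smul_univ, hφ, twistExp, neg_one_zpow_sum, prod_range]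

theorem IsAdmissible.exists_hom {F : A.Family H.carrier} (hF : IsAdmissible H.gr F)
    (hd : H.d = 0) (hmul : H.mul = 0) (curvature_eq_zero : A.curvature F = 0) :
    ∃ G : AInfAlgebra.Hom H.toAInf A.toAInf, ∀ x, G.linear x = F 1 fun _ => x := by
  obtain ⟨f, f_zero, f_one, f_apply⟩ := hF.exists_components
  refine ⟨homOfComponents f f_zero (fun n v deg hv => ?_) fun n v deg _ hv => ?_, f_one⟩
  · rw [f_apply n v deg hv]
    exact Submodule.smul_mem _ _ (hF.hasDegree n v deg hv)
  · refine Eq.trans (sum_eq_zero fun x _ => sum_eq_zero fun y _ => ?_) (Eq.symm ?_)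
    · rw [MultilinearMap.map_coord_zero (i := ⟨x.1, by omega⟩), smul_zero]
      simp [spliceSeq, ops_eq_zero_of_d_mul_eq_zero hd hmul]
    · have f_apply_add (i j : ℕ) : f j (fun k => v (i + k)) =
          (-1 : K) ^ twistExp j (fun k => deg (i + k)) • F j fun k => v (i + k) :=
        f_apply j (fun k => v (i + k)) (fun k => deg (i + k)) fun k => hv _
      simp only [f_apply _ v deg hv, f_apply_add]
      rw [sum_antidiagonal_mul_of_twist hF.hasDegree hv, map_smul, ← smul_add]
      exact smul_eq_zero_of_right _ (congrFun (congrFun curvature_eq_zero n) v)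

end DGAlgebra

/-! ### Two criteria for formality -/

namespace DGAlgebra

variable {K : Type v} [Field K]

section ProductFamily

variable {A : DGAlgebra.{v, w} K} {V : Type*} [AddCommGroup V] [Module K V]

/-- The family `v ↦ a (v 0) * c (v 1) * ⋯ * c (v (n - 1))`. -/
noncomputable def productFamily (a c : V →ₗ[K] A.carrier) : A.Family V
  | 0, _ => 0
  | 1, v => a (v 0)
  | n + 2, v => A.mul (productFamily a c (n + 1) v) (c (v (n + 1)))

variable {a c : V →ₗ[K] A.carrier}

theorem isMultilinearSeq_productFamily : ∀ n, IsMultilinearSeq K n (A.productFamily a c n)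
  | 0 => .zero _
  | 1 => .apply_zero a
  | n + 2 => .mul A.mul rfl (isMultilinearSeq_productFamily (n + 1)) (.apply_zero c)

theorem hasDegree_productFamily {gr : ℤ → Submodule K V} (ha : ∀ i, ∀ x ∈ gr i, a x ∈ A.gr i)
    (hc : ∀ i, ∀ x ∈ gr i, c x ∈ A.gr (i - 1)) : HasDegree gr 1 (A.productFamily a c)
  | 0, _, _, _ => zero_mem _
  | 1, _, _, hv => by simpa [productFamily] using ha _ _ (hv 0)
  | n + 2, v, deg, hv => by
    rw [productFamily]
    convert A.mul_mem _ _ _ _ (hasDegree_productFamily ha hc (n + 1) v deg hv)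
      (hc _ _ (hv (n + 1))) using 2
    rw [sum_range_succ _ (n + 1)]
    push_cast
    ring

theorem isAdmissible_productFamily {gr : ℤ → Submodule K V} (ha : ∀ i, ∀ x ∈ gr i, a x ∈ A.gr i)
    (hc : ∀ i, ∀ x ∈ gr i, c x ∈ A.gr (i - 1)) : IsAdmissible gr (A.productFamily a c) :=
  ⟨rfl, isMultilinearSeq_productFamily, hasDegree_productFamily ha hc⟩

theorem productFamily_mem {J : Submodule K A.carrier} (mul_mem : ∀ x ∈ J, ∀ y, A.mul x y ∈ J)
    (ha : ∀ x, a x ∈ J) : ∀ (n : ℕ) (v : ℕ → V), A.productFamily a c n v ∈ J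
  | 0, _ => zero_mem _
  | 1, _ => ha _
  | n + 2, _ => mul_mem _ (productFamily_mem mul_mem ha (n + 1) _) _

theorem square_productFamily (n : ℕ) (v : ℕ → V) : A.square (A.productFamily a c) (n + 2) v =
    A.mul (A.square (A.productFamily a c) (n + 1) v) (c (v (n + 1))) +
      A.mul (A.involution (A.productFamily a c (n + 1) v)) (a (v (n + 1))) := by
  simp only [square, conv_apply, Finset.Nat.sum_antidiagonal_succ', productFamily, map_zero,
    zero_add, map_sum, LinearMap.sum_apply, A.mul_assoc, add_zero, postcomp_apply]
  rw [add_comm]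
  congr 1
  refine sum_congr rfl fun x hx => ?_
  rw [← HasAntidiagonal.mem_antidiagonal.1 hx]
  congr 3

theorem curvature_productFamily (n : ℕ) (v : ℕ → V) :
    A.curvature (A.productFamily a c) (n + 2) v =
      A.mul (A.curvature (A.productFamily a c) (n + 1) v) (c (v (n + 1))) +
        A.mul (A.involution (A.productFamily a c (n + 1) v))
          (A.d (c (v (n + 1))) + a (v (n + 1))) := by
  simp only [curvature, Pi.add_apply, postcomp_apply, square_productFamily, map_add,
    LinearMap.add_apply]
  rw [productFamily, d_mul]
  abel

theorem curvature_productFamily_mem {N : Submodule K A.carrier}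
    (mul_mem : ∀ x ∈ N, ∀ y, A.mul x y ∈ N) (d_a : ∀ x, A.d (a x) = 0)
    (hac : ∀ n v x, A.mul (A.involution (A.productFamily a c n v)) (A.d (c x) + a x) ∈ N) :
    ∀ n v, A.curvature (A.productFamily a c) n v ∈ N
  | 0, v => by simp [curvature, square, conv_apply, postcomp_apply, productFamily]
  | 1, v => by
    simp [curvature, square, conv_apply, postcomp_apply, productFamily, d_a,
      Finset.Nat.antidiagonal_succ]
  | n + 2, v => by
    rw [curvature_productFamily]
    exact add_mem (mul_mem _ (curvature_productFamily_mem mul_mem d_a hac (n + 1) v) _)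
      (hac (n + 1) v _)

end ProductFamily

section Harmonic

variable {A : DGAlgebra.{v, w} K} {P : Submodule K A.carrier}

/-- `P` is a graded space of cocycles that represents every cohomology class exactly once. -/
structure IsHarmonic (P : Submodule K A.carrier) : Prop where
  isHomogeneous : P.IsHomogeneous A.gr
  le_ker : P ≤ LinearMap.ker A.d
  disjoint : Disjoint P (LinearMap.range A.d)
  ker_le : LinearMap.ker A.d ≤ P ⊔ LinearMap.range A.d

theorem exists_isHarmonic_le {J : Submodule K A.carrier} (hJ : J.IsHomogeneous A.gr)
    (ker_le : LinearMap.ker A.d ≤ J ⊔ LinearMap.range A.d) :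
    ∃ P ≤ J, IsHarmonic P := by
  let Z (i : ℤ) := A.gr i ⊓ (J ⊓ LinearMap.ker A.d)
  choose W disjoint sup_eq using fun i =>
    IsModularLattice.exists_disjoint_and_sup_eq (inf_le_left : Z i ⊓ LinearMap.range A.d ≤ Z i)
  have W_le (i : ℤ) : W i ≤ Z i := (sup_eq i).le.trans' le_sup_right
  let P := ⨅ i, (W i).comap (A.proj i)
  have mem_P {x : A.carrier} : x ∈ P ↔ ∀ i, A.proj i x ∈ W i := by simp [P]
  have W_le_P (i : ℤ) : W i ≤ P := fun x hx => mem_P.2 fun j => by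
    obtain rfl | hij := eq_or_ne i j
    · rwa [A.proj_of_mem (W_le i hx).1]
    · simp [A.proj_of_mem_ne (W_le i hx).1 hij]
  refine ⟨P, fun x hx => A.mem_of_forall_proj_mem fun i => (W_le i (mem_P.1 hx i)).2.1,
    fun i x hx => W_le_P i (mem_P.1 hx i),
    fun x hx => A.mem_of_forall_proj_mem fun i => (W_le i (mem_P.1 hx i)).2.2,
    Submodule.disjoint_def.2 fun x hx hxd => ?_,
    fun x hx => A.mem_of_forall_proj_mem fun i => ?_⟩
  · refine (Submodule.mem_bot K).1 (A.mem_of_forall_proj_mem fun i => ?_)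
    obtain ⟨y, rfl⟩ := hxd
    have hW := mem_P.1 hx i
    refine (disjoint i).le_bot ⟨⟨W_le i hW, A.proj (i - 1) y, ?_⟩, hW⟩
    rw [← A.proj_d, sub_add_cancel]
  · obtain ⟨y, hy, _, ⟨z, rfl⟩, rfl⟩ := Submodule.mem_sup.1 (ker_le hx)
    have hdy : A.d y = 0 := by simpa [A.d_d] using hx
    have proj_y_mem : A.proj i y ∈ Z i :=
      ⟨A.proj_mem i y, hJ i hy, (A.proj_d i y).symm.trans (by rw [hdy, map_zero])⟩
    have Z_le : Z i ≤ P ⊔ LinearMap.range A.d :=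
      (sup_eq i).ge.trans (sup_le (inf_le_right.trans le_sup_right) ((W_le_P i).trans le_sup_left))
    have proj_d_mem : A.proj i (A.d z) ∈ P ⊔ LinearMap.range A.d :=
      Submodule.mem_sup_right ⟨A.proj (i - 1) z, by rw [← A.proj_d, sub_add_cancel]⟩
    rw [map_add]
    exact add_mem (Z_le proj_y_mem) proj_d_mem

theorem isInternal_comap_subtype (hP : P.IsHomogeneous A.gr) :
    DirectSum.IsInternal fun i => (A.gr i).comap P.subtype := by
  refine DirectSum.isInternal_submodule_of_iSupIndep_of_iSup_eq_top (fun i => ?_)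
    (eq_top_iff.2 fun x _ => ?_)
  · refine Submodule.disjoint_def.2 fun x hx hx' => Subtype.ext ?_
    refine Submodule.disjoint_def.1 (A.isInternal.submodule_iSupIndep i) x.1 hx ?_
    have map_le : (⨆ j, ⨆ (_ : j ≠ i), (A.gr j).comap P.subtype).map P.subtype ≤
        ⨆ j, ⨆ (_ : j ≠ i), A.gr j := by
      simp only [Submodule.map_iSup]
      exact iSup₂_mono fun j _ => Submodule.map_comap_le _ _
    exact map_le ⟨x, hx', rfl⟩
  · have coe_mem : x.1 ∈ (⨆ i, (A.gr i).comap P.subtype).map P.subtype :=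
      A.mem_of_forall_proj_mem fun i =>
        ⟨⟨A.proj i x, hP i x.2⟩, Submodule.mem_iSup_of_mem i (A.proj_mem i x), rfl⟩
    obtain ⟨y, hy, hyx⟩ := coe_mem
    rwa [← Subtype.ext hyx]

/-- The graded space `P` as a dg-algebra with trivial differential and product `m`. -/
def ofSubmodule (hP : P.IsHomogeneous A.gr) (m : P →ₗ[K] P →ₗ[K] P)
    (m_mem : ∀ i j, ∀ x y : P, x.1 ∈ A.gr i → y.1 ∈ A.gr j → (m x y).1 ∈ A.gr (i + j))
    (m_assoc : ∀ x y z, m (m x y) z = m x (m y z)) : DGAlgebra.{v, w} K where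
  carrier := P
  gr i := (A.gr i).comap P.subtype
  isInternal := isInternal_comap_subtype hP
  d := 0
  mul := m
  d_mem _ _ _ := zero_mem _
  mul_mem := m_mem
  d_d _ := rfl
  mul_assoc := m_assoc
  leibniz _ _ _ _ := by simp

theorem IsHarmonic.isFormal (hP : IsHarmonic P) {m : P →ₗ[K] P →ₗ[K] P}
    {m_mem : ∀ i j, ∀ x y : P, x.1 ∈ A.gr i → y.1 ∈ A.gr j → (m x y).1 ∈ A.gr (i + j)}
    {m_assoc : ∀ x y z, m (m x y) z = m x (m y z)}
    (F : AInfAlgebra.Hom (ofSubmodule hP.isHomogeneous m m_mem m_assoc).toAInf A.toAInf)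
    (hF : ∀ x : P, F.linear x = x.1) : A.IsFormal := by
  refine ⟨_, rfl, F, isQuasiIso_of_forall rfl F P.subtype hF (fun x y hy => ?_) fun y hy => ?_⟩
  · exact Subtype.ext (Submodule.disjoint_def.1 hP.disjoint x.1 x.2 ⟨y, hy⟩)
  · obtain ⟨x, hx, _, ⟨z, rfl⟩, rfl⟩ := Submodule.mem_sup.1 (hP.ker_le hy)
    exact ⟨⟨x, hx⟩, z, (add_sub_cancel_left x _).symm⟩

end Harmonic

section Strict

/-- The components of the `A_∞`-morphism given by a linear map. -/
def strictComponents {V W : Type*} [AddCommGroup V] [Module K V] [AddCommGroup W] [Module K W]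
    (g : V →ₗ[K] W) : (n : ℕ) → MultilinearMap K (fun _ : Fin n => V) W
  | 1 => MultilinearMap.ofSubsingleton K V W (0 : Fin 1) g
  | _ => 0

theorem strictComponents_apply {V W : Type*} [AddCommGroup V] [Module K V] [AddCommGroup W]
    [Module K W] (g : V →ₗ[K] W) (v : ℕ → V) :
    ∀ n, strictComponents g n (fun i => v i) = if n = 1 then g (v 0) else 0
  | 0 => rfl
  | 1 => rfl
  | _ + 2 => rfl

variable {H : DGAlgebra.{v, w} K} {A : DGAlgebra.{v, w'} K}

theorem sum_strictComponents_spliceSeq (g : H.carrier →ₗ[K] A.carrier) {n : ℕ} (hn : 0 < n)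
    (v : ℕ → H.carrier) (deg : ℕ → ℤ) :
    ∑ x ∈ antidiagonal n, ∑ y ∈ antidiagonal x.2 with 1 ≤ y.1,
      (((x.1 : ℤ) + y.1 * y.2) + (2 - (y.1 : ℤ)) * ∑ l ∈ range x.1, deg l).negOnePow •
        strictComponents g (x.1 + 1 + y.2)
          (fun i => spliceSeq v x.1 y.1 (H.ops y.1 fun j => v (x.1 + j)) i) =
      g (H.ops n fun j => v j) := by
  simp only [strictComponents_apply]
  rw [sum_eq_single (0, n), sum_eq_single (n, 0)]
  · simp [spliceSeq]
  · intro y hy hne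
    rw [mem_filter, HasAntidiagonal.mem_antidiagonal] at hy
    rw [if_neg, smul_zero]
    exact fun h => hne (Prod.ext (by grind) (by grind))
  · simp; omega
  · intro x hx hne
    rw [HasAntidiagonal.mem_antidiagonal] at hx
    refine sum_eq_zero fun y _ => ?_
    rw [if_neg, smul_zero]
    exact fun h => hne (Prod.ext (by grind) (by grind))
  · simp

theorem add_sum_strictComponents (g : H.carrier →ₗ[K] A.carrier) (v : ℕ → H.carrier)
    (deg : ℕ → ℤ) : ∀ n, A.d (strictComponents g n fun i => v i) + ∑ x ∈ antidiagonal n,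
      ((x.1 : ℤ) - 1 + (1 - (x.2 : ℤ)) * ∑ l ∈ range x.1, deg l).negOnePow •
        A.mul (strictComponents g x.1 fun i => v i) (strictComponents g x.2 fun i => v (x.1 + i)) =
      A.ops n fun j => g (v j)
  | 0 => by simp [strictComponents, ops]
  | 1 => by simp [strictComponents, Finset.Nat.antidiagonal_succ, ops_one]
  | 2 => by simp [strictComponents, Finset.Nat.antidiagonal_succ, ops_two]
  | n + 3 => by
    have apply_add (i j : ℕ) : strictComponents g j (fun k => v (i + k)) =
      if j = 1 then g (v i) else 0 := strictComponents_apply g (fun k => v (i + k)) j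
    simp only [apply_add, strictComponents_apply]
    rw [sum_eq_zero fun x hx => ?_]
    · simp [ops]
    · rw [HasAntidiagonal.mem_antidiagonal] at hx
      split_ifs <;> first | omega | simp

theorem map_ops (g : H.carrier →ₗ[K] A.carrier) (hd : ∀ x, g (H.d x) = A.d (g x))
    (hmul : ∀ x y, g (H.mul x y) = A.mul (g x) (g y)) (v : ℕ → H.carrier) :
    ∀ n, g (H.ops n fun j => v j) = A.ops n fun j => g (v j)
  | 0 => map_zero g
  | 1 => hd _
  | 2 => hmul _ _
  | _ + 3 => map_zero g

theorem exists_hom_of_strict (g : H.carrier →ₗ[K] A.carrier)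
    (hgr : ∀ i, ∀ x ∈ H.gr i, g x ∈ A.gr i) (hd : ∀ x, g (H.d x) = A.d (g x))
    (hmul : ∀ x y, g (H.mul x y) = A.mul (g x) (g y)) :
    ∃ F : AInfAlgebra.Hom H.toAInf A.toAInf, ∀ x, F.linear x = g x := by
  refine ⟨homOfComponents (strictComponents g) rfl (fun n v deg hv => ?_)
    (fun n v deg hn _ => ?_), fun _ => rfl⟩
  · rw [strictComponents_apply]
    split_ifs with h
    · simpa [h] using hgr _ _ (hv 0)
    · exact zero_mem _
  · rw [sum_strictComponents_spliceSeq g hn, add_sum_strictComponents, map_ops g hd hmul]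

end Strict

variable {A : DGAlgebra.{v, w} K}

theorem IsHarmonic.isFormal_of_mul_mem {P : Submodule K A.carrier} (hP : IsHarmonic P)
    (mul_mem : ∀ x ∈ P, ∀ y ∈ P, A.mul x y ∈ P) : A.IsFormal := by
  let m : P →ₗ[K] P →ₗ[K] P := LinearMap.mk₂ K (fun x y => ⟨A.mul x y, mul_mem x x.2 y y.2⟩)
    (by simp) (by simp) (by simp) (by simp)
  obtain ⟨F, hF⟩ := exists_hom_of_strict (A := A)
    (H := ofSubmodule hP.isHomogeneous m (fun i j x y => A.mul_mem i j x y)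
      fun x y z => Subtype.ext (A.mul_assoc x y z))
    P.subtype (fun _ _ hx => hx) (fun x => (hP.le_ker x.2).symm) fun _ _ => rfl
  exact hP.isFormal F hF

theorem isHarmonic_span_singleton {e : A.carrier} (he : e ∈ A.gr 0) (hd : A.d e = 0)
    (inj : ∀ (c : K) y, A.d y = c • e → c = 0)
    (ker_le : LinearMap.ker A.d ≤ Submodule.span K {e} ⊔ LinearMap.range A.d) :
    IsHarmonic (Submodule.span K {e}) where
  isHomogeneous i x hx := by
    obtain ⟨c, rfl⟩ := Submodule.mem_span_singleton.1 hx
    change A.proj i (c • e) ∈ _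
    obtain rfl | hi := eq_or_ne 0 i
    · rwa [A.proj_of_mem (Submodule.smul_mem _ c he)]
    · rw [A.proj_of_mem_ne (Submodule.smul_mem _ c he) hi]
      exact zero_mem _
  le_ker := (Submodule.span_singleton_le_iff_mem _ _).2 hd
  disjoint := Submodule.disjoint_def.2 fun x hx ⟨y, hy⟩ => by
    obtain ⟨c, rfl⟩ := Submodule.mem_span_singleton.1 hx
    rw [inj c y hy, zero_smul]
  ker_le := ker_le

theorem isFormal_of_idempotent {e : A.carrier} (he : e ∈ A.gr 0) (hd : A.d e = 0)
    (hmul : A.mul e e = e) (inj : ∀ (c : K) y, A.d y = c • e → c = 0)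
    (ker_le : LinearMap.ker A.d ≤ Submodule.span K {e} ⊔ LinearMap.range A.d) : A.IsFormal := by
  refine (isHarmonic_span_singleton he hd inj ker_le).isFormal_of_mul_mem fun x hx y hy => ?_
  obtain ⟨c, rfl⟩ := Submodule.mem_span_singleton.1 hx
  obtain ⟨c', rfl⟩ := Submodule.mem_span_singleton.1 hy
  simpa [hmul, smul_smul] using Submodule.smul_mem _ _ (Submodule.mem_span_singleton_self e)

theorem exists_lowering_of_ker_le {H : DGAlgebra.{v, w'} K} {J : Submodule K A.carrier}
    (hJ : J.IsHomogeneous A.gr) (ker_le : LinearMap.ker A.d ≤ J ⊔ LinearMap.range A.d)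
    (a : H.carrier →ₗ[K] A.carrier) (a_mem : ∀ i, ∀ x ∈ H.gr i, a x ∈ A.gr i)
    (d_a : ∀ x, A.d (a x) = 0) :
    ∃ c : H.carrier →ₗ[K] A.carrier, (∀ i, ∀ x ∈ H.gr i, c x ∈ A.gr (i - 1)) ∧
      ∀ x, A.d (c x) + a x ∈ J := by
  obtain ⟨s, hs⟩ := exists_linearMap_mem_of_forall_exists
    (J.comap (a.coprod A.d)) fun x => by
      obtain ⟨y, hy, _, ⟨z, rfl⟩, hyz⟩ := Submodule.mem_sup.1 (ker_le (d_a x))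
      exact ⟨-z, by simpa [← hyz] using hy⟩
  let c := lift fun i => (A.proj (i - 1)).comp (s.comp (H.gr i).subtype)
  have c_apply {i : ℤ} {x : H.carrier} (hx : x ∈ H.gr i) : c x = A.proj (i - 1) (s x) :=
    lift_apply _ hx
  refine ⟨c, fun i x hx => c_apply hx ▸ A.proj_mem _ _, fun x => ?_⟩
  suffices J.mkQ.comp (A.d.comp c + a) = 0 from
    (Submodule.Quotient.mk_eq_zero J).1 (LinearMap.congr_fun this x)
  refine linearMap_ext fun i x hx => (Submodule.Quotient.mk_eq_zero J).2 ?_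
  have proj_mem : A.proj i (a x + A.d (s x)) ∈ J := hJ i (by simpa using hs x)
  have proj_d_s : A.proj i (A.d (s x)) = A.d (c x) := by
    rw [c_apply hx, ← A.proj_d, sub_add_cancel]
  rwa [map_add, A.proj_of_mem (a_mem i x hx), proj_d_s, add_comm] at proj_mem

/-- The inclusion `P → A` of harmonic cocycles in `J₁` extends to a twisting family: the products
`x₀ * c x₁ * ⋯ * c xₙ`, where `x + d (c x)` lies in `J₂`, satisfy the Maurer–Cartan equation modulo
`N`, and the error is corrected within the acyclic ideal `N`. -/
theorem isFormal_of_ideals {J₁ J₂ N : Submodule K A.carrier} (hJ₁ : J₁.IsHomogeneous A.gr)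
    (hJ₂ : J₂.IsHomogeneous A.gr) (hN : N.IsHomogeneous A.gr)
    (mul_mem : ∀ x ∈ J₁, ∀ y, A.mul x y ∈ J₁)
    (mul_mem_right : ∀ x ∈ N, ∀ y, A.mul x y ∈ N) (mul_mem_left : ∀ x, ∀ y ∈ N, A.mul x y ∈ N)
    (mul_mem_of_mem_of_mem : ∀ x ∈ J₁, ∀ y ∈ J₂, A.mul x y ∈ N)
    (acyclic : ∀ x ∈ N, A.d x = 0 → ∃ y ∈ N, A.d y = x)
    (ker_le₁ : LinearMap.ker A.d ≤ J₁ ⊔ LinearMap.range A.d)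
    (ker_le₂ : LinearMap.ker A.d ≤ J₂ ⊔ LinearMap.range A.d) : A.IsFormal := by
  obtain ⟨P, hPJ, hP⟩ := exists_isHarmonic_le hJ₁ ker_le₁
  let H := ofSubmodule hP.isHomogeneous 0 (fun _ _ _ _ _ _ => zero_mem _) fun _ _ _ => rfl
  obtain ⟨c, c_mem, hc⟩ := exists_lowering_of_ker_le (H := H) hJ₂ ker_le₂ P.subtype
    (fun _ _ hx => hx) fun x => hP.le_ker x.2
  obtain ⟨h, hh⟩ := exists_isContraction hN acyclic
  let G := A.productFamily P.subtype c
  have hG : IsAdmissible H.gr G := isAdmissible_productFamily (fun _ _ hx => hx) c_mem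
  have curvature_mem : ∀ n v, A.curvature G n v ∈ N :=
    curvature_productFamily_mem mul_mem_right (fun x => hP.le_ker x.2) fun n v x =>
      mul_mem_of_mem_of_mem _ (involution_mem_of_isHomogeneous hJ₁
        (productFamily_mem mul_mem (fun x => hPJ x.2) n v)) _ (hc x)
  obtain ⟨F, hF⟩ := (hG.solution hh.mem_gr).exists_hom (H := H) rfl rfl
    (curvature_solution hh hN mul_mem_right mul_mem_left hG.zero curvature_mem)
  exact hP.isFormal F fun x => (hF x).trans (solution_one_index hG.zero (hP.le_ker x.2))

end DGAlgebra

/-! ### Ordered chains and their subdivision -/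

/-- Linear combinations of finite sequences of points of `E`, of all lengths. A sequence stands for
an ordered simplex; the empty sequence is allowed and plays the role of the augmentation. -/
abbrev OrderedChain (K E : Type*) [Semiring K] := List E →₀ K

namespace OrderedChain

variable {K : Type*} [Ring K] {E E' : Type*} {M M' : Type*} [AddCommGroup M] [Module K M]
  [AddCommGroup M'] [Module K M']

section Boundary

/-- The cone on an ordered chain: `(p_0, …, p_n) ↦ (b, p_0, …, p_n)`. -/
noncomputable def cone (b : E) : OrderedChain K E →ₗ[K] OrderedChain K E :=
  Finsupp.lmapDomain K K (List.cons b)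

theorem cone_single (b : E) (l : List E) (c : K) :
    cone b (Finsupp.single l c) = Finsupp.single (b :: l) c :=
  Finsupp.mapDomain_single

theorem length_eraseIdx_add_one (l : List E) (j : Fin l.length) :
    (l.eraseIdx j).length + 1 = l.length := by
  rw [List.length_eraseIdx_of_lt j.is_lt, Nat.sub_add_cancel (Nat.one_le_of_lt j.is_lt)]

variable (K) in
/-- The alternating sum of the values of `f` on the faces of the ordered simplex `l`. -/
def alternatingSum (f : List E → M) (l : List E) : M :=
  ∑ j : Fin l.length, (-1 : K) ^ (j : ℕ) • f (l.eraseIdx j)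

theorem map_alternatingSum (g : M →ₗ[K] M') (f : List E → M) (l : List E) :
    g (alternatingSum K f l) = alternatingSum K (fun l => g (f l)) l := by
  simp [alternatingSum]

theorem alternatingSum_map (f : List E' → M) (g : E → E') (l : List E) :
    alternatingSum K f (l.map g) = alternatingSum K (fun l => f (l.map g)) l := by
  rw [alternatingSum, alternatingSum, ← (finCongr (List.length_map g).symm).sum_comp]
  simp [List.eraseIdx_map]

theorem alternatingSum_congr {f g : List E → M} {l : List E}
    (h : ∀ l', l'.length < l.length → f l' = g l') :
    alternatingSum K f l = alternatingSum K g l :=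
  Finset.sum_congr rfl fun j _ => by
    rw [h _ (by have := length_eraseIdx_add_one l j; omega)]

theorem alternatingSum_cons (f : List E → M) (x : E) (l : List E) :
    alternatingSum K f (x :: l) = f l - alternatingSum K (fun l => f (x :: l)) l := by
  simp [alternatingSum, Fin.sum_univ_succ, pow_succ, sub_eq_add_neg]

theorem alternatingSum_sub (f g : List E → M) (l : List E) :
    alternatingSum K (fun l => f l - g l) l = alternatingSum K f l - alternatingSum K g l := by
  simp only [alternatingSum, smul_sub, Finset.sum_sub_distrib]

theorem alternatingSum_mem {f : List E → M} {l : List E} {P : Submodule K M}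
    (h : ∀ l', l'.length + 1 = l.length → l' ⊆ l → f l' ∈ P) : alternatingSum K f l ∈ P :=
  P.sum_mem fun j _ =>
    P.smul_mem _ (h _ (length_eraseIdx_add_one l j) List.eraseIdx_subset)

/-- The simplicial boundary of ordered chains; a vertex is sent to the empty sequence. -/
noncomputable def boundary : OrderedChain K E →ₗ[K] OrderedChain K E :=
  Finsupp.linearCombination K (alternatingSum K fun l => Finsupp.single l 1)

theorem boundary_single (l : List E) :
    boundary (Finsupp.single l (1 : K)) = alternatingSum K (fun l => Finsupp.single l 1) l := by
  simp [boundary]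

theorem boundary_single_nil : boundary (Finsupp.single ([] : List E) (1 : K)) = 0 := by
  simp [boundary_single, alternatingSum]

theorem linearCombination_boundary_single (f : List E → M) (l : List E) :
    Finsupp.linearCombination K f (boundary (Finsupp.single l 1)) = alternatingSum K f l := by
  simp [boundary_single, map_alternatingSum]

theorem boundary_single_cons (x : E) (l : List E) : boundary (Finsupp.single (x :: l) (1 : K)) =
    Finsupp.single l 1 - cone x (boundary (Finsupp.single l 1)) := by
  simp only [boundary_single, alternatingSum_cons, map_alternatingSum, cone_single]

theorem boundary_cone (x : E) (y : OrderedChain K E) :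
    boundary (cone x y) = y - cone x (boundary y) := by
  have : boundary.comp (cone x) = LinearMap.id - (cone (K := K) x).comp boundary := by
    refine Finsupp.lhom_ext' fun l => LinearMap.ext_ring ?_
    simp [cone_single, boundary_single_cons]
  exact LinearMap.congr_fun this y

theorem boundary_boundary_single (l : List E) :
    boundary (boundary (Finsupp.single l (1 : K))) = 0 := by
  induction l with
  | nil => rw [boundary_single_nil, map_zero]
  | cons x l ih => simp [boundary_single_cons, boundary_cone, ih]

theorem alternatingSum_boundary (l : List E) :
    alternatingSum K (fun l => boundary (Finsupp.single l (1 : K))) l = 0 := by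
  rw [← map_alternatingSum, ← boundary_single, boundary_boundary_single]

end Boundary

section Subdivision

variable (bary : List E → E)

/-- The subdivision of an ordered simplex: the cone, from the point `bary l` chosen as its
barycenter, on the subdivision of its boundary. -/
noncomputable def subdivide (l : List E) : OrderedChain K E :=
  if l = [] then Finsupp.single [] 1 else
    cone (bary l) (∑ j : Fin l.length, (-1 : K) ^ (j : ℕ) • subdivide (l.eraseIdx j))
termination_by l.length
decreasing_by exact (length_eraseIdx_add_one l j).le

theorem subdivide_nil : subdivide (K := K) bary [] = Finsupp.single [] 1 := by
  rw [subdivide, if_pos rfl]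

theorem subdivide_of_ne_nil {l : List E} (h : l ≠ []) :
    subdivide (K := K) bary l = cone (bary l) (alternatingSum K (subdivide bary) l) := by
  rw [subdivide, if_neg h, alternatingSum]

/-- The linear extension of `OrderedChain.subdivide`. -/
noncomputable def subdivision : OrderedChain K E →ₗ[K] OrderedChain K E :=
  Finsupp.linearCombination K (subdivide bary)

theorem subdivision_single (l : List E) :
    subdivision bary (Finsupp.single l (1 : K)) = subdivide bary l := by
  simp [subdivision]

theorem boundary_subdivide (l : List E) : boundary (subdivide (K := K) bary l) =
    subdivision bary (boundary (Finsupp.single l 1)) := by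
  induction hn : l.length using Nat.strong_induction_on generalizing l with
  | _ n ih =>
  obtain rfl | h := eq_or_ne l []
  · rw [subdivide_nil, boundary_single_nil, map_zero]
  · rw [subdivide_of_ne_nil bary h, boundary_cone, map_alternatingSum,
      alternatingSum_congr fun l' hl' => ih _ (hn ▸ hl') _ rfl, ← map_alternatingSum,
      alternatingSum_boundary, map_zero, map_zero, sub_zero, subdivision,
      linearCombination_boundary_single]

theorem boundary_subdivision (x : OrderedChain K E) :
    boundary (subdivision bary x) = subdivision bary (boundary x) := by
  have : boundary.comp (subdivision (K := K) bary) = (subdivision bary).comp boundary := by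
    refine Finsupp.lhom_ext' fun l => LinearMap.ext_ring ?_
    simp [subdivision_single, boundary_subdivide]
  exact LinearMap.congr_fun this x

theorem boundary_subdivision_pow (k : ℕ) (x : OrderedChain K E) :
    boundary ((subdivision bary ^ k) x) = (subdivision bary ^ k) (boundary x) := by
  induction k generalizing x with
  | zero => rfl
  | succ k ih => rw [pow_succ, Module.End.mul_apply, Module.End.mul_apply, ih, boundary_subdivision]

/-- The value on an ordered simplex of the chain homotopy between the identity and the
subdivision. -/
noncomputable def homotopize (l : List E) : OrderedChain K E :=
  if l = [] then 0 else
    cone (bary l)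
      (Finsupp.single l 1 - ∑ j : Fin l.length, (-1 : K) ^ (j : ℕ) • homotopize (l.eraseIdx j))
termination_by l.length
decreasing_by exact (length_eraseIdx_add_one l j).le

theorem homotopize_nil : homotopize (K := K) bary [] = 0 := by
  rw [homotopize, if_pos rfl]

theorem homotopize_of_ne_nil {l : List E} (h : l ≠ []) : homotopize (K := K) bary l =
    cone (bary l) (Finsupp.single l 1 - alternatingSum K (homotopize bary) l) := by
  rw [homotopize, if_neg h, alternatingSum]

/-- The chain homotopy between the identity and the subdivision. -/
noncomputable def homotopy : OrderedChain K E →ₗ[K] OrderedChain K E :=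
  Finsupp.linearCombination K (homotopize bary)

theorem homotopy_single (l : List E) :
    homotopy bary (Finsupp.single l (1 : K)) = homotopize bary l := by
  simp [homotopy]

theorem boundary_homotopize (l : List E) : boundary (homotopize (K := K) bary l) =
    Finsupp.single l 1 - subdivide bary l - homotopy bary (boundary (Finsupp.single l 1)) := by
  induction hn : l.length using Nat.strong_induction_on generalizing l with
  | _ n ih =>
  obtain rfl | h := eq_or_ne l []
  · simp [subdivide_nil, homotopize_nil, boundary_single_nil]
  · have boundary_faces : alternatingSum K (fun l => boundary (homotopize (K := K) bary l)) l =
        boundary (Finsupp.single l 1) - alternatingSum K (subdivide bary) l := by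
      rw [alternatingSum_congr fun l' hl' => ih _ (hn ▸ hl') _ rfl, alternatingSum_sub,
        alternatingSum_sub, ← map_alternatingSum (K := K) (homotopy bary), alternatingSum_boundary,
        map_zero, sub_zero, boundary_single]
    rw [homotopize_of_ne_nil bary h, boundary_cone, map_sub, map_alternatingSum, boundary_faces,
      sub_sub_cancel, ← subdivide_of_ne_nil bary h, homotopy, linearCombination_boundary_single]
    abel

theorem sub_subdivision (x : OrderedChain K E) : x - subdivision bary x =
    boundary (homotopy bary x) + homotopy bary (boundary x) := by
  have : LinearMap.id - subdivision (K := K) bary =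
      boundary.comp (homotopy bary) + (homotopy bary).comp boundary := by
    refine Finsupp.lhom_ext' fun l => LinearMap.ext_ring ?_
    simp [subdivision_single, homotopy_single, boundary_homotopize]
  exact LinearMap.congr_fun this x

end Subdivision

section Naturality

/-- The map of ordered chains induced by a map of points. -/
noncomputable def push (g : E → E') : OrderedChain K E →ₗ[K] OrderedChain K E' :=
  Finsupp.lmapDomain K K (List.map g)

theorem push_single (g : E → E') (l : List E) (c : K) :
    push g (Finsupp.single l c) = Finsupp.single (l.map g) c :=
  Finsupp.mapDomain_single

theorem push_cone (g : E → E') (b : E) (x : OrderedChain K E) :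
    push g (cone b x) = cone (g b) (push g x) := by
  have : (push (K := K) g).comp (cone b) = (cone (g b)).comp (push g) := by
    refine Finsupp.lhom_ext' fun l => LinearMap.ext_ring ?_
    simp [push_single, cone_single]
  exact LinearMap.congr_fun this x

variable {bary : List E → E} {bary' : List E' → E'} {g : E → E'}
  (hg : ∀ l, l ≠ [] → g (bary l) = bary' (l.map g))

include hg

theorem push_subdivide (l : List E) :
    push g (subdivide (K := K) bary l) = subdivide bary' (l.map g) := by
  induction hn : l.length using Nat.strong_induction_on generalizing l with
  | _ n ih =>
  obtain rfl | h := eq_or_ne l []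
  · simp [subdivide_nil, push_single]
  · rw [subdivide_of_ne_nil bary h, subdivide_of_ne_nil bary' (by simpa using h), push_cone,
      hg l h, map_alternatingSum, alternatingSum_map,
      alternatingSum_congr fun l' hl' => ih _ (hn ▸ hl') _ rfl]

theorem push_homotopize (l : List E) :
    push g (homotopize (K := K) bary l) = homotopize bary' (l.map g) := by
  induction hn : l.length using Nat.strong_induction_on generalizing l with
  | _ n ih =>
  obtain rfl | h := eq_or_ne l []
  · simp [homotopize_nil]
  · rw [homotopize_of_ne_nil bary h, homotopize_of_ne_nil bary' (by simpa using h), push_cone,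
      hg l h, map_sub, map_alternatingSum, alternatingSum_map,
      alternatingSum_congr fun l' hl' => ih _ (hn ▸ hl') _ rfl, push_single]

theorem push_subdivision (x : OrderedChain K E) :
    push g (subdivision bary x) = subdivision bary' (push g x) := by
  have : (push (K := K) g).comp (subdivision bary) = (subdivision bary').comp (push g) := by
    refine Finsupp.lhom_ext' fun l => LinearMap.ext_ring ?_
    simp [push_single, subdivision_single, push_subdivide hg]
  exact LinearMap.congr_fun this x

theorem push_homotopy (x : OrderedChain K E) :
    push g (homotopy bary x) = homotopy bary' (push g x) := by
  have : (push (K := K) g).comp (homotopy bary) = (homotopy bary').comp (push g) := by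
    refine Finsupp.lhom_ext' fun l => LinearMap.ext_ring ?_
    simp [push_single, homotopy_single, push_homotopize hg]
  exact LinearMap.congr_fun this x

theorem push_subdivision_pow (k : ℕ) (x : OrderedChain K E) :
    push g ((subdivision bary ^ k) x) = (subdivision bary' ^ k) (push g x) := by
  induction k generalizing x with
  | zero => rfl
  | succ k ih => rw [pow_succ, pow_succ, Module.End.mul_apply, Module.End.mul_apply, ih,
      push_subdivision hg]

end Naturality

section Support

theorem cone_mem_supported {b : E} {s t : Set (List E)} (h : ∀ l ∈ s, b :: l ∈ t)
    {x : OrderedChain K E} (hx : x ∈ Finsupp.supported K K s) :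
    cone b x ∈ Finsupp.supported K K t := by
  have := Finsupp.lmapDomain_supported (M := K) K (List.cons b) s
  refine Finsupp.supported_mono ?_ (this.le (Submodule.mem_map_of_mem hx))
  rintro _ ⟨l, hl, rfl⟩
  exact h l hl

theorem linearCombination_mem_supported {f : List E → OrderedChain K E} {s t : Set (List E)}
    (h : ∀ l ∈ s, f l ∈ Finsupp.supported K K t) {x : OrderedChain K E}
    (hx : x ∈ Finsupp.supported K K s) :
    Finsupp.linearCombination K f x ∈ Finsupp.supported K K t :=
  Submodule.sum_mem _ fun l hl => Submodule.smul_mem _ _ (h l (hx hl))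

theorem subdivide_mem_supported_length (bary : List E → E) (l : List E) :
    subdivide bary l ∈ Finsupp.supported K K {l' | l'.length = l.length} := by
  induction hn : l.length using Nat.strong_induction_on generalizing l with
  | _ n ih =>
  obtain rfl | h := eq_or_ne l []
  · rw [subdivide_nil]
    exact Finsupp.single_mem_supported _ _ hn
  · rw [subdivide_of_ne_nil bary h]
    refine cone_mem_supported (s := {l' | l'.length + 1 = n}) (fun l' hl' => by simpa using hl')
      (alternatingSum_mem fun l' hl' _ => ?_)
    obtain rfl : l'.length + 1 = n := hl'.trans hn
    refine Finsupp.supported_mono (fun l'' h'' => ?_) (ih _ (Nat.lt_succ_self _) l' rfl)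
    simpa using h''

end Support

section Mesh

variable [PseudoMetricSpace E]

/-- The only property of a choice of barycenters that makes the mesh of iterated subdivisions
tend to zero. -/
def IsAveraging (bary : List E → E) : Prop :=
  ∀ l, l ≠ [] → ∀ q, dist (bary l) q ≤ (l.map (dist · q)).sum / l.length

/-- The ordered simplices of diameter at most `r`. -/
def meshLE (E : Type*) [PseudoMetricSpace E] (r : ℝ) : Set (List E) :=
  {l | ∀ p ∈ l, ∀ q ∈ l, dist p q ≤ r}

theorem cons_mem_meshLE {r : ℝ} {b : E} {l : List E} (hr : 0 ≤ r) (hl : l ∈ meshLE E r)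
    (hb : ∀ p ∈ l, dist p b ≤ r) : b :: l ∈ meshLE E r := by
  intro p hp q hq
  obtain rfl | hpl := List.mem_cons.1 hp <;> obtain rfl | hql := List.mem_cons.1 hq
  · rwa [dist_self]
  · rw [dist_comm]
    exact hb q hql
  · exact hb p hpl
  · exact hl p hpl q hql

variable {bary : List E → E}

theorem IsAveraging.dist_le (hb : IsAveraging bary) {l : List E} (h : l ≠ []) {q : E} {r : ℝ}
    (hr : ∀ p ∈ l, dist p q ≤ r) : dist (bary l) q ≤ r := by
  refine (hb l h q).trans ?_
  rw [div_le_iff₀ (by exact_mod_cast List.length_pos_iff.2 h)]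
  have := List.sum_le_card_nsmul (l.map (dist · q)) r (by simpa using hr)
  simpa [mul_comm] using this

theorem IsAveraging.dist_le_of_mem (hb : IsAveraging bary) {l : List E} {q : E} (hq : q ∈ l)
    {r : ℝ} (hr : ∀ p ∈ l, dist p q ≤ r) :
    dist (bary l) q ≤ (l.length - 1) / l.length * r := by
  refine (hb l (List.ne_nil_of_mem hq) q).trans ?_
  rw [div_mul_eq_mul_div]
  gcongr
  obtain ⟨s, t, rfl⟩ := List.append_of_mem hq
  have sum_le (s' : List E) (hs' : ∀ p ∈ s', p ∈ s ++ q :: t) :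
      (s'.map (dist · q)).sum ≤ s'.length * r := by
    simpa using List.sum_le_card_nsmul (s'.map (dist · q)) r
      (by simpa using fun p hp => hr p (hs' p hp))
  have := sum_le s (by simp +contextual)
  have := sum_le t (by simp +contextual)
  simp only [List.map_append, List.map_cons, dist_self, List.sum_append, List.sum_cons, zero_add,
    List.length_append, List.length_cons, Nat.cast_add, Nat.cast_one]
  linarith

theorem IsAveraging.dist_le_mul (hb : IsAveraging bary) {N : ℕ} {l : List E} {r : ℝ}
    (hN : l.length ≤ N + 1) (hl : l ∈ meshLE E r) {p : E} (hp : p ∈ l) :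
    dist p (bary l) ≤ N / (N + 1) * r := by
  rw [dist_comm]
  refine (hb.dist_le_of_mem hp fun q hq => hl q hq p hp).trans ?_
  refine mul_le_mul_of_nonneg_right ?_ (dist_nonneg.trans (hl p hp p hp))
  have length_pos : (0 : ℝ) < l.length := by exact_mod_cast List.length_pos_of_mem hp
  have length_le : (l.length : ℝ) ≤ N + 1 := by exact_mod_cast hN
  rw [div_le_div_iff₀ length_pos (by positivity)]
  linarith

theorem IsAveraging.subdivide_mem_supported_ball (hb : IsAveraging bary) {q : E} {r : ℝ}
    (l : List E) (hl : ∀ p ∈ l, dist p q ≤ r) :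
    subdivide bary l ∈ Finsupp.supported K K {l' | ∀ p ∈ l', dist p q ≤ r} := by
  induction hn : l.length using Nat.strong_induction_on generalizing l with
  | _ n ih =>
  obtain rfl | h := eq_or_ne l []
  · rw [subdivide_nil]
    exact Finsupp.single_mem_supported _ _ (by simp)
  · rw [subdivide_of_ne_nil bary h]
    refine cone_mem_supported (s := {l' | ∀ p ∈ l', dist p q ≤ r}) (fun l' hl' => ?_)
      (alternatingSum_mem fun l' hl' hsub =>
        ih _ (by omega) l' (fun p hp => hl p (hsub hp)) rfl)
    simpa using And.intro (hb.dist_le h hl) hl'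

theorem IsAveraging.subdivide_mem_supported_mesh (hb : IsAveraging bary) {N : ℕ} {r : ℝ}
    (hr : 0 ≤ r) (l : List E) (hN : l.length ≤ N + 1) (hl : l ∈ meshLE E r) :
    subdivide bary l ∈ Finsupp.supported K K (meshLE E (N / (N + 1) * r)) := by
  induction hn : l.length using Nat.strong_induction_on generalizing l with
  | _ n ih =>
  obtain rfl | h := eq_or_ne l []
  · rw [subdivide_nil]
    exact Finsupp.single_mem_supported _ _ (by simp [meshLE])
  · rw [subdivide_of_ne_nil bary h]
    refine cone_mem_supported
      (s := {l' | ∀ p ∈ l', dist p (bary l) ≤ N / (N + 1) * r} ∩ meshLE E (N / (N + 1) * r))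
      (fun l' hl' => cons_mem_meshLE (by positivity) hl'.2 hl'.1)
      (alternatingSum_mem fun l' hl' hsub => ?_)
    rw [Finsupp.supported_inter]
    exact ⟨hb.subdivide_mem_supported_ball l' fun p hp => hb.dist_le_mul hN hl (hsub hp),
      ih _ (by omega) l' (by omega) (fun p hp q hq => hl p (hsub hp) q (hsub hq)) rfl⟩

theorem IsAveraging.subdivision_pow_mem_supported (hb : IsAveraging bary) {N : ℕ} {r : ℝ}
    (hr : 0 ≤ r) {l : List E} (hN : l.length ≤ N + 1) (hl : l ∈ meshLE E r) (k : ℕ) :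
    (subdivision bary ^ k) (Finsupp.single l 1) ∈ Finsupp.supported K K
      ({l' | l'.length = l.length} ∩ meshLE E ((N / (N + 1) : ℝ) ^ k * r)) := by
  induction k with
  | zero => exact Finsupp.single_mem_supported _ _ ⟨rfl, by simpa using hl⟩
  | succ k ih =>
    rw [pow_succ' (subdivision bary), Module.End.mul_apply]
    refine linearCombination_mem_supported (fun l' hl' => ?_) ih
    obtain ⟨length_eq, mesh_le⟩ := hl'
    rw [Finsupp.supported_inter, pow_succ', mul_assoc, ← show _ = _ from length_eq]
    exact ⟨subdivide_mem_supported_length bary l', hb.subdivide_mem_supported_mesh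
      (by positivity) l' (length_eq.trans_le hN) mesh_le⟩

end Mesh

end OrderedChain

/-! ### Affine simplices -/

section ConvexCombination

variable {ι ι' κ κ' : Type*} [Fintype ι] [Fintype ι'] [Fintype κ] [Fintype κ']

/-- The convex combination, with weights `w`, of points of a standard simplex. -/
noncomputable def convexComb (w : stdSimplex ℝ ι) (p : ι → stdSimplex ℝ κ) : stdSimplex ℝ κ :=
  ⟨∑ i, w i • (p i : κ → ℝ), (convex_stdSimplex ℝ κ).sum_mem (fun i _ => w.2.1 i) w.2.2
    fun i _ => (p i).2⟩

theorem coe_convexComb (w : stdSimplex ℝ ι) (p : ι → stdSimplex ℝ κ) :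
    (convexComb w p : κ → ℝ) = ∑ i, w i • (p i : κ → ℝ) := rfl

theorem dist_convexComb_le (w : stdSimplex ℝ ι) (p : ι → stdSimplex ℝ κ) (q : stdSimplex ℝ κ) :
    dist (convexComb w p) q ≤ ∑ i, w i * dist (p i) q := by
  have sub_eq_sum : (convexComb w p : κ → ℝ) - q = ∑ i, w i • ((p i : κ → ℝ) - q) := by
    simp only [smul_sub, Finset.sum_sub_distrib, ← Finset.sum_smul]
    rw [stdSimplex.sum_eq_one, one_smul, coe_convexComb]
  calc dist (convexComb w p) q = ‖(convexComb w p : κ → ℝ) - q‖ :=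
      dist_eq_norm (convexComb w p : κ → ℝ) q
    _ ≤ ∑ i, ‖w i • ((p i : κ → ℝ) - q)‖ := sub_eq_sum ▸ norm_sum_le _ _
    _ = ∑ i, w i * dist (p i) q := Finset.sum_congr rfl fun i _ => by
      rw [norm_smul, Real.norm_of_nonneg (stdSimplex.zero_le w i), Subtype.dist_eq, dist_eq_norm]
      rfl

theorem dist_convexComb_le_of_forall (w : stdSimplex ℝ ι) {p : ι → stdSimplex ℝ κ}
    {q : stdSimplex ℝ κ} {r : ℝ} (hr : ∀ i, dist (p i) q ≤ r) : dist (convexComb w p) q ≤ r :=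
  calc dist (convexComb w p) q ≤ ∑ i, w i * dist (p i) q := dist_convexComb_le w p q
    _ ≤ ∑ i, w i * r :=
      Finset.sum_le_sum fun i _ => mul_le_mul_of_nonneg_left (hr i) (stdSimplex.zero_le w i)
    _ = r := by rw [← Finset.sum_mul, stdSimplex.sum_eq_one, one_mul]

theorem map_convexComb (f : κ → κ') (w : stdSimplex ℝ ι) (p : ι → stdSimplex ℝ κ) :
    stdSimplex.map f (convexComb w p) = convexComb w fun i => stdSimplex.map f (p i) := by
  refine stdSimplex.ext ?_
  simp only [stdSimplex.map_coe, coe_convexComb, map_sum, map_smul]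

theorem convexComb_map (f : ι → ι') (w : stdSimplex ℝ ι) (p : ι' → stdSimplex ℝ κ) :
    convexComb (stdSimplex.map f w) p = convexComb w fun i => p (f i) := by
  classical
  refine stdSimplex.ext ?_
  simp only [coe_convexComb, stdSimplex.map_coe, FunOnFinite.linearMap_apply_apply,
    Finset.sum_smul]
  rw [← Finset.sum_fiberwise Finset.univ f]
  refine Finset.sum_congr rfl fun j _ => Finset.sum_congr rfl fun i hi => ?_
  rw [(Finset.mem_filter.1 hi).2]

theorem convexComb_vertex [DecidableEq ι] (w : stdSimplex ℝ ι) :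
    convexComb w stdSimplex.vertex = w := by
  refine stdSimplex.ext ?_
  change ∑ i, w i • (Pi.single i 1 : ι → ℝ) = _
  funext j
  simp [Finset.sum_apply, Pi.single_apply]

theorem continuous_convexComb (p : ι → stdSimplex ℝ κ) :
    Continuous fun w : stdSimplex ℝ ι => convexComb w p :=
  (continuous_finsetSum _ fun i _ =>
    ((continuous_apply i).comp continuous_subtype_val).smul continuous_const).subtype_mk _

end ConvexCombination

/-- The standard topological `n`-simplex. -/
abbrev TopSimplex (n : ℕ) : Type := stdSimplex ℝ (Fin (n + 1))

namespace TopSimplex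

variable {m n : ℕ}

theorem barycenter_weight [Nonempty (Fin n)] (i : Fin n) :
    (stdSimplex.barycenter : stdSimplex ℝ (Fin n)) i = (n : ℝ)⁻¹ :=
  (stdSimplex.barycenter_apply i).trans (by rw [Fintype.card_fin])

/-- The barycenter of the points of a list; the value on the empty list is irrelevant. -/
noncomputable def barycenter (l : List (TopSimplex m)) : TopSimplex m :=
  if h : l = [] then stdSimplex.vertex 0 else
    haveI : Nonempty (Fin l.length) := ⟨⟨0, List.length_pos_iff.2 h⟩⟩
    convexComb stdSimplex.barycenter fun i : Fin l.length => l[i]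

theorem coe_barycenter {l : List (TopSimplex m)} (h : l ≠ []) :
    (barycenter l : Fin (m + 1) → ℝ) =
      (l.length : ℝ)⁻¹ • (l.map fun p : TopSimplex m => ⇑p).sum := by
  have : Nonempty (Fin l.length) := ⟨⟨0, List.length_pos_iff.2 h⟩⟩
  rw [barycenter, dif_neg h, coe_convexComb, ← Fin.sum_univ_fun_getElem, Finset.smul_sum]
  refine Finset.sum_congr rfl fun i _ => ?_
  rw [barycenter_weight]
  rfl

theorem isAveraging_barycenter : OrderedChain.IsAveraging (barycenter (m := m)) := by
  intro l h q
  have : Nonempty (Fin l.length) := ⟨⟨0, List.length_pos_iff.2 h⟩⟩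
  rw [barycenter, dif_neg h]
  refine (dist_convexComb_le _ _ _).trans (le_of_eq ?_)
  rw [← Fin.sum_univ_fun_getElem, div_eq_inv_mul, Finset.mul_sum]
  refine Finset.sum_congr rfl fun i _ => ?_
  rw [barycenter_weight]
  rfl

theorem map_barycenter (f : Fin (m + 1) → Fin (n + 1)) (l : List (TopSimplex m)) (h : l ≠ []) :
    stdSimplex.map f (barycenter l) = barycenter (l.map (stdSimplex.map f)) := by
  refine stdSimplex.ext ?_
  rw [stdSimplex.map_coe, coe_barycenter h, coe_barycenter (by simpa using h), map_smul,
    map_list_sum, List.map_map, List.map_map, List.length_map]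
  rfl

/-- The affine map from the standard `n`-simplex whose vertices are the first `n + 1` entries of
`l`; it is only used for lists of length `n + 1`. -/
noncomputable def affineMap (n : ℕ) (l : List (TopSimplex m)) : C(TopSimplex n, TopSimplex m) :=
  ⟨fun t => convexComb t fun i => l.getD i (stdSimplex.vertex 0), continuous_convexComb _⟩

theorem affineMap_apply (l : List (TopSimplex m)) (t : TopSimplex n) :
    affineMap n l t = convexComb t fun i => l.getD i (stdSimplex.vertex 0) := rfl

theorem affineMap_eq_convexComb_getElem {l : List (TopSimplex m)} (hl : l.length = n + 1)
    (t : TopSimplex n) :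
    affineMap n l t = convexComb t fun i => l[(i : ℕ)]'(by rw [hl]; exact i.is_lt) := by
  rw [affineMap_apply]
  congr 1
  funext i
  exact List.getD_eq_getElem _ _ _

theorem affineMap_face (l : List (TopSimplex m)) (j : Fin (n + 2)) (t : TopSimplex n) :
    affineMap (n + 1) l (stdSimplex.map j.succAbove t) = affineMap n (l.eraseIdx j) t := by
  rw [affineMap_apply, affineMap_apply, convexComb_map]
  congr 1
  funext i
  rw [List.getD_eq_getElem?_getD, List.getD_eq_getElem?_getD, List.getElem?_eraseIdx,
    show ((j.succAbove i : Fin (n + 2)) : ℕ) = if (i : ℕ) < j then ↑i else ↑i + 1 from δ_val j i]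
  split_ifs <;> rfl

theorem map_affineMap {m' : ℕ} (f : Fin (m + 1) → Fin (m' + 1)) {l : List (TopSimplex m)}
    (hl : l.length = n + 1) (t : TopSimplex n) :
    stdSimplex.map f (affineMap n l t) = affineMap n (l.map (stdSimplex.map f)) t := by
  rw [affineMap_eq_convexComb_getElem hl,
    affineMap_eq_convexComb_getElem ((List.length_map _).trans hl), map_convexComb]
  simp only [List.getElem_map]

/-- The list of the vertices of the standard `m`-simplex, that is, its fundamental chain. -/
noncomputable def vertices (m : ℕ) : List (TopSimplex m) := List.ofFn stdSimplex.vertex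

theorem length_vertices (m : ℕ) : (vertices m).length = m + 1 := List.length_ofFn

theorem affineMap_vertices (t : TopSimplex m) : affineMap m (vertices m) t = t := by
  rw [affineMap_eq_convexComb_getElem (length_vertices m)]
  simp only [vertices, List.getElem_ofFn]
  exact convexComb_vertex t

theorem vertices_eraseIdx (m : ℕ) (j : Fin (m + 2)) :
    (vertices (m + 1)).eraseIdx j = (vertices m).map (stdSimplex.map j.succAbove) := by
  have length_eq : ((vertices (m + 1)).eraseIdx j).length = m + 1 := by
    rw [List.length_eraseIdx_of_lt (by rw [length_vertices]; exact j.is_lt), length_vertices]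
    rfl
  refine List.ext_getElem (by rw [length_eq, List.length_map, length_vertices]) fun i hi _ => ?_
  rw [length_eq] at hi
  have succAbove_val : ((j.succAbove ⟨i, hi⟩ : Fin (m + 2)) : ℕ) = if i < j then i else i + 1 :=
    δ_val j ⟨i, hi⟩
  rw [List.getElem_eraseIdx, List.getElem_map]
  simp only [vertices, List.getElem_ofFn, stdSimplex.map_vertex]
  split_ifs with h <;> congr 1 <;> ext <;> simp [succAbove_val, h]

end TopSimplex

/-! ### Small simplices -/

open Simplicial

theorem exists_linearMap_comp_eq {K V W : Type*} [Field K] [AddCommGroup V] [Module K V]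
    [AddCommGroup W] [Module K W] (L : V →ₗ[K] W) (S : Submodule K W) (f : V →ₗ[K] K)
    (hf : ∀ x, L x ∈ S → f x = 0) : ∃ g : W →ₗ[K] K, (∀ y ∈ S, g y = 0) ∧ g ∘ₗ L = f := by
  have mem_range : f ∈ LinearMap.range (S.mkQ ∘ₗ L).dualMap := by
    rw [LinearMap.range_dualMap_eq_dualAnnihilator_ker, Submodule.mem_dualAnnihilator]
    exact fun x hx => hf x ((Submodule.Quotient.mk_eq_zero S).1 hx)
  obtain ⟨g, rfl⟩ := mem_range
  refine ⟨g ∘ₗ S.mkQ, fun y hy => ?_, rfl⟩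
  rw [LinearMap.comp_apply, Submodule.mkQ_apply, (Submodule.Quotient.mk_eq_zero S).2 hy, map_zero]

/-- The singular simplicial set of a space. -/
noncomputable abbrev Sing (X : Type u) [TopologicalSpace X] : SSet.{u} :=
  TopCat.toSSet.obj (TopCat.of X)

section Coboundary

variable {K : Type v} [Field K] {S : SSet.{u}} {n : ℕ}

/-- The differential on cochains of degree `n` of a simplicial set. -/
def coboundary (φ : S _⦋n⦌ → K) (σ : S _⦋n + 1⦌) : K :=
  ∑ j : Fin (n + 2), (-1 : K) ^ (j : ℕ) * φ (S.δ j σ)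

variable (K S n) in
/-- The boundary of the chains of a simplicial set, the transpose of the coboundary. -/
noncomputable def chainBoundary : ((S _⦋n + 1⦌) →₀ K) →ₗ[K] ((S _⦋n⦌) →₀ K) :=
  Finsupp.linearCombination K fun σ =>
    ∑ j : Fin (n + 2), (-1 : K) ^ (j : ℕ) • Finsupp.single (S.δ j σ) 1

theorem linearCombination_coboundary (ψ : S _⦋n⦌ → K) (x : (S _⦋n + 1⦌) →₀ K) :
    Finsupp.linearCombination K (coboundary ψ) x =
      Finsupp.linearCombination K ψ (chainBoundary K S n x) := by
  have : Finsupp.linearCombination K (coboundary ψ) =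
      (Finsupp.linearCombination K ψ).comp (chainBoundary K S n) := by
    refine Finsupp.lhom_ext' fun σ => LinearMap.ext_ring ?_
    simp [chainBoundary, coboundary]
  exact LinearMap.congr_fun this x

end Coboundary

namespace Sing

variable {K : Type v} [Field K] {X : Type u} [TopologicalSpace X] {m n : ℕ}

section Simplex

/-- The continuous map underlying a singular simplex. -/
noncomputable def toMap (σ : Sing X _⦋n⦌) : C(TopSimplex n, X) :=
  TopCat.toSSetObjEquiv (TopCat.of X) (Opposite.op ⦋n⦌) σ

/-- The singular simplex given by a continuous map. -/
noncomputable def ofMap (f : C(TopSimplex n, X)) : Sing X _⦋n⦌ :=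
  (TopCat.toSSetObjEquiv (TopCat.of X) (Opposite.op ⦋n⦌)).symm f

theorem toMap_ofMap (f : C(TopSimplex n, X)) : toMap (ofMap f) = f :=
  Equiv.apply_symm_apply _ _

theorem toMap_δ (σ : Sing X _⦋n + 1⦌) (j : Fin (n + 2)) (z : TopSimplex n) :
    toMap ((Sing X).δ j σ) z = toMap σ (stdSimplex.map j.succAbove z) := rfl

theorem ext_toMap {σ τ : Sing X _⦋n⦌} (h : ∀ z, toMap σ z = toMap τ z) : σ = τ :=
  (TopCat.toSSetObjEquiv (TopCat.of X) (Opposite.op ⦋n⦌)).injective (ContinuousMap.ext h)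

/-- The image of the singular simplex `σ` is contained in `U`. -/
def Inside (U : Set X) (σ : Sing X _⦋n⦌) : Prop := ∀ z, toMap σ z ∈ U

theorem Inside.δ {U : Set X} {σ : Sing X _⦋n + 1⦌} (h : Inside U σ) (j : Fin (n + 2)) :
    Inside U ((Sing X).δ j σ) := fun _ => h _

theorem Inside.intervalFace {U : Set X} {σ : Sing X _⦋n⦌} (h : Inside U σ) (a k : ℕ) :
    Inside U (intervalFace σ a k) := fun _ => h _

end Simplex

section EvalAffine

/-- The value of a cochain of degree `n` on the image under `f` of a chain of ordered affine
simplices; those of dimension other than `n` contribute zero. -/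
noncomputable def evalAffine (φ : Sing X _⦋n⦌ → K) (f : C(TopSimplex m, X)) :
    OrderedChain K (TopSimplex m) →ₗ[K] K :=
  Finsupp.linearCombination K fun l =>
    if l.length = n + 1 then φ (ofMap (f.comp (TopSimplex.affineMap n l))) else 0

theorem evalAffine_single (φ : Sing X _⦋n⦌ → K) (f : C(TopSimplex m, X))
    (l : List (TopSimplex m)) : evalAffine φ f (Finsupp.single l 1) =
      if l.length = n + 1 then φ (ofMap (f.comp (TopSimplex.affineMap n l))) else 0 := by
  simp [evalAffine]

theorem evalAffine_eq_zero {φ : Sing X _⦋n⦌ → K} {f : C(TopSimplex m, X)}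
    {s : Set (List (TopSimplex m))} {x : OrderedChain K (TopSimplex m)}
    (hx : x ∈ Finsupp.supported K K s)
    (h : ∀ l ∈ s, l.length = n + 1 → φ (ofMap (f.comp (TopSimplex.affineMap n l))) = 0) :
    evalAffine φ f x = 0 := by
  rw [evalAffine, Finsupp.linearCombination_apply]
  refine Finset.sum_eq_zero fun l hl => ?_
  dsimp only
  split_ifs with hl'
  · rw [h l (hx hl) hl', smul_zero]
  · rw [smul_zero]

theorem δ_ofMap_affineMap (f : C(TopSimplex m, X)) (l : List (TopSimplex m)) (j : Fin (n + 2)) :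
    (Sing X).δ j (ofMap (f.comp (TopSimplex.affineMap (n + 1) l))) =
      ofMap (f.comp (TopSimplex.affineMap n (l.eraseIdx j))) := by
  refine ext_toMap fun z => ?_
  rw [toMap_δ, toMap_ofMap, toMap_ofMap, ContinuousMap.comp_apply, ContinuousMap.comp_apply,
    TopSimplex.affineMap_face]

theorem evalAffine_boundary (φ : Sing X _⦋n⦌ → K) (f : C(TopSimplex m, X))
    (x : OrderedChain K (TopSimplex m)) :
    evalAffine φ f (OrderedChain.boundary x) = evalAffine (coboundary φ) f x := by
  have : (evalAffine φ f).comp OrderedChain.boundary = evalAffine (coboundary φ) f := by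
    refine Finsupp.lhom_ext' fun l => LinearMap.ext_ring ?_
    simp only [LinearMap.comp_apply, Finsupp.lsingle_apply, OrderedChain.boundary_single,
      OrderedChain.map_alternatingSum, evalAffine_single]
    simp only [OrderedChain.alternatingSum]
    have length_face (j : Fin l.length) := OrderedChain.length_eraseIdx_add_one l j
    split_ifs with hl
    · rw [coboundary, ← (finCongr hl).sum_comp]
      refine Finset.sum_congr rfl fun j _ => ?_
      rw [if_pos (by have := length_face j; omega), δ_ofMap_affineMap]
      rfl
    · refine Finset.sum_eq_zero fun j _ => ?_
      rw [if_neg (by have := length_face j; omega), smul_zero]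
  exact LinearMap.congr_fun this x

theorem evalAffine_push {m' : ℕ} (φ : Sing X _⦋n⦌ → K) (f : C(TopSimplex m', X))
    (g : Fin (m + 1) → Fin (m' + 1)) (x : OrderedChain K (TopSimplex m)) :
    evalAffine φ f (OrderedChain.push (stdSimplex.map g) x) =
      evalAffine φ (f.comp ⟨stdSimplex.map g, stdSimplex.continuous_map g⟩) x := by
  have : (evalAffine φ f).comp (OrderedChain.push (stdSimplex.map g)) =
      evalAffine φ (f.comp ⟨stdSimplex.map g, stdSimplex.continuous_map g⟩) := by
    refine Finsupp.lhom_ext' fun l => LinearMap.ext_ring ?_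
    simp only [LinearMap.comp_apply, Finsupp.lsingle_apply, OrderedChain.push_single,
      evalAffine_single, List.length_map]
    split_ifs with hl
    · congr 2
      ext z
      simp [TopSimplex.map_affineMap g hl]
    · rfl
  exact LinearMap.congr_fun this x

end EvalAffine

section Subdivision

variable (K n) in
/-- The `k`-fold barycentric subdivision of the fundamental chain of the standard `n`-simplex. -/
noncomputable def subdividedSimplex (k : ℕ) : OrderedChain K (TopSimplex n) :=
  (OrderedChain.subdivision TopSimplex.barycenter ^ k) (Finsupp.single (TopSimplex.vertices n) 1)

/-- The composite of the cochain `φ` with the `k`-fold barycentric subdivision of chains. -/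
noncomputable def subdivide (k : ℕ) (φ : Sing X _⦋n⦌ → K) (σ : Sing X _⦋n⦌) : K :=
  evalAffine φ (toMap σ) (subdividedSimplex K n k)

theorem subdivide_zero (φ : Sing X _⦋n⦌ → K) : subdivide 0 φ = φ := by
  funext σ
  rw [subdivide, subdividedSimplex, pow_zero, Module.End.one_apply, evalAffine_single,
    if_pos (TopSimplex.length_vertices n)]
  congr 1
  refine ext_toMap fun z => ?_
  rw [toMap_ofMap, ContinuousMap.comp_apply, TopSimplex.affineMap_vertices]

/-- A cochain whose coboundary is the difference of two consecutive subdivisions of a cocycle. -/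
noncomputable def subdivisionHomotopy (k : ℕ) (φ : Sing X _⦋n + 1⦌ → K) (τ : Sing X _⦋n⦌) : K :=
  evalAffine φ (toMap τ)
    (OrderedChain.homotopy TopSimplex.barycenter (subdividedSimplex K n k))

theorem boundary_vertices (n : ℕ) :
    OrderedChain.boundary (Finsupp.single (TopSimplex.vertices (n + 1)) (1 : K)) =
      ∑ j : Fin (n + 2), (-1 : K) ^ (j : ℕ) • OrderedChain.push (stdSimplex.map j.succAbove)
        (Finsupp.single (TopSimplex.vertices n) 1) := by
  rw [OrderedChain.boundary_single, OrderedChain.alternatingSum,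
    ← (finCongr (TopSimplex.length_vertices (n + 1)).symm).sum_comp]
  refine Finset.sum_congr rfl fun j _ => ?_
  rw [OrderedChain.push_single, ← TopSimplex.vertices_eraseIdx]
  rfl

theorem boundary_subdividedSimplex (n k : ℕ) :
    OrderedChain.boundary (subdividedSimplex K (n + 1) k) =
      ∑ j : Fin (n + 2), (-1 : K) ^ (j : ℕ) • OrderedChain.push (stdSimplex.map j.succAbove)
        (subdividedSimplex K n k) := by
  simp only [subdividedSimplex, OrderedChain.boundary_subdivision_pow, boundary_vertices, map_sum,
    map_smul, OrderedChain.push_subdivision_pow (TopSimplex.map_barycenter _)]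

theorem subdivide_eq_subdivide_succ_add {φ : Sing X _⦋n + 1⦌ → K} (hφ : coboundary φ = 0)
    (k : ℕ) : subdivide k φ = subdivide (k + 1) φ + coboundary (subdivisionHomotopy k φ) := by
  funext σ
  have subdividedSimplex_succ : subdividedSimplex K (n + 1) (k + 1) =
      OrderedChain.subdivision TopSimplex.barycenter (subdividedSimplex K (n + 1) k) := by
    rw [subdividedSimplex, pow_succ', Module.End.mul_apply, subdividedSimplex]
  have evalAffine_coboundary (x) : evalAffine (coboundary φ) (toMap σ) x = 0 :=
    evalAffine_eq_zero (s := Set.univ) (by simp) fun l _ _ => congrFun hφ _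
  rw [Pi.add_apply, ← sub_eq_iff_eq_add', subdivide, subdivide, subdividedSimplex_succ, ← map_sub,
    OrderedChain.sub_subdivision, map_add, evalAffine_boundary, evalAffine_coboundary, zero_add,
    boundary_subdividedSimplex, map_sum, map_sum]
  refine Finset.sum_congr rfl fun j _ => ?_
  rw [map_smul, map_smul, ← OrderedChain.push_homotopy (TopSimplex.map_barycenter _),
    evalAffine_push, smul_eq_mul]
  rfl

theorem subdivisionHomotopy_eq_zero {U : Set X} {φ : Sing X _⦋n + 1⦌ → K}
    (hφ : ∀ σ, Inside U σ → φ σ = 0) (k : ℕ) {τ : Sing X _⦋n⦌} (hτ : Inside U τ) :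
    subdivisionHomotopy k φ τ = 0 :=
  evalAffine_eq_zero (s := Set.univ) (by simp) fun l _ _ => hφ _ fun z => by
    rw [toMap_ofMap]
    exact hτ _

theorem eventually_subdividedSimplex_mem_supported (n : ℕ) {δ : ℝ} (hδ : 0 < δ) :
    ∃ k₀, ∀ k ≥ k₀, subdividedSimplex K n k ∈
      Finsupp.supported K K {l | ∀ p ∈ l, ∀ q ∈ l, dist p q < δ} := by
  let r := Metric.diam (Set.univ : Set (TopSimplex n))
  have mesh : TopSimplex.vertices n ∈ OrderedChain.meshLE (TopSimplex n) r := fun p _ q _ =>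
    Metric.dist_le_diam_of_mem isCompact_univ.isBounded trivial trivial
  have ratio_lt_one : (n / (n + 1) : ℝ) < 1 := by
    rw [div_lt_one (by positivity)]
    linarith
  have tendsto_zero :
      Filter.Tendsto (fun k => (n / (n + 1) : ℝ) ^ k * r) Filter.atTop (nhds 0) := by
    simpa using (tendsto_pow_atTop_nhds_zero_of_lt_one (by positivity) ratio_lt_one).mul_const r
  obtain ⟨k₀, hk₀⟩ := Filter.eventually_atTop.1 (tendsto_zero.eventually_lt_const hδ)
  refine ⟨k₀, fun k hk => Finsupp.supported_mono ?_
    (TopSimplex.isAveraging_barycenter.subdivision_pow_mem_supported Metric.diam_nonneg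
      (TopSimplex.length_vertices n).le mesh k)⟩
  exact fun l hl p hp q hq => (hl.2 p hp q hq).trans_lt (hk₀ k hk)

end Subdivision

section Acyclicity

variable {𝒰 : Set (Set X)} (isOpen : ∀ U ∈ 𝒰, IsOpen U) (cover : ⋃₀ 𝒰 = Set.univ)

include isOpen cover

theorem exists_inside_of_dist_lt (f : C(TopSimplex m, X)) :
    ∃ δ > 0, ∀ l : List (TopSimplex m), l.length = n + 1 →
      (∀ p ∈ l, ∀ q ∈ l, dist p q < δ) →
      ∃ U ∈ 𝒰, Inside U (ofMap (f.comp (TopSimplex.affineMap n l))) := by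
  obtain ⟨δ, hδ, hball⟩ := lebesgue_number_lemma_of_metric (isCompact_univ (X := TopSimplex m))
    (c := fun U : 𝒰 => f ⁻¹' U) (fun U => (isOpen U U.2).preimage f.continuous) (fun z _ => by
      obtain ⟨U, hU, hz⟩ := Set.mem_sUnion.1 (cover ▸ Set.mem_univ (f z))
      exact Set.mem_iUnion.2 ⟨⟨U, hU⟩, hz⟩)
  refine ⟨δ / 2, by positivity, fun l hl hdist => ?_⟩
  have length_pos : 0 < l.length := by omega
  obtain ⟨U, hU⟩ := hball l[0] trivial
  refine ⟨U, U.2, fun z => ?_⟩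
  rw [toMap_ofMap]
  refine hU (Metric.mem_ball.2 (lt_of_le_of_lt ?_ (half_lt_self hδ)))
  rw [TopSimplex.affineMap_eq_convexComb_getElem hl]
  exact dist_convexComb_le_of_forall _ fun i =>
    (hdist _ (List.getElem_mem _) _ (List.getElem_mem length_pos)).le

theorem eventually_subdivide_eq_zero {φ : Sing X _⦋n⦌ → K}
    (hφ : ∀ U ∈ 𝒰, ∀ σ, Inside U σ → φ σ = 0) (σ : Sing X _⦋n⦌) :
    ∃ k₀, ∀ k ≥ k₀, subdivide k φ σ = 0 := by
  obtain ⟨δ, hδ, hsmall⟩ := exists_inside_of_dist_lt isOpen cover (n := n) (toMap σ)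
  obtain ⟨k₀, hk₀⟩ := eventually_subdividedSimplex_mem_supported (K := K) n hδ
  refine ⟨k₀, fun k hk => evalAffine_eq_zero (hk₀ k hk) fun l hl hlen => ?_⟩
  obtain ⟨U, hU, hl⟩ := hsmall l hlen hl
  exact hφ U hU _ hl

theorem linearCombination_eq_zero_of_chainBoundary_mem_supported {n : ℕ} {φ : Sing X _⦋n + 1⦌ → K}
    (hφ : ∀ U ∈ 𝒰, ∀ σ, Inside U σ → φ σ = 0) (hd : coboundary φ = 0)
    {x : (Sing X _⦋n + 1⦌) →₀ K}
    (hx : chainBoundary K (Sing X) n x ∈ Finsupp.supported K K {σ | ∃ U ∈ 𝒰, Inside U σ}) :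
    Finsupp.linearCombination K φ x = 0 := by
  have homotopy_term (k : ℕ) :
      Finsupp.linearCombination K (coboundary (subdivisionHomotopy k φ)) x = 0 := by
    rw [linearCombination_coboundary, Finsupp.linearCombination_apply]
    refine Finset.sum_eq_zero fun τ hτ => ?_
    obtain ⟨U, hU, hτ⟩ := hx hτ
    exact smul_eq_zero_of_right _ (subdivisionHomotopy_eq_zero (hφ U hU) k hτ)
  have eq_subdivide (k : ℕ) : Finsupp.linearCombination K φ x =
      Finsupp.linearCombination K (subdivide k φ) x := by
    induction k with
    | zero => rw [subdivide_zero]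
    | succ k ih =>
      rw [ih, subdivide_eq_subdivide_succ_add hd]
      simpa only [← Finsupp.bilinearCombination_apply (R := K) (S := K), map_add,
        LinearMap.add_apply, add_eq_left]
        using homotopy_term k
  choose k₀ hk₀ using eventually_subdivide_eq_zero isOpen cover hφ
  rw [eq_subdivide (x.support.sup k₀), Finsupp.linearCombination_apply]
  exact Finset.sum_eq_zero fun σ hσ => smul_eq_zero_of_right _ (hk₀ σ _ (Finset.le_sup hσ))

theorem exists_coboundary_eq {n : ℕ} {φ : Sing X _⦋n + 1⦌ → K}
    (hφ : ∀ U ∈ 𝒰, ∀ σ, Inside U σ → φ σ = 0) (hd : coboundary φ = 0) :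
    ∃ ψ : Sing X _⦋n⦌ → K, (∀ U ∈ 𝒰, ∀ σ, Inside U σ → ψ σ = 0) ∧
      coboundary ψ = φ := by
  obtain ⟨g, g_small, g_boundary⟩ := exists_linearMap_comp_eq (chainBoundary K (Sing X) n)
    (Finsupp.supported K K {σ | ∃ U ∈ 𝒰, Inside U σ}) (Finsupp.linearCombination K φ) fun x hx =>
      linearCombination_eq_zero_of_chainBoundary_mem_supported isOpen cover hφ hd hx
  refine ⟨fun σ => g (Finsupp.single σ 1), fun U hU σ hσ =>
    g_small _ (Finsupp.single_mem_supported _ _ ⟨U, hU, hσ⟩), funext fun σ => ?_⟩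
  have := LinearMap.congr_fun g_boundary (Finsupp.single σ 1)
  simpa only [LinearMap.comp_apply, chainBoundary, Finsupp.linearCombination_single, one_smul,
    map_sum, map_smul, smul_eq_mul, one_mul, coboundary] using this

end Acyclicity

end Sing

/-! ### Cones on singular simplices -/

namespace TopSimplex

variable {m n : ℕ}

/-- The point dividing in the ratio `t : 1 - t` the segment from `s`, in the face opposite to the
vertex `0`, to this vertex. -/
noncomputable def join (t : unitInterval) (s : TopSimplex n) : TopSimplex (n + 1) :=
  ⟨Fin.cons (t : ℝ) fun i => (1 - t) * s i,
    Fin.cases t.2.1 fun i => mul_nonneg (sub_nonneg.2 t.2.2) (s.2.1 i), by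
    rw [Fin.sum_univ_succ]
    simp only [Fin.cons_zero, Fin.cons_succ]
    rw [← Finset.mul_sum, stdSimplex.sum_eq_one, mul_one, add_sub_cancel]⟩

theorem join_apply_zero (t : unitInterval) (s : TopSimplex n) : join t s 0 = t := rfl

theorem join_apply_succ (t : unitInterval) (s : TopSimplex n) (i : Fin (n + 1)) :
    join t s i.succ = (1 - t) * s i := rfl

theorem map_join {f : Fin (n + 1) → Fin (m + 1)} {g : Fin (n + 2) → Fin (m + 2)} (g_zero : g 0 = 0)
    (g_succ : ∀ i, g i.succ = (f i).succ) (t : unitInterval) (s : TopSimplex n) :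
    stdSimplex.map g (join t s) = join t (stdSimplex.map f s) := by
  refine stdSimplex.ext (funext fun j => ?_)
  rw [stdSimplex.map_coe, FunOnFinite.linearMap_apply_apply, Finset.sum_filter,
    Fin.sum_univ_succ, g_zero]
  simp only [g_succ, join_apply_zero, join_apply_succ]
  cases j using Fin.cases with
  | zero => simp [join_apply_zero]
  | succ j =>
    simp [join_apply_succ, FunOnFinite.linearMap_apply_apply, Finset.sum_filter, Finset.mul_sum,
      (Fin.succ_ne_zero j).symm]

theorem join_zero_left (s : TopSimplex n) : join 0 s = stdSimplex.map (Fin.succAbove 0) s := by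
  refine stdSimplex.ext (funext fun j => ?_)
  rw [stdSimplex.map_coe, FunOnFinite.linearMap_apply_apply, Finset.sum_filter]
  cases j using Fin.cases <;> simp [join_apply_zero, join_apply_succ]

theorem join_one_left (s : TopSimplex n) : join 1 s = stdSimplex.vertex 0 := by
  refine stdSimplex.ext (funext fun j => ?_)
  cases j using Fin.cases <;> simp [join_apply_zero, join_apply_succ]

theorem continuous_join : Continuous fun x : unitInterval × TopSimplex n => join x.1 x.2 := by
  refine Continuous.subtype_mk (continuous_pi (Fin.cases ?_ fun i => ?_)) _
  · exact continuous_subtype_val.comp continuous_fst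
  · have continuous_coord : Continuous fun x : unitInterval × TopSimplex n => x.2 i :=
      (continuous_apply i).comp (continuous_subtype_val.comp continuous_snd)
    exact (continuous_const.sub (continuous_subtype_val.comp continuous_fst)).mul continuous_coord

theorem exists_join_eq (p : TopSimplex (n + 1)) :
    ∃ (t : unitInterval) (s : TopSimplex n), join t s = p := by
  have sum_eq_one : p 0 + ∑ i : Fin (n + 1), p i.succ = 1 := by
    rw [← Fin.sum_univ_succ]
    exact p.2.2
  obtain h | h := eq_or_lt_of_le (stdSimplex.le_one p 0)
  · have sum_eq_zero : ∑ i : Fin (n + 1), p i.succ = 0 := by linarith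
    have succ_eq_zero := (Finset.sum_eq_zero_iff_of_nonneg fun i _ => p.2.1 (Fin.succ i)).1
      sum_eq_zero
    refine ⟨1, stdSimplex.vertex 0, stdSimplex.ext (funext (Fin.cases h.symm fun i => ?_))⟩
    exact (by simp [join_apply_succ] : join 1 (stdSimplex.vertex 0) i.succ = 0).trans
      (succ_eq_zero i (Finset.mem_univ i)).symm
  · have one_sub_pos : 0 < 1 - p 0 := by linarith
    refine ⟨⟨p 0, p.2.1 0, h.le⟩, ⟨fun i => p i.succ / (1 - p 0), fun i =>
      div_nonneg (p.2.1 _) one_sub_pos.le, ?_⟩, stdSimplex.ext ?_⟩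
    · rw [← Finset.sum_div, div_eq_one_iff_eq one_sub_pos.ne']
      linarith
    · refine funext (Fin.cases rfl fun i => ?_)
      exact mul_div_cancel₀ _ one_sub_pos.ne'

theorem eq_of_join_eq_join {t t' : unitInterval} {s s' : TopSimplex n}
    (h : join t s = join t' s') : t = t' ∧ (t ≠ 1 → s = s') := by
  obtain rfl : t = t' := Subtype.ext (by rw [← join_apply_zero t s, h, join_apply_zero])
  refine ⟨rfl, fun t_ne => Subtype.ext (funext fun i => ?_)⟩
  have one_sub_ne : (1 - t : ℝ) ≠ 0 := sub_ne_zero.2 fun h => t_ne (Subtype.ext h.symm)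
  exact mul_left_cancel₀ one_sub_ne (congrArg (fun p => p i.succ) h)

theorem exists_extend_join {Y : Type*} [TopologicalSpace Y] (g : C(unitInterval × TopSimplex n, Y))
    (hg : ∀ s s', g (1, s) = g (1, s')) :
    ∃ G : C(TopSimplex (n + 1), Y), ∀ t s, G (join t s) = g (t, s) := by
  let j : C(unitInterval × TopSimplex n, TopSimplex (n + 1)) :=
    ⟨fun x => join x.1 x.2, continuous_join⟩
  have isQuotientMap_j : Topology.IsQuotientMap j :=
    j.continuous.isClosedMap.isQuotientMap j.continuous fun p => by
      obtain ⟨t, s, h⟩ := exists_join_eq p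
      exact ⟨(t, s), h⟩
  have factorsThrough : Function.FactorsThrough g j := by
    rintro ⟨t, s⟩ ⟨t', s'⟩ h
    obtain ⟨rfl : t = t', hs : t ≠ 1 → s = s'⟩ := eq_of_join_eq_join h
    obtain rfl | ht := eq_or_ne t 1
    · exact hg s s'
    · rw [hs ht]
  exact ⟨isQuotientMap_j.lift g factorsThrough, fun t s =>
    congrArg (fun f => f (t, s)) (isQuotientMap_j.lift_comp g factorsThrough)⟩

end TopSimplex

/-- `U` is categorical in `X`: its inclusion into `X` is null-homotopic. -/
def IsCategorical {X : Type u} [TopologicalSpace X] (U : Set X) : Prop :=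
  (⟨Subtype.val, continuous_subtype_val⟩ : C(U, X)).Nullhomotopic

namespace Sing

variable {K : Type v} [Field K] {X : Type u} [TopologicalSpace X] {U : Set X} {n : ℕ}

/-- `τ` is the trace of the singular simplex `σ` under the homotopy `H` contracting `U`, its
vertex `0` being the end point of the contraction. -/
def IsCone {y : X} (H : (⟨Subtype.val, continuous_subtype_val⟩ : C(U, X)).Homotopy
    (ContinuousMap.const U y)) {σ : Sing X _⦋n⦌} (hσ : Inside U σ) (τ : Sing X _⦋n + 1⦌) : Prop :=
  ∀ t s, toMap τ (TopSimplex.join t s) = H (t, ⟨toMap σ s, hσ s⟩)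

section Cone

variable {y : X} {H : (⟨Subtype.val, continuous_subtype_val⟩ : C(U, X)).Homotopy
  (ContinuousMap.const U y)}

variable (H) in
theorem exists_isCone {σ : Sing X _⦋n⦌} (hσ : Inside U σ) :
    ∃ τ : Sing X _⦋n + 1⦌, IsCone H hσ τ := by
  obtain ⟨G, hG⟩ := TopSimplex.exists_extend_join
    (⟨fun x => H (x.1, ⟨toMap σ x.2, hσ x.2⟩), by fun_prop⟩ : C(unitInterval × TopSimplex n, X))
    (fun s s' => by simp)
  exact ⟨ofMap G, fun t s => by rw [toMap_ofMap, hG]; rfl⟩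

theorem IsCone.δ_zero {σ : Sing X _⦋n⦌} {hσ : Inside U σ} {τ : Sing X _⦋n + 1⦌}
    (h : IsCone H hσ τ) : (Sing X).δ 0 τ = σ := ext_toMap fun z => by
  rw [toMap_δ, ← TopSimplex.join_zero_left, h, H.apply_zero]
  rfl

theorem IsCone.δ_succ {σ : Sing X _⦋n + 1⦌} {hσ : Inside U σ} {τ : Sing X _⦋n + 2⦌}
    (h : IsCone H hσ τ) {j : Fin (n + 2)} {τ' : Sing X _⦋n + 1⦌} (h' : IsCone H (hσ.δ j) τ') :
    (Sing X).δ j.succ τ = τ' := ext_toMap fun z => by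
  obtain ⟨t, s, rfl⟩ := TopSimplex.exists_join_eq z
  rw [h', toMap_δ, TopSimplex.map_join (f := j.succAbove) (by simp) (by simp), h]
  rfl

theorem IsCone.δ_one {σ : Sing X _⦋0⦌} {hσ : Inside U σ} {τ : Sing X _⦋1⦌} (h : IsCone H hσ τ) :
    (Sing X).δ 1 τ = ofMap (ContinuousMap.const _ y) := ext_toMap fun z => by
  have face_eq_join : stdSimplex.map (Fin.succAbove 1) z = TopSimplex.join 1 z := by
    rw [TopSimplex.join_one_left, Subsingleton.elim z (stdSimplex.vertex 0), stdSimplex.map_vertex]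
    rfl
  rw [toMap_δ, face_eq_join, h, H.apply_one, toMap_ofMap]
  rfl

end Cone

theorem exists_eq_coboundary_of_inside (hU : IsCategorical U) {φ : Sing X _⦋n + 1⦌ → K}
    (hφ : coboundary φ = 0) :
    ∃ ψ : Sing X _⦋n⦌ → K, ∀ σ, Inside U σ → φ σ = coboundary ψ σ := by
  classical
  obtain ⟨y, ⟨H⟩⟩ := hU
  choose cone isCone_cone using fun (n : ℕ) (σ : Sing X _⦋n⦌) => exists_isCone H (σ := σ)
  refine ⟨fun τ => if h : Inside U τ then φ (cone n τ h) else 0, fun σ hσ => ?_⟩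
  have coboundary_cone : coboundary φ (cone (n + 1) σ hσ) = 0 := congrFun hφ _
  rw [coboundary, Fin.sum_univ_succ, (isCone_cone _ _ hσ).δ_zero] at coboundary_cone
  simp only [Fin.val_zero, pow_zero, one_mul,
    fun j => (isCone_cone _ _ hσ).δ_succ (isCone_cone _ _ (hσ.δ j)), Fin.val_succ, pow_succ,
    mul_neg, mul_one, neg_mul, Finset.sum_neg_distrib] at coboundary_cone
  rw [coboundary, ← sub_eq_zero, sub_eq_add_neg]
  simpa only [dif_pos (hσ.δ _)] using coboundary_cone

theorem exists_eq_const_of_inside (hU : IsCategorical U) {φ : Sing X _⦋0⦌ → K}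
    (hφ : coboundary φ = 0) : ∃ c, ∀ σ, Inside U σ → φ σ = c := by
  obtain ⟨y, ⟨H⟩⟩ := hU
  refine ⟨φ (ofMap (ContinuousMap.const _ y)), fun σ hσ => ?_⟩
  obtain ⟨τ, hτ⟩ := exists_isCone H hσ
  have coboundary_cone : coboundary φ τ = 0 := congrFun hφ τ
  rw [coboundary, Fin.sum_univ_two, hτ.δ_zero, hτ.δ_one] at coboundary_cone
  simp only [Fin.val_zero, pow_zero, one_mul, Fin.val_one, pow_one, neg_mul] at coboundary_cone
  exact add_neg_eq_zero.1 coboundary_cone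

end Sing

/-! ### The augmented cochain algebra -/

section AugmentedCochains

variable {K : Type v} [Field K] {S : SSet.{u}} {n : ℕ}

/-- The cochain concentrated in degree `n` with a given component there. -/
noncomputable def singleCochain (n : ℕ) : (S _⦋n⦌ → K) →ₗ[K] cochains K S :=
  (LinearMap.single K (fun k => S _⦋k⦌ → K) n).codRestrict (cochains K S) fun φ =>
    ⟨n + 1, fun k hk => Pi.single_eq_of_ne (M := fun k => S _⦋k⦌ → K) (by omega : k ≠ n) φ⟩

theorem singleCochain_same (φ : S _⦋n⦌ → K) : (singleCochain n φ).1 n = φ :=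
  Pi.single_eq_same (M := fun k => S _⦋k⦌ → K) n φ

theorem singleCochain_of_ne {k : ℕ} (h : k ≠ n) (φ : S _⦋n⦌ → K) :
    (singleCochain n φ).1 k = 0 :=
  Pi.single_eq_of_ne (M := fun k => S _⦋k⦌ → K) h φ

theorem eq_singleCochain {φ : cochains K S} (h : ∀ k ≠ n, φ.1 k = 0) :
    φ = singleCochain n (φ.1 n) := by
  refine Subtype.ext (funext fun k => ?_)
  obtain rfl | hk := eq_or_ne k n
  · rw [singleCochain_same]
  · rw [singleCochain_of_ne hk, h k hk]

theorem cochainDLin_singleCochain (φ : S _⦋n⦌ → K) :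
    cochainDLin K S (singleCochain n φ) = singleCochain (n + 1) (coboundary φ) := by
  refine (eq_singleCochain fun k hk => funext fun σ => ?_).trans
    (congrArg _ (funext fun σ => ?_))
  · cases k with
    | zero => rfl
    | succ k =>
      change coboundary ((singleCochain n φ).1 k) σ = 0
      simp [coboundary, singleCochain_of_ne (show k ≠ n by omega)]
  · change coboundary ((singleCochain n φ).1 n) σ = _
    rw [singleCochain_same]

theorem smul_unitCochain (c : K) : c • unitCochain K S = singleCochain 0 fun _ => c := by
  refine (eq_singleCochain fun k hk => ?_).trans (congrArg _ (funext fun σ => ?_))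
  · obtain ⟨k, rfl⟩ := Nat.exists_eq_succ_of_ne_zero hk
    simp [unitCochain]
  · simp [unitCochain]

theorem cupLin_singleCochain_zero (φ ψ : S _⦋0⦌ → K) :
    cupLin K S (singleCochain 0 φ) (singleCochain 0 ψ) = singleCochain 0 (φ * ψ) := by
  refine (eq_singleCochain fun k hk => funext fun σ => ?_).trans
    (congrArg _ (funext fun σ => ?_))
  · change cup (singleCochain 0 φ).1 (singleCochain 0 ψ).1 k σ = 0
    refine Finset.sum_eq_zero fun x hx => ?_
    rw [Finset.HasAntidiagonal.mem_antidiagonal] at hx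
    obtain h | h : x.1 ≠ 0 ∨ x.2 ≠ 0 := by omega
    · simp [singleCochain_of_ne h]
    · simp [singleCochain_of_ne h]
  · change cup (singleCochain 0 φ).1 (singleCochain 0 ψ).1 0 σ = _
    rw [cup_zero_apply, singleCochain_same, singleCochain_same, Pi.mul_apply]

variable (s₀ : S _⦋0⦌)

variable {s₀} in
theorem augProj_of_apply_eq_zero {φ : cochains K S} (h : φ.1 0 s₀ = 0) : augProj K s₀ φ = φ := by
  rw [augProj_apply, h, zero_smul, sub_zero]

theorem augGrProj_of_mem {i : ℤ} {x : K × cochains K S} (hx : x ∈ augGr K S i) :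
    augGrProj K S i x = x := by
  ext n σ
  · by_cases h : i = -1
    · simp [augGrProj, h]
    · simp [augGrProj, h, hx.1 h]
  · by_cases h : (n : ℤ) = i
    · simp [augGrProj, h]
    · simp [augGrProj, h, hx.2 n h]

theorem augGrProj_of_mem_ne {i j : ℤ} {x : K × cochains K S} (hx : x ∈ augGr K S i)
    (hij : i ≠ j) : augGrProj K S j x = 0 := by
  ext n σ
  · by_cases h : j = -1
    · simp [augGrProj, h, hx.1 (h ▸ hij)]
    · simp [augGrProj, h]
  · by_cases h : (n : ℤ) = j
    · simp [augGrProj, h, hx.2 n (h ▸ hij.symm)]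
    · simp [augGrProj, h]

theorem proj_augCochains (i : ℤ) (x : (augCochains K s₀).carrier) :
    (augCochains K s₀).proj i x = augGrProj K S i x := by
  suffices (augCochains K s₀).proj i = augGrProj K S i from LinearMap.congr_fun this x
  refine DGAlgebra.linearMap_ext fun j x hx => ?_
  obtain rfl | hij := eq_or_ne j i
  · exact (DGAlgebra.proj_of_mem _ hx).trans (augGrProj_of_mem hx).symm
  · exact (DGAlgebra.proj_of_mem_ne _ hx hij).trans (augGrProj_of_mem_ne hx hij).symm

theorem fst_proj_augCochains (i : ℤ) (x : (augCochains K s₀).carrier) :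
    ((augCochains K s₀).proj i x).1 = if i = -1 then x.1 else 0 :=
  congrArg Prod.fst (proj_augCochains s₀ i x)

theorem snd_proj_augCochains_apply (i : ℤ) (x : (augCochains K s₀).carrier) (n : ℕ) :
    ((augCochains K s₀).proj i x).2.1 n = if (n : ℤ) = i then x.2.1 n else 0 :=
  congrArg (fun y : K × cochains K S => y.2.1 n) (proj_augCochains s₀ i x)

theorem augProj_snd_proj_apply (i : ℤ) (x : (augCochains K s₀).carrier) (n : ℕ) :
    (augProj K s₀ ((augCochains K s₀).proj i x).2).1 n =
      if (n : ℤ) = i then (augProj K s₀ x.2).1 n else 0 := by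
  have augProj_apply_succ (φ : cochains K S) (n : ℕ) :
      (augProj K s₀ φ).1 (n + 1) = φ.1 (n + 1) := by simp [augProj, unitCochain]
  have augProj_apply_zero (φ : cochains K S) (σ : S _⦋0⦌) :
      (augProj K s₀ φ).1 0 σ = φ.1 0 σ - φ.1 0 s₀ := by simp [augProj, unitCochain]
  cases n with
  | zero =>
    funext σ
    rw [augProj_apply_zero, snd_proj_augCochains_apply]
    split_ifs <;> simp [augProj_apply_zero]
  | succ n => rw [augProj_apply_succ, augProj_apply_succ, snd_proj_augCochains_apply]

/-- The element of the augmented cochain algebra given by a cochain of degree `n`. -/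
noncomputable def augSingle (n : ℕ) : (S _⦋n⦌ → K) →ₗ[K] (augCochains K s₀).carrier :=
  LinearMap.inr K K (cochains K S) ∘ₗ singleCochain n

theorem augSingle_mem (φ : S _⦋n⦌ → K) : augSingle s₀ n φ ∈ (augCochains K s₀).gr n :=
  ⟨fun _ => rfl, fun k hk => singleCochain_of_ne (by omega) φ⟩

theorem d_augSingle (φ : S _⦋n⦌ → K) :
    (augCochains K s₀).d (augSingle s₀ n φ) = augSingle s₀ (n + 1) (coboundary φ) := by
  refine (augCochains_d_apply K s₀ 0 (singleCochain n φ)).trans ?_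
  rw [cochainDLin_singleCochain, zero_smul, add_zero]
  rfl

theorem augSingle_const_mem_range_d (c : K) :
    augSingle s₀ 0 (fun _ => c) ∈ LinearMap.range (augCochains K s₀).d := by
  refine ⟨(c, 0), (augCochains_d_apply K s₀ c 0).trans ?_⟩
  rw [map_zero, zero_add, smul_unitCochain]
  rfl

theorem d_apply_zero (x : (augCochains K s₀).carrier) (σ : S _⦋0⦌) :
    ((augCochains K s₀).d x).2.1 0 σ = x.1 := by
  obtain ⟨c, φ⟩ := x
  rw [augCochains_d_apply]
  simp [cochainDLin, cochainD, unitCochain]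

variable {s₀}

theorem mul_augSingle_zero {φ ψ : S _⦋0⦌ → K} (hφ : φ s₀ = 0) (hψ : ψ s₀ = 0) :
    (augCochains K s₀).mul (augSingle s₀ 0 φ) (augSingle s₀ 0 ψ) = augSingle s₀ 0 (φ * ψ) := by
  refine (augCochains_mul_apply K s₀ 0 0 (singleCochain 0 φ) (singleCochain 0 ψ)).trans ?_
  rw [augProj_of_apply_eq_zero (by rwa [singleCochain_same]),
    augProj_of_apply_eq_zero (by rwa [singleCochain_same]), cupLin_singleCochain_zero]
  rfl

theorem eq_zero_or_eq_augSingle_of_d_eq_zero {i : ℤ} {x : (augCochains K s₀).carrier}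
    (hx : x ∈ (augCochains K s₀).gr i) (hd : (augCochains K s₀).d x = 0) :
    x = 0 ∨ ∃ (n : ℕ) (φ : S _⦋n⦌ → K), coboundary φ = 0 ∧ x = augSingle s₀ n φ := by
  have fst_eq_zero : x.1 = 0 := by
    rw [← d_apply_zero s₀ x s₀, hd]
    rfl
  obtain ⟨n, rfl⟩ | hi := em (∃ n : ℕ, i = n)
  · have x_eq : x = augSingle s₀ n (x.2.1 n) :=
      Prod.ext fst_eq_zero (eq_singleCochain fun k hk => hx.2 k (by exact_mod_cast hk))
    refine Or.inr ⟨n, _, ?_, x_eq⟩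
    rw [x_eq, d_augSingle] at hd
    rw [← singleCochain_same (coboundary _)]
    exact congrArg (fun y : K × cochains K S => y.2.1 (n + 1)) hd
  · exact Or.inl (Prod.ext fst_eq_zero (Subtype.ext (funext fun n =>
      hx.2 n fun hn => hi ⟨n, hn.symm⟩)))

theorem mem_of_d_eq_zero {M P : Submodule K (augCochains K s₀).carrier}
    (hM : M.IsHomogeneous (augCochains K s₀).gr)
    (h : ∀ (n : ℕ) (φ : S _⦋n⦌ → K), coboundary φ = 0 → augSingle s₀ n φ ∈ M →
      augSingle s₀ n φ ∈ P)
    {x : (augCochains K s₀).carrier} (hx : x ∈ M) (hd : (augCochains K s₀).d x = 0) : x ∈ P :=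
  DGAlgebra.mem_of_forall_proj_mem _ fun i => by
    have proj_mem : (augCochains K s₀).proj i x ∈ M := hM i hx
    obtain hzero | ⟨n, φ, hφ, hn⟩ := eq_zero_or_eq_augSingle_of_d_eq_zero
      ((augCochains K s₀).proj_mem i x) (by rw [← DGAlgebra.proj_d, hd, map_zero])
    · exact hzero ▸ zero_mem P
    · exact hn ▸ h n φ hφ (hn ▸ proj_mem)

theorem ker_d_le {P : Submodule K (augCochains K s₀).carrier}
    (h : ∀ (n : ℕ) (φ : S _⦋n⦌ → K), coboundary φ = 0 → augSingle s₀ n φ ∈ P) :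
    LinearMap.ker (augCochains K s₀).d ≤ P := fun _ hx =>
  mem_of_d_eq_zero (M := ⊤) (fun _ _ _ => trivial) (fun n φ hφ _ => h n φ hφ) trivial hx

end AugmentedCochains

/-! ### Spaces covered by two categorical open sets -/

namespace Sing

variable {K : Type v} [Field K] {X : Type u} [TopologicalSpace X] {U V : Set X} {n : ℕ}

section Vanishing

variable (K U) in
/-- The ideal of the cochains that vanish on the singular simplices contained in `U`. -/
noncomputable def vanishing : Submodule K (cochains K (Sing X)) where
  carrier := {φ | ∀ (n : ℕ) (σ : Sing X _⦋n⦌), Inside U σ → φ.1 n σ = 0}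
  add_mem' hφ hψ n σ hσ := by simp [hφ n σ hσ, hψ n σ hσ]
  zero_mem' _ _ _ := rfl
  smul_mem' c φ hφ n σ hσ := by simp [hφ n σ hσ]

theorem cupLin_mem_vanishing_left {φ : cochains K (Sing X)} (hφ : φ ∈ vanishing K U)
    (ψ : cochains K (Sing X)) : cupLin K (Sing X) φ ψ ∈ vanishing K U := fun n σ hσ =>
  show cup φ.1 ψ.1 n σ = 0 from
    Finset.sum_eq_zero fun _ _ => by rw [hφ _ _ (hσ.intervalFace _ _), zero_mul]

theorem cupLin_mem_vanishing_right (φ : cochains K (Sing X)) {ψ : cochains K (Sing X)}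
    (hψ : ψ ∈ vanishing K U) : cupLin K (Sing X) φ ψ ∈ vanishing K U := fun n σ hσ =>
  show cup φ.1 ψ.1 n σ = 0 from
    Finset.sum_eq_zero fun _ _ => by rw [hψ _ _ (hσ.intervalFace _ _), mul_zero]

theorem singleCochain_mem_vanishing {φ : Sing X _⦋n⦌ → K} :
    singleCochain n φ ∈ vanishing K U ↔ ∀ σ, Inside U σ → φ σ = 0 := by
  refine ⟨fun h σ hσ => ?_, fun h k σ hσ => ?_⟩
  · simpa only [singleCochain_same] using h n σ hσ
  · obtain rfl | hk := eq_or_ne k n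
    · rw [singleCochain_same, h σ hσ]
    · rw [singleCochain_of_ne hk, Pi.zero_apply]

variable (s₀ : Sing X _⦋0⦌)

variable (K U) in
/-- The elements of the augmented cochain algebra whose component in the augmentation ideal
vanishes on the singular simplices contained in `U`. -/
noncomputable def augVanishing : Submodule K (augCochains K s₀).carrier :=
  (vanishing K U).comap (augProj K s₀ ∘ₗ LinearMap.snd K K (cochains K (Sing X)))

variable (K U V) in
/-- The cochains, without component in degree `-1`, that vanish on the singular simplices contained
in `U` or in `V`. -/
noncomputable def coverIdeal : Submodule K (augCochains K s₀).carrier :=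
  (⊥ : Submodule K K).prod (vanishing K U ⊓ vanishing K V)

theorem isHomogeneous_augVanishing :
    (augVanishing K U s₀).IsHomogeneous (augCochains K s₀).gr := fun i x hx n σ hσ => by
  refine (congrFun (augProj_snd_proj_apply s₀ i x n) σ).trans ?_
  split_ifs
  · exact hx n σ hσ
  · rfl

theorem isHomogeneous_coverIdeal :
    (coverIdeal K U V s₀).IsHomogeneous (augCochains K s₀).gr := fun i x ⟨hx₁, hxU, hxV⟩ => by
  have apply_eq_zero {n : ℕ} {σ : Sing X _⦋n⦌} (h : x.2.1 n σ = 0) :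
      ((augCochains K s₀).proj i x).2.1 n σ = 0 := by
    rw [snd_proj_augCochains_apply]
    split_ifs
    · exact h
    · rfl
  refine ⟨(fst_proj_augCochains s₀ i x).trans ?_, fun n σ hσ => apply_eq_zero (hxU n σ hσ),
    fun n σ hσ => apply_eq_zero (hxV n σ hσ)⟩
  rw [show x.1 = 0 from hx₁, ite_self]

variable {s₀}

theorem mul_mem_augVanishing {x : (augCochains K s₀).carrier} (hx : x ∈ augVanishing K U s₀)
    (y : (augCochains K s₀).carrier) : (augCochains K s₀).mul x y ∈ augVanishing K U s₀ := by
  change augProj K s₀ (cupLin K (Sing X) (augProj K s₀ x.2) (augProj K s₀ y.2)) ∈ vanishing K U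
  rw [augProj_cup]
  exact cupLin_mem_vanishing_left hx _

theorem mul_mem_coverIdeal_of_mem_of_mem {x y : (augCochains K s₀).carrier}
    (hx : x ∈ augVanishing K U s₀) (hy : y ∈ augVanishing K V s₀) :
    (augCochains K s₀).mul x y ∈ coverIdeal K U V s₀ :=
  ⟨rfl, cupLin_mem_vanishing_left hx _, cupLin_mem_vanishing_right _ hy⟩

theorem coverIdeal_le_augVanishing (hs₀ : Inside U s₀ ∨ Inside V s₀) :
    coverIdeal K U V s₀ ≤ augVanishing K U s₀ ⊓ augVanishing K V s₀ := by
  rintro x ⟨-, hxU, hxV⟩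
  have augProj_eq : augProj K s₀ x.2 = x.2 :=
    augProj_of_apply_eq_zero (hs₀.elim (hxU 0 s₀) (hxV 0 s₀))
  exact ⟨(congrArg (· ∈ vanishing K U) augProj_eq).mpr hxU,
    (congrArg (· ∈ vanishing K V) augProj_eq).mpr hxV⟩

theorem mul_mem_coverIdeal_right (hs₀ : Inside U s₀ ∨ Inside V s₀)
    {x : (augCochains K s₀).carrier} (hx : x ∈ coverIdeal K U V s₀)
    (y : (augCochains K s₀).carrier) : (augCochains K s₀).mul x y ∈ coverIdeal K U V s₀ := by
  obtain ⟨hxU, hxV⟩ := coverIdeal_le_augVanishing hs₀ hx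
  exact ⟨rfl, cupLin_mem_vanishing_left hxU _, cupLin_mem_vanishing_left hxV _⟩

theorem mul_mem_coverIdeal_left (hs₀ : Inside U s₀ ∨ Inside V s₀)
    (x : (augCochains K s₀).carrier) {y : (augCochains K s₀).carrier}
    (hy : y ∈ coverIdeal K U V s₀) : (augCochains K s₀).mul x y ∈ coverIdeal K U V s₀ := by
  obtain ⟨hyU, hyV⟩ := coverIdeal_le_augVanishing hs₀ hy
  exact ⟨rfl, cupLin_mem_vanishing_right _ hyU, cupLin_mem_vanishing_right _ hyV⟩

theorem augSingle_mem_coverIdeal {φ : Sing X _⦋n⦌ → K} :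
    augSingle s₀ n φ ∈ coverIdeal K U V s₀ ↔
      (∀ σ, Inside U σ → φ σ = 0) ∧ ∀ σ, Inside V σ → φ σ = 0 :=
  (and_iff_right (Submodule.zero_mem ⊥)).trans
    (and_congr singleCochain_mem_vanishing singleCochain_mem_vanishing)

end Vanishing

theorem inside_of_mem {σ : Sing X _⦋0⦌} {z : TopSimplex 0} (h : toMap σ z ∈ U) : Inside U σ :=
  fun z' => by rwa [Subsingleton.elim z' z]

theorem inside_or_inside_of_union_eq_univ (hUV : U ∪ V = Set.univ) (σ : Sing X _⦋0⦌) :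
    Inside U σ ∨ Inside V σ :=
  (hUV ▸ Set.mem_univ (toMap σ (stdSimplex.vertex 0)) : _ ∈ U ∪ V).imp inside_of_mem inside_of_mem

variable {s₀ : Sing X _⦋0⦌}

theorem exists_mem_coverIdeal_d_eq (hU : IsOpen U) (hV : IsOpen V) (hUV : U ∪ V = Set.univ)
    {x : (augCochains K s₀).carrier} (hx : x ∈ coverIdeal K U V s₀)
    (hd : (augCochains K s₀).d x = 0) :
    ∃ y ∈ coverIdeal K U V s₀, (augCochains K s₀).d y = x := by
  refine mem_of_d_eq_zero (P := (coverIdeal K U V s₀).map (augCochains K s₀).d)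
    (isHomogeneous_coverIdeal s₀) (fun n φ hφ hmem => ?_) hx hd
  obtain ⟨hφU, hφV⟩ := augSingle_mem_coverIdeal.1 hmem
  cases n with
  | zero =>
    have φ_eq_zero : φ = 0 := funext fun σ =>
      (inside_or_inside_of_union_eq_univ hUV σ).elim (hφU σ) (hφV σ)
    rw [φ_eq_zero, map_zero]
    exact zero_mem _
  | succ n =>
    obtain ⟨ψ, hψ, rfl⟩ := exists_coboundary_eq (𝒰 := {U, V}) (by simp [hU, hV])
      (by rw [Set.sUnion_pair, hUV]) (by simpa using ⟨hφU, hφV⟩) hφ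
    exact ⟨augSingle s₀ n ψ, augSingle_mem_coverIdeal.2 ⟨hψ U (by simp), hψ V (by simp)⟩,
      d_augSingle s₀ ψ⟩

theorem ker_d_le_augVanishing_sup_range (hU : IsCategorical U)
    (hconst : ∀ φ : Sing X _⦋0⦌ → K, coboundary φ = 0 → ∃ c, φ = fun _ => c) :
    LinearMap.ker (augCochains K s₀).d ≤
      augVanishing K U s₀ ⊔ LinearMap.range (augCochains K s₀).d := ker_d_le fun n φ hφ => by
  cases n with
  | zero =>
    obtain ⟨c, rfl⟩ := hconst φ hφ
    exact Submodule.mem_sup_right (augSingle_const_mem_range_d s₀ c)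
  | succ n =>
    obtain ⟨ψ, hψ⟩ := exists_eq_coboundary_of_inside hU hφ
    have sub_mem : augSingle s₀ (n + 1) (φ - coboundary ψ) ∈ augVanishing K U s₀ := by
      change augProj K s₀ (singleCochain (n + 1) (φ - coboundary ψ)) ∈ vanishing K U
      rw [augProj_of_apply_eq_zero (by rw [singleCochain_of_ne (by omega), Pi.zero_apply])]
      exact singleCochain_mem_vanishing.2 fun σ hσ => sub_eq_zero.2 (hψ σ hσ)
    refine Submodule.mem_sup.2 ⟨_, sub_mem, _, ⟨augSingle s₀ n ψ, rfl⟩, ?_⟩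
    rw [d_augSingle, ← map_add, sub_add_cancel]

theorem isFormal_augCochains_of_const (hU : IsOpen U) (hV : IsOpen V) (hUV : U ∪ V = Set.univ)
    (hU' : IsCategorical U) (hV' : IsCategorical V)
    (hconst : ∀ φ : Sing X _⦋0⦌ → K, coboundary φ = 0 → ∃ c, φ = fun _ => c) :
    (augCochains K s₀).IsFormal :=
  have hs₀ := inside_or_inside_of_union_eq_univ hUV s₀
  DGAlgebra.isFormal_of_ideals (J₁ := augVanishing K U s₀) (J₂ := augVanishing K V s₀)
    (N := coverIdeal K U V s₀) (isHomogeneous_augVanishing s₀) (isHomogeneous_augVanishing s₀)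
    (isHomogeneous_coverIdeal s₀) (fun _ hx y => mul_mem_augVanishing hx y)
    (fun _ hx y => mul_mem_coverIdeal_right hs₀ hx y)
    (fun x _ hy => mul_mem_coverIdeal_left hs₀ x hy)
    (fun _ hx _ hy => mul_mem_coverIdeal_of_mem_of_mem hx hy)
    (fun _ hx hd => exists_mem_coverIdeal_d_eq hU hV hUV hx hd)
    (ker_d_le_augVanishing_sup_range hU' hconst) (ker_d_le_augVanishing_sup_range hV' hconst)

theorem inside_const {x : X} (hx : x ∈ U) :
    Inside U (ofMap (ContinuousMap.const (TopSimplex n) x)) := fun z => by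
  rw [toMap_ofMap]
  exact hx

theorem exists_eq_const (hUV : U ∪ V = Set.univ) (hU : IsCategorical U) (hV : IsCategorical V)
    (h : U = ∅ ∨ V = ∅ ∨ (U ∩ V).Nonempty) {φ : Sing X _⦋0⦌ → K} (hφ : coboundary φ = 0) :
    ∃ c, φ = fun _ => c := by
  obtain ⟨a, ha⟩ := exists_eq_const_of_inside hU hφ
  obtain ⟨b, hb⟩ := exists_eq_const_of_inside hV hφ
  have inside (σ) := inside_or_inside_of_union_eq_univ hUV σ
  obtain rfl | rfl | ⟨p, hpU, hpV⟩ := h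
  · exact ⟨b, funext fun σ => (inside σ).elim (fun h => (h (stdSimplex.vertex 0)).elim) (hb σ)⟩
  · exact ⟨a, funext fun σ => (inside σ).elim (ha σ) fun h => (h (stdSimplex.vertex 0)).elim⟩
  · obtain rfl : a = b := (ha _ (inside_const hpU)).symm.trans (hb _ (inside_const hpV))
    exact ⟨a, funext fun σ => (inside σ).elim (ha σ) (hb σ)⟩

section Disjoint

theorem Inside.not_inside_of_disjoint (h : Disjoint U V) {σ : Sing X _⦋n⦌} (hσ : Inside U σ) :
    ¬Inside V σ := fun hσ' =>
  Set.disjoint_left.1 h (hσ (stdSimplex.vertex 0)) (hσ' _)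

theorem inside_or_inside_of_disjoint (hU : IsOpen U) (hV : IsOpen V) (hUV : U ∪ V = Set.univ)
    (hdisj : Disjoint U V) (σ : Sing X _⦋n⦌) : Inside U σ ∨ Inside V σ :=
  ((isPreconnected_range (toMap σ).continuous).subset_or_subset hU hV hdisj
    (hUV ▸ Set.subset_univ _)).imp Set.range_subset_iff.1 Set.range_subset_iff.1

theorem coboundary_congr {φ ψ : Sing X _⦋n⦌ → K} (h : ∀ σ, Inside U σ → φ σ = ψ σ)
    {σ : Sing X _⦋n + 1⦌} (hσ : Inside U σ) : coboundary φ σ = coboundary ψ σ :=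
  Finset.sum_congr rfl fun j _ => congrArg _ (h _ (hσ.δ j))

variable (K V) in
/-- The `0`-cochain equal to `1` on the points of `V` and to `0` elsewhere. -/
noncomputable def vertexIndicator : Sing X _⦋0⦌ → K := Set.indicator {σ | Inside V σ} 1

theorem vertexIndicator_of_inside {σ : Sing X _⦋0⦌} (h : Inside V σ) :
    vertexIndicator K V σ = 1 := Set.indicator_of_mem h _

theorem vertexIndicator_of_inside_of_disjoint (hdisj : Disjoint U V) {σ : Sing X _⦋0⦌}
    (h : Inside U σ) : vertexIndicator K V σ = 0 :=
  Set.indicator_of_notMem (h.not_inside_of_disjoint hdisj) _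

variable (K V) in
theorem vertexIndicator_mul_self :
    vertexIndicator K V * vertexIndicator K V = vertexIndicator (X := X) K V := by
  classical
  ext σ
  simp [vertexIndicator, Set.indicator_apply]

theorem coboundary_vertexIndicator (hU : IsOpen U) (hV : IsOpen V) (hUV : U ∪ V = Set.univ)
    (hdisj : Disjoint U V) : coboundary (vertexIndicator K V) = 0 := by
  have coboundary_const (c : K) (σ : Sing X _⦋1⦌) : coboundary (fun _ => c) σ = 0 := by
    simp [coboundary, Fin.sum_univ_two]
  funext σ
  obtain h | h := inside_or_inside_of_disjoint hU hV hUV hdisj σ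
  · exact (coboundary_congr (fun _ => vertexIndicator_of_inside_of_disjoint hdisj) h).trans
      (coboundary_const 0 σ)
  · exact (coboundary_congr (fun _ => vertexIndicator_of_inside) h).trans (coboundary_const 1 σ)

theorem exists_coboundary_eq_of_disjoint (hU : IsOpen U) (hV : IsOpen V)
    (hUV : U ∪ V = Set.univ) (hdisj : Disjoint U V) (hU' : IsCategorical U)
    (hV' : IsCategorical V) {φ : Sing X _⦋n + 1⦌ → K} (hφ : coboundary φ = 0) :
    ∃ ψ, coboundary ψ = φ := by
  classical
  obtain ⟨ψU, hψU⟩ := exists_eq_coboundary_of_inside hU' hφ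
  obtain ⟨ψV, hψV⟩ := exists_eq_coboundary_of_inside hV' hφ
  refine ⟨fun τ => if Inside U τ then ψU τ else ψV τ, funext fun σ => ?_⟩
  obtain h | h := inside_or_inside_of_disjoint hU hV hUV hdisj σ
  · rw [hψU σ h]
    exact coboundary_congr (fun τ hτ => if_pos hτ) h
  · rw [hψV σ h]
    exact coboundary_congr (fun τ hτ => if_neg (hτ.not_inside_of_disjoint hdisj.symm)) h

variable {s₀ : Sing X _⦋0⦌}

theorem ker_d_le_span_sup_range (hU : IsOpen U) (hV : IsOpen V) (hUV : U ∪ V = Set.univ)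
    (hdisj : Disjoint U V) (hU' : IsCategorical U) (hV' : IsCategorical V) :
    LinearMap.ker (augCochains K s₀).d ≤
      Submodule.span K {augSingle s₀ 0 (vertexIndicator K V)} ⊔
        LinearMap.range (augCochains K s₀).d := ker_d_le fun n φ hφ => by
  cases n with
  | zero =>
    obtain ⟨a, ha⟩ := exists_eq_const_of_inside hU' hφ
    obtain ⟨b, hb⟩ := exists_eq_const_of_inside hV' hφ
    have φ_eq : φ = (b - a) • vertexIndicator K V + fun _ => a := funext fun σ => by
      obtain h | h := inside_or_inside_of_disjoint hU hV hUV hdisj σ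
      · simp [ha σ h, vertexIndicator_of_inside_of_disjoint hdisj h]
      · simp [hb σ h, vertexIndicator_of_inside h]
    rw [φ_eq, map_add, map_smul]
    exact add_mem (Submodule.mem_sup_left
        (Submodule.smul_mem _ _ (Submodule.mem_span_singleton_self _)))
      (Submodule.mem_sup_right (augSingle_const_mem_range_d s₀ a))
  | succ n =>
    obtain ⟨ψ, rfl⟩ := exists_coboundary_eq_of_disjoint hU hV hUV hdisj hU' hV' hφ
    exact Submodule.mem_sup_right ⟨_, d_augSingle s₀ ψ⟩

theorem eq_zero_of_d_eq_smul_vertexIndicator (hdisj : Disjoint U V) (hne : V.Nonempty)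
    (hs₀ : Inside U s₀) {c : K} {y : (augCochains K s₀).carrier}
    (h : (augCochains K s₀).d y = c • augSingle s₀ 0 (vertexIndicator K V)) : c = 0 := by
  obtain ⟨p, hp⟩ := hne
  have fst_eq (σ : Sing X _⦋0⦌) : y.1 = c * vertexIndicator K V σ := by
    rw [← d_apply_zero s₀ y σ, h, ← map_smul]
    exact congrFun (singleCochain_same _) σ
  have fst_eq_zero := fst_eq s₀
  rw [vertexIndicator_of_inside_of_disjoint hdisj hs₀, mul_zero] at fst_eq_zero
  simpa [fst_eq_zero, vertexIndicator_of_inside (inside_const hp), eq_comm] using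
    fst_eq (ofMap (ContinuousMap.const _ p))

theorem isFormal_augCochains_of_disjoint (hU : IsOpen U) (hV : IsOpen V)
    (hUV : U ∪ V = Set.univ) (hU' : IsCategorical U) (hV' : IsCategorical V)
    (hdisj : Disjoint U V) (hne : V.Nonempty) (hs₀ : Inside U s₀) :
    (augCochains K s₀).IsFormal := by
  have indicator_s₀ : vertexIndicator K V s₀ = 0 := vertexIndicator_of_inside_of_disjoint hdisj hs₀
  refine DGAlgebra.isFormal_of_idempotent (e := augSingle s₀ 0 (vertexIndicator K V))
    (augSingle_mem s₀ _) ?_ ?_ (fun _ _ => eq_zero_of_d_eq_smul_vertexIndicator hdisj hne hs₀)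
    (ker_d_le_span_sup_range hU hV hUV hdisj hU' hV')
  · rw [d_augSingle, coboundary_vertexIndicator hU hV hUV hdisj, map_zero]
  · rw [mul_augSingle_zero indicator_s₀ indicator_s₀, vertexIndicator_mul_self]

end Disjoint

theorem isFormal_augCochains (hU : IsOpen U) (hV : IsOpen V) (hUV : U ∪ V = Set.univ)
    (hU' : IsCategorical U) (hV' : IsCategorical V) (s₀ : Sing X _⦋0⦌) :
    (augCochains K s₀).IsFormal := by
  by_cases h : U = ∅ ∨ V = ∅ ∨ (U ∩ V).Nonempty
  · exact isFormal_augCochains_of_const hU hV hUV hU' hV' fun φ => exists_eq_const hUV hU' hV' h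
  push Not at h
  obtain ⟨hneU, hneV, hinter⟩ := h
  have hdisj : Disjoint U V := Set.disjoint_iff_inter_eq_empty.2 hinter
  obtain hs₀ | hs₀ := inside_or_inside_of_union_eq_univ hUV s₀
  · exact isFormal_augCochains_of_disjoint hU hV hUV hU' hV' hdisj hneV hs₀
  · exact isFormal_augCochains_of_disjoint hV hU (Set.union_comm U V ▸ hUV) hV' hU' hdisj.symm
      hneU hs₀

end Sing

theorem exists_isCategorical_cover_of_lsCat_le_one {X : Type u} [TopologicalSpace X]
    (hX : lsCat X ≤ 1) : ∃ U V : Set X, IsOpen U ∧ IsOpen V ∧ U ∪ V = Set.univ ∧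
      IsCategorical U ∧ IsCategorical V := by
  have lsCat_lt_two : lsCat X < 2 := hX.trans_lt (by exact_mod_cast one_lt_two)
  obtain ⟨_, ⟨n, rfl, W, isOpen, iUnion_eq, isCategorical⟩, hn⟩ := sInf_lt_iff.1 lsCat_lt_two
  have n_lt_two : n < 2 := by exact_mod_cast hn
  refine ⟨W 0, W (Fin.last n), isOpen _, isOpen _, Set.eq_univ_of_forall fun x => ?_,
    isCategorical _, isCategorical _⟩
  obtain ⟨i, hi⟩ := Set.mem_iUnion.1 (iUnion_eq ▸ Set.mem_univ x)
  obtain rfl | rfl : i = 0 ∨ i = Fin.last n := by grind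
  · exact Or.inl hi
  · exact Or.inr hi

theorem mainTheorem3_general {K : Type v} [Field K] {X : Type u} [TopologicalSpace X] (x₀ : X)
    (hX : lsCat X ≤ 1) : (augSingularCochains K X x₀).IsFormal := by
  obtain ⟨U, V, hU, hV, hUV, hU', hV'⟩ := exists_isCategorical_cover_of_lsCat_le_one hX
  exact Sing.isFormal_augCochains hU hV hUV hU' hV' _

theorem mainTheorem3 {K : Type v} [Field K] [CharZero K] {X : Type u} [TopologicalSpace X]
    (x₀ : X) (hX : lsCat X ≤ 1) : (augSingularCochains K X x₀).IsFormal :=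
  mainTheorem3_general x₀ hX
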